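/- **Setting.** Alice and Bob each hold $N\ge 1$ bosonic modes, with Hilbert space $L^2(\mathbb R^N)\otimes L^2(\mathbb R^N)$. For a mode with annihilation operator $\hat a$ let $\hat q=\hat a+\hat a^\dagger$, $\hat p=-i(\hat a-\hat a^\dagger)$ (so the vacuum has covariance matrix $I$) and $D_\alpha=\exp(\alpha\hat a^\dagger-\alpha^*\hat a)$. Let $|\phi_s\rangle$ be the two-mode squeezed vacuum of one mode of Alice and one mode of Bob with squeezing parameter $s\in\mathbb R$, i.e. the pure centred Gaussian state whose covariance matrix in the order $(q_1,p_1,q_2,p_2)$ is $\begin{pmatrix}\cosh 2s\, I&\sinh 2s\, Z\\ \sinh 2s\, Z&\cosh 2s\, I\end{pmatrix}$, $Z=\mathrm{diag}(1,-1)$. For $\vec r=(\vec r^1,\dots,\vec r^N)\in\mathbb R^{4N}$ with $\vec r^i=(a_i,b_i,c_i,d_i)$ let $D_{\vec r}=\bigotimes_{i=1}^N D_{a_i+ib_i}\otimes D_{c_i+id_i}$ and $\rho_{\vec r}=D_{\vec r}\,|\phi_s\rangle\langle\phi_s|^{\otimes N}D_{\vec r}^\dagger$. Fix $\sigma>0$,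 let $P(\vec r)=(2\pi\sigma^2)^{-2N}e^{-|\vec r|^2/2\sigma^2}$, $\alpha_i=(a_i-c_i)(b_i+d_i)$, and $$\rho_{\rm even}=2\int_{\{\#\{i:\alpha_i>0\}\text{ even}\}}P(\vec r)\rho_{\vec r}\,d\vec r,\qquad \rho_{\rm odd}=2\int_{\{\#\{i:\alpha_i>0\}\text{ odd}\}}P(\vec r)\rho_{\vec r}\,d\vec r .$$ A *Gaussian measurement* is a POVM with density $\Pi_{\vec y}=\pi^{-2N}D_{\vec y}\Pi_0D_{\vec y}^\dagger$, $\vec y\in\mathbb R^{4N}$, where $\Pi_0$ is a Gaussian density operator on the $2N$ modes with vanishing displacement and arbitrary covariance matrix. It is *PPT* if every $\Pi_{\vec y}$ has positive partial transpose with respect to the cut Alice$|$Bob; every Gaussian measurement implementable by local operations and classical communication (GLOCC) is PPT. With $\rho_{\rm even},\rho_{\rm odd}$ equiprobable, a measurement $\{\Pi_{\vec y}\}$ together with a measurable set $E\subseteq\mathbb R^{4N}$ (guess "even" iff $\vec y\in E$) has success probability $$P_{\rm succ}=\tfrac12\int_E\operatorname{tr}(\rho_{\rm even}\Pi_{\vec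 y})\,d\vec y+\tfrac12\int_{E^c}\operatorname{tr}(\rho_{\rm odd}\Pi_{\vec y})\,d\vec y .$$ **Theorem.** Let $\sigma>0$. 1. For all $N\ge1$ and $s\in\mathbb R$, $\rho_{\rm even}$ and $\rho_{\rm odd}$ are density operators. 2. For every $N\ge1$ and $\varepsilon>0$ there is $s_0$ such that for every $s\ge s_0$ some (in general nonlocal) Gaussian measurement with some decision set $E$ has $P_{\rm succ}\ge1-\varepsilon$. 3. For every $\varepsilon>0$ there is $N_0$ such that for all $N\ge \max(N_0,1)$, all $s\in\mathbb R$, all PPT Gaussian measurements (in particular all GLOCC measurements, acting jointly on the $N$ copies) and all measurable $E$, one has $|P_{\rm succ}-\tfrac12|\le\varepsilon$. -/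

import Mathlib

open MeasureTheory
open scoped ENNReal ComplexConjugate InnerProductSpace

noncomputable section

namespace GaussianHiding

/-- Positions of the `N` modes of one party. -/
abbrev LocalConf (N : ℕ) : Type := Fin N → ℝ

/-- Positions of all `2N` modes: first Alice's `N` modes, then Bob's `N` modes. -/
abbrev Conf (N : ℕ) : Type := LocalConf N × LocalConf N

/-- The Hilbert space `L²(ℝ^N)` of one party. -/
abbrev LocalSpace (N : ℕ) : Type := Lp ℂ 2 (volume : Measure (LocalConf N))

/-- The Hilbert space `L²(ℝ^N × ℝ^N) = L²(ℝ^N) ⊗ L²(ℝ^N)` of both parties, in the position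
representation. The quadratures of each mode are `x = a + a†` (multiplication) and
`p = -i (a - a†) = -2i d/dx`, so that `[x, p] = 2i` and the vacuum has covariance matrix `1`. -/
abbrev Space (N : ℕ) : Type := Lp ℂ 2 (volume : Measure (Conf N))

/-- Bounded operators. -/
abbrev Op (N : ℕ) : Type := Space N →L[ℂ] Space N

/-- Phase space `ℝ^{4N}`. For `r : PhaseSpace N`, the numbers `r (i, 0), r (i, 1), r (i, 2), r (i, 3)`
are `a_i, b_i, c_i, d_i`: the first two belong to Alice's mode, the last two to Bob's mode of
the `i`-th pair. -/
abbrev PhaseSpace (N : ℕ) : Type := Fin N × Fin 4 → ℝ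

/-! ### Displacement operators -/

lemma memLp_phase {N : ℕ} {θ : Conf N → ℝ} (hθ : Continuous θ) (f : Space N) :
    MemLp (fun x => Complex.exp (Complex.I * (θ x : ℂ)) * f x) 2 (volume : Measure (Conf N)) := by
  refine (Lp.memLp f).of_le ?_ ?_
  · exact AEStronglyMeasurable.mul
      (Continuous.aestronglyMeasurable (by fun_prop)) (Lp.aestronglyMeasurable f)
  · refine Filter.Eventually.of_forall fun x => ?_
    rw [norm_mul, mul_comm Complex.I, Complex.norm_exp_ofReal_mul_I, one_mul]

/-- Multiplication by the phase `exp (i θ)`, as an isometry of the Hilbert space. -/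
def phaseMul {N : ℕ} (θ : Conf N → ℝ) (hθ : Continuous θ) : Space N →ₗᵢ[ℂ] Space N where
  toFun f := (memLp_phase hθ f).toLp _
  map_add' f g := by
    rw [← MemLp.toLp_add]
    refine MemLp.toLp_congr _ _ ?_
    filter_upwards [Lp.coeFn_add f g] with x hx
    simp only [hx, Pi.add_apply]
    ring
  map_smul' c f := by
    rw [RingHom.id_apply, ← MemLp.toLp_const_smul]
    refine MemLp.toLp_congr _ _ ?_
    filter_upwards [Lp.coeFn_smul c f] with x hx
    simp only [hx, Pi.smul_apply, smul_eq_mul]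
    ring
  norm_map' f := by
    change ‖(memLp_phase hθ f).toLp _‖ = ‖f‖
    rw [Lp.norm_toLp, Lp.norm_def]
    congr 1
    refine eLpNorm_congr_norm_ae (Filter.Eventually.of_forall fun x => ?_)
    rw [norm_mul, mul_comm Complex.I, Complex.norm_exp_ofReal_mul_I, one_mul]

/-- The position shift `(2 a, 2 c)` of a displacement. -/
def shift {N : ℕ} (r : PhaseSpace N) : Conf N :=
  (fun i => 2 * r (i, 0), fun i => 2 * r (i, 2))

/-- The phase of a displacement. -/
def dispPhase {N : ℕ} (r : PhaseSpace N) (x : Conf N) : ℝ :=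
  ∑ i, (r (i, 1) * (x.1 i - r (i, 0)) + r (i, 3) * (x.2 i - r (i, 2)))

lemma continuous_dispPhase {N : ℕ} (r : PhaseSpace N) : Continuous (dispPhase r) := by
  unfold dispPhase
  fun_prop

lemma measurePreserving_shift {N : ℕ} (c : Conf N) :
    MeasurePreserving (fun x : Conf N => x - c) volume volume :=
  (measurePreserving_sub_right (volume : Measure (LocalConf N)) c.1).prod
    (measurePreserving_sub_right (volume : Measure (LocalConf N)) c.2)

/-- The displacement operator `⨂_i D_{a_i + i b_i} ⊗ D_{c_i + i d_i}` with
`D_α = exp (α a† - α* a)`. For one mode and `α = a + i b` the exponent is `i b x - 2 a d/dx`, hence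
`(D_α ψ)(x) = exp (i b (x - a)) ψ (x - 2 a)`. -/
def disp {N : ℕ} (r : PhaseSpace N) : Op N :=
  ((phaseMul (dispPhase r) (continuous_dispPhase r)).comp
    (Lp.compMeasurePreservingₗᵢ ℂ (fun x : Conf N => x - shift r)
      (measurePreserving_shift (shift r)))).toContinuousLinearMap

/-- The displacement operator acts on wave functions as it should. -/
lemma coeFn_disp {N : ℕ} (r : PhaseSpace N) (ψ : Space N) :
    (disp r ψ : Conf N → ℂ) =ᵐ[volume]
      fun x => Complex.exp (Complex.I * (dispPhase r x : ℂ)) * ψ (x - shift r) := by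
  refine (MemLp.coeFn_toLp (memLp_phase (continuous_dispPhase r)
    (Lp.compMeasurePreservingₗᵢ ℂ (fun x : Conf N => x - shift r)
      (measurePreserving_shift (shift r)) ψ))).trans ?_
  filter_upwards [Lp.coeFn_compMeasurePreserving ψ
    (measurePreserving_shift (shift r))] with x hx
  have h : (Lp.compMeasurePreservingₗᵢ ℂ (fun x : Conf N => x - shift r)
      (measurePreserving_shift (shift r)) ψ : Conf N → ℂ) x = ψ (x - shift r) := hx
  rw [h]

/-! ### Traces, density operators and Gaussian states -/

/-- `A` has trace `t`: the diagonal series converges to `t` in every orthonormal basis. -/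
def HasTrace {N : ℕ} (A : Op N) (t : ℂ) : Prop :=
  ∀ (ι : Type) (b : HilbertBasis ι ℂ (Space N)), HasSum (fun i => ⟪b i, A (b i)⟫_ℂ) t

lemma exists_basis (N : ℕ) : ∃ w : Set (Space N), Nonempty (HilbertBasis w ℂ (Space N)) :=
  let ⟨w, b, _⟩ := exists_hilbertBasis ℂ (Space N)
  ⟨w, ⟨b⟩⟩

/-- The trace of an operator. -/
def opTrace {N : ℕ} (A : Op N) : ℂ :=
  let b := (exists_basis N).choose_spec.some
  ∑' i, ⟪b i, A (b i)⟫_ℂ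

/-- The operator `opTrace` computes every trace that exists. -/
lemma HasTrace.opTrace_eq {N : ℕ} {A : Op N} {t : ℂ} (h : HasTrace A t) : opTrace A = t :=
  (h _ (exists_basis N).choose_spec.some).tsum_eq

/-- Density operators: positive operators of trace one. -/
def IsDensity {N : ℕ} (ρ : Op N) : Prop :=
  ρ.IsPositive ∧ HasTrace ρ 1

/-- The symplectic form `Ω = ⨁ [[0, 1], [-1, 0]]` applied to a vector of phase space. -/
def symp {N : ℕ} (ξ : PhaseSpace N) : PhaseSpace N :=
  fun k => ![ξ (k.1, 1), -ξ (k.1, 0), ξ (k.1, 3), -ξ (k.1, 2)] k.2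

/-- `ρ` is a Gaussian state with vanishing displacement and covariance matrix `V` (with respect to
the quadratures `x_A, p_A, x_B, p_B` of each pair of modes, the vacuum having `V = 1`):
its characteristic function `ξ ↦ tr (ρ D_ξ)` is `exp (- (Ωξ)ᵀ V (Ωξ) / 2)`. -/
def IsCenteredGaussian {N : ℕ} (ρ : Op N) (V : Matrix (Fin N × Fin 4) (Fin N × Fin 4) ℝ) : Prop :=
  V.IsSymm ∧ IsDensity ρ ∧
    ∀ ξ : PhaseSpace N,
      HasTrace (ρ * disp ξ) (Real.exp (-(symp ξ ⬝ᵥ V.mulVec (symp ξ)) / 2) : ℂ)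

/-! ### The data hiding states -/

/-- Wave function of `N` copies of the two-mode squeezed vacuum with squeezing parameter `s`:
`(x_A - x_B) / √2` has variance `exp (-2s)` and `(x_A + x_B) / √2` has variance `exp (2s)`, while
`(p_A - p_B) / √2` has variance `exp (2s)` and `(p_A + p_B) / √2` has variance `exp (-2s)`. -/
def squeezedFun (N : ℕ) (s : ℝ) (x : Conf N) : ℂ :=
  ((∏ i : Fin N, (√(2 * Real.pi))⁻¹ *
    Real.exp (-(Real.exp (2 * s) * (x.1 i - x.2 i) ^ 2
      + Real.exp (-2 * s) * (x.1 i + x.2 i) ^ 2) / 8) : ℝ) : ℂ)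

lemma memLp_squeezedFun (N : ℕ) (s : ℝ) :
    MemLp (squeezedFun N s) 2 (volume : Measure (Conf N)) := by
  have hcont : Continuous (squeezedFun N s) := by
    unfold squeezedFun
    fun_prop
  rw [memLp_two_iff_integrable_sq_norm hcont.aestronglyMeasurable]
  set m : ℝ := min (Real.exp (2 * s)) (Real.exp (-2 * s)) with hm
  have hm0 : 0 < m := lt_min (Real.exp_pos _) (Real.exp_pos _)
  have hm1 : m ≤ Real.exp (2 * s) := min_le_left _ _
  have hm2 : m ≤ Real.exp (-2 * s) := min_le_right _ _
  have hg : Integrable (fun x : LocalConf N => ∏ i : Fin N, Real.exp (-(m / 2) * x i ^ 2)) :=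
    Integrable.fintype_prod (f := fun (_ : Fin N) (t : ℝ) => Real.exp (-(m / 2) * t ^ 2))
      fun _ => integrable_exp_neg_mul_sq (half_pos hm0)
  have hG : Integrable (fun x : Conf N =>
      ((∏ _i : Fin N, ((√(2 * Real.pi))⁻¹) ^ 2) *
        ((∏ i : Fin N, Real.exp (-(m / 2) * x.1 i ^ 2)) *
          ∏ i : Fin N, Real.exp (-(m / 2) * x.2 i ^ 2)))) := (hg.mul_prod hg).const_mul _
  refine hG.mono (hcont.norm.pow 2).aestronglyMeasurable (Filter.Eventually.of_forall fun x => ?_)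
  rw [Real.norm_of_nonneg (by positivity), Real.norm_of_nonneg (by positivity)]
  unfold squeezedFun
  rw [Complex.norm_real, Real.norm_of_nonneg (by positivity), ← Finset.prod_pow,
    ← Finset.prod_mul_distrib, ← Finset.prod_mul_distrib]
  refine Finset.prod_le_prod (fun i _ => by positivity) fun i _ => ?_
  rw [mul_pow, ← Real.exp_add, ← Real.exp_nat_mul]
  refine mul_le_mul_of_nonneg_left (Real.exp_le_exp.2 ?_) (by positivity)
  push_cast
  nlinarith [mul_le_mul_of_nonneg_right hm1 (sq_nonneg (x.1 i - x.2 i)),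
    mul_le_mul_of_nonneg_right hm2 (sq_nonneg (x.1 i + x.2 i))]

/-- `N` copies of the two-mode squeezed vacuum. -/
def squeezed (N : ℕ) (s : ℝ) : Space N := (memLp_squeezedFun N s).toLp _

/-- `N` displaced two-mode squeezed states `ρ_r = ⨂_i ρ_{r^i} = D_r |φ⟩⟨φ| D_r†`. -/
def displaced {N : ℕ} (s : ℝ) (r : PhaseSpace N) : Op N :=
  disp r * InnerProductSpace.rankOne ℂ (squeezed N s) (squeezed N s)
    * ContinuousLinearMap.adjoint (disp r)

/-- Density of the centred Gaussian prior on `ℝ^{4N}` with covariance matrix `σ² 1`. -/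
def prior {N : ℕ} (σ : ℝ) (r : PhaseSpace N) : ℝ :=
  ((2 * Real.pi * σ ^ 2) ^ (2 * N))⁻¹ * Real.exp (-(∑ k, r k ^ 2) / (2 * σ ^ 2))

/-- The number of indices `i` with `α_i = (a_i - c_i) (b_i + d_i) > 0`. -/
def posCount {N : ℕ} (r : PhaseSpace N) : ℕ :=
  (Finset.univ.filter fun i : Fin N => 0 < (r (i, 0) - r (i, 2)) * (r (i, 1) + r (i, 3))).card

/-- The state `ρ_even`. -/
def rhoEven (N : ℕ) (σ s : ℝ) : Op N :=
  (2 : ℝ) • ∫ r in {r : PhaseSpace N | Even (posCount r)}, prior σ r • displaced s r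

/-- The state `ρ_odd`. -/
def rhoOdd (N : ℕ) (σ s : ℝ) : Op N :=
  (2 : ℝ) • ∫ r in {r : PhaseSpace N | Odd (posCount r)}, prior σ r • displaced s r

/-! ### Gaussian measurements -/

/-- A Gaussian measurement on the `2N` modes, given by a Gaussian state with vanishing
displacement. -/
structure GaussianMeasurement (N : ℕ) where
  /-- The Gaussian state `Π₀`. -/
  seed : Op N
  /-- The covariance matrix of `Π₀`. -/
  cov : Matrix (Fin N × Fin 4) (Fin N × Fin 4) ℝ
  isGaussian : IsCenteredGaussian seed cov

/-- The effect `Π_y = π^{-2N} D_y Π₀ D_y†` of the outcome `y ∈ ℝ^{4N}` (a density with respect to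
Lebesgue measure `dy`). -/
def GaussianMeasurement.effect {N : ℕ} (M : GaussianMeasurement N) (y : PhaseSpace N) : Op N :=
  ((Real.pi ^ (2 * N))⁻¹ : ℝ) • (disp y * M.seed * ContinuousLinearMap.adjoint (disp y))

/-- The probability density `tr (ρ Π_y)` of the outcome `y` in the state `ρ`. -/
def GaussianMeasurement.density {N : ℕ} (M : GaussianMeasurement N) (ρ : Op N)
    (y : PhaseSpace N) : ℝ :=
  (opTrace (ρ * M.effect y)).re

/-- The success probability when `ρ₀` or `ρ₁` is sent with probability `1/2` each, the measurement
`M` is performed, and the receiver guesses `ρ₀` if the outcome lies in `E` and `ρ₁` otherwise. -/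
def GaussianMeasurement.success {N : ℕ} (M : GaussianMeasurement N) (ρ₀ ρ₁ : Op N)
    (E : Set (PhaseSpace N)) : ℝ :=
  (1 / 2) * (∫ y in E, M.density ρ₀ y) + (1 / 2) * ∫ y in Eᶜ, M.density ρ₁ y

lemma memLp_tensor {N : ℕ} (u v : LocalSpace N) :
    MemLp (fun x : Conf N => u x.1 * v x.2) 2 (volume : Measure (Conf N)) := by
  have hu := Lp.memLp u
  have hv := Lp.memLp v
  have hm : AEStronglyMeasurable (fun x : Conf N => u x.1 * v x.2) volume :=
    hu.1.comp_fst.mul hv.1.comp_snd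
  rw [memLp_two_iff_integrable_sq_norm hm]
  have h := ((memLp_two_iff_integrable_sq_norm hu.1).1 hu).mul_prod
    ((memLp_two_iff_integrable_sq_norm hv.1).1 hv)
  refine h.congr (Filter.Eventually.of_forall fun x => ?_)
  simp only [norm_mul, mul_pow]

/-- The product vector `u ⊗ v` of a vector of Alice and a vector of Bob. -/
def tensor {N : ℕ} (u v : LocalSpace N) : Space N := (memLp_tensor u v).toLp _

/-- `A` has positive partial transpose with respect to Alice | Bob. In the position basis the
transpose `B ↦ Bᵀ` satisfies `⟪v, Bᵀ w⟫ = ⟪w̄, B v̄⟫`, so the partial transpose `A^Γ` on Bob's side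
satisfies `⟪u ⊗ v̄, A^Γ (u' ⊗ v̄')⟫ = ⟪u ⊗ v', A (u' ⊗ v)⟫`; the condition says that
`⟪Φ, A^Γ Φ⟫ ≥ 0` for all finite sums `Φ = ∑ k, u k ⊗ conj (v k)`. -/
def IsPPT {N : ℕ} (A : Op N) : Prop :=
  ∀ (n : ℕ) (u v : Fin n → LocalSpace N),
    0 ≤ (∑ k, ∑ l, ⟪tensor (u k) (v l), A (tensor (u l) (v k))⟫_ℂ).re

/-- The measurement is PPT: every effect has positive partial transpose. Every measurement that
can be implemented by local operations and classical communication has this property. -/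
def GaussianMeasurement.PPT {N : ℕ} (M : GaussianMeasurement N) : Prop :=
  ∀ y, IsPPT (M.effect y)

end GaussianHiding

end

open GaussianHiding

noncomputable section

namespace GaussianHiding

open Filter Topology ProbabilityTheory
open scoped ComplexOrder NNReal

variable {N : ℕ}

/-! A Gaussian measurement of displaced squeezed states is a classical additive channel: the
displacement minus the outcome has a law `noise` that does not depend on the displacement
(`inner_effect`, `success_eq`). Plancherel's theorem gives the orthogonality relation
`lintegral_enorm_sq_inner_disp`. Averaging an operator over all displacements therefore yields a
scalar, π^{2N} times its trace (`HasTwirl`). Applied to the seed, this shows that the noise is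
Gaussian with covariance (V_s + V)/4, where V_s and V are the covariance matrices of the squeezed
vacuum and of the seed (`integral_cexp_noise`). What remains is to read the parity, up to a global
sign the product of the signs of all a_i - c_i and b_i + d_i, through this noise.

Both operators are states because reversing the positions of one pair preserves the prior and
exchanges even and odd, so each case has probability 1/2.

The variables a_i - c_i and b_i + d_i correspond to commuting quadratures, so both can be measured
sharply. If the seed is the squeezed vacuum itself, each of them suffers noise of variance e^{-2s}.
Chebyshev's inequality and a union bound then show that the parity is read correctly with
probability tending to 1 (`one_sub_errBound_le`, `exists_forall_le_success`).

Partial transposition destroys this commutation. Testing the PPT condition on displaced product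
vectors and averaging gives a positive semidefinite kernel, and its second-order expansion is an
uncertainty relation (`PPT.uncertainty`). Hence the noise cannot be small in both variables of any
pair. Since the noise of different pairs may be correlated, one cannot argue pair by pair. Instead
`exists_noise_direction` finds a single vector w with w wᵀ below the noise covariance, with |w|² at
most θ, and with total overlap Σ (|a_i - c_i| + |b_i + d_i|) of order √N.

Such a w means that the noise contains an independent standard Gaussian multiple of w
(`exists_eq_map_add_smul`), so every decision probability is smoothed along w. Moving the smoothing
onto the sign product and estimating its second moment (`abs_integral_smoothing_le`) leaves the
correlations of translates of the sign product by g w and g' w. After a rotation these factor over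
2N independent coordinates and decay like exp(-(overlap) · rate(g, g')), with positive rate for g ≠
g'. The resulting bound depends on N only through the overlap, so it is uniform in the squeezing,
the measurement and the decision set. -/

/-! ### The algebra of displacement operators -/

/-- The symplectic form on phase space that governs the products of displacement operators. -/
def sform (r r' : PhaseSpace N) : ℝ :=
  ∑ i, (r (i, 1) * r' (i, 0) - r (i, 0) * r' (i, 1) + (r (i, 3) * r' (i, 2) - r (i, 2) * r' (i, 3)))

/-- The phase factor `exp (i t)`. -/
def phase (t : ℝ) : ℂ := Complex.exp (Complex.I * (t : ℂ))

lemma phase_add (s t : ℝ) : phase (s + t) = phase s * phase t := by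
  simp [phase, mul_add, Complex.exp_add]

@[simp] lemma phase_zero : phase 0 = 1 := by simp [phase]

lemma norm_phase (t : ℝ) : ‖phase t‖ = 1 := by
  rw [phase, mul_comm, Complex.norm_exp_ofReal_mul_I]

lemma conj_phase (t : ℝ) : conj (phase t) = phase (-t) := by
  simp [phase, ← Complex.exp_conj]

lemma continuous_phase : Continuous phase := by
  unfold phase
  fun_prop

lemma sform_neg_right (x r : PhaseSpace N) : sform x (-r) = -sform x r := by
  simp only [sform, ← Finset.sum_neg_distrib, Pi.neg_apply]
  exact Finset.sum_congr rfl fun i _ => by ring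

lemma sform_swap (r r' : PhaseSpace N) : sform r r' = -sform r' r := by
  simp only [sform, ← Finset.sum_neg_distrib]
  exact Finset.sum_congr rfl fun i _ => by ring

lemma sform_self (r : PhaseSpace N) : sform r r = 0 := by
  have := sform_swap r r
  linarith

lemma sform_eq_neg_dotProduct (z r : PhaseSpace N) : sform z r = -(z ⬝ᵥ symp r) := by
  simp only [dotProduct, symp, Fintype.sum_prod_type, Fin.sum_univ_four, sform,
    ← Finset.sum_neg_distrib]
  refine Finset.sum_congr rfl fun i _ => ?_
  simp
  ring

lemma shift_add (r r' : PhaseSpace N) : shift (r + r') = shift r + shift r' := by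
  ext i <;> simp [shift] <;> ring

lemma continuous_shift : Continuous (shift : PhaseSpace N → Conf N) := by
  unfold shift
  fun_prop

lemma dispPhase_add_comp (r r' : PhaseSpace N) (x : Conf N) :
    dispPhase r x + dispPhase r' (x - shift r) = sform r r' + dispPhase (r + r') x := by
  simp only [dispPhase, sform, shift, ← Finset.sum_add_distrib, Pi.add_apply, Prod.fst_sub,
    Prod.snd_sub, Pi.sub_apply]
  exact Finset.sum_congr rfl fun i _ => by ring

lemma disp_disp_apply (r r' : PhaseSpace N) (ψ : Space N) :
    disp r (disp r' ψ) = phase (sform r r') • disp (r + r') ψ := by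
  refine Lp.ext ?_
  have h1 := (measurePreserving_shift (shift r)).quasiMeasurePreserving.ae_eq_comp
    (coeFn_disp r' ψ)
  filter_upwards [coeFn_disp r (disp r' ψ), h1, Lp.coeFn_smul (phase (sform r r'))
    (disp (r + r') ψ), coeFn_disp (r + r') ψ] with x h2 h3 h4 h5
  simp only [Function.comp_apply] at h3
  rw [h2, h3, h4, Pi.smul_apply, h5, smul_eq_mul, ← mul_assoc, ← mul_assoc, shift_add,
    sub_sub, ← Complex.exp_add, phase, ← Complex.exp_add, ← mul_add, ← mul_add,
    ← Complex.ofReal_add, ← Complex.ofReal_add, dispPhase_add_comp]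

lemma disp_mul_disp (r r' : PhaseSpace N) :
    disp r * disp r' = phase (sform r r') • disp (r + r') := by
  ext1 ψ
  exact disp_disp_apply r r' ψ

@[simp] lemma disp_zero : disp (0 : PhaseSpace N) = 1 := by
  ext1 ψ
  refine Lp.ext ?_
  filter_upwards [coeFn_disp (0 : PhaseSpace N) ψ] with x h
  have h0 : shift (0 : PhaseSpace N) = 0 := by ext i <;> simp [shift]
  rw [h, h0]
  simp [dispPhase]

lemma disp_mul_disp_neg (r : PhaseSpace N) : disp r * disp (-r) = 1 := by
  rw [disp_mul_disp, sform_neg_right, sform_self, neg_zero, phase_zero, one_smul, add_neg_cancel,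
    disp_zero]

lemma disp_neg_mul_disp (r : PhaseSpace N) : disp (-r) * disp r = 1 := by
  simpa using disp_mul_disp_neg (-r)

@[simp] lemma norm_disp_apply (r : PhaseSpace N) (ψ : Space N) : ‖disp r ψ‖ = ‖ψ‖ :=
  LinearIsometry.norm_map ((phaseMul (dispPhase r) (continuous_dispPhase r)).comp
    (Lp.compMeasurePreservingₗᵢ ℂ (fun x : Conf N => x - shift r)
      (measurePreserving_shift (shift r)))) ψ

lemma inner_disp_disp (r : PhaseSpace N) (ψ χ : Space N) : ⟪disp r ψ, disp r χ⟫_ℂ = ⟪ψ, χ⟫_ℂ :=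
  LinearIsometry.inner_map_map ((phaseMul (dispPhase r) (continuous_dispPhase r)).comp
    (Lp.compMeasurePreservingₗᵢ ℂ (fun x : Conf N => x - shift r)
      (measurePreserving_shift (shift r)))) ψ χ

lemma disp_disp_neg_apply (r : PhaseSpace N) (ψ : Space N) : disp r (disp (-r) ψ) = ψ :=
  congrArg (fun T : Op N => T ψ) (disp_mul_disp_neg r)

lemma disp_neg_disp_apply (r : PhaseSpace N) (ψ : Space N) : disp (-r) (disp r ψ) = ψ :=
  congrArg (fun T : Op N => T ψ) (disp_neg_mul_disp r)

@[simp] lemma adjoint_disp (r : PhaseSpace N) :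
    ContinuousLinearMap.adjoint (disp r) = disp (-r) := by
  symm
  rw [ContinuousLinearMap.eq_adjoint_iff]
  intro x y
  rw [← inner_disp_disp r, disp_disp_neg_apply]

/-- Displacement operators as unitary equivalences. -/
def dispEquiv (r : PhaseSpace N) : Space N ≃ₗᵢ[ℂ] Space N where
  toFun := disp r
  map_add' := map_add _
  map_smul' := map_smul _
  invFun := disp (-r)
  left_inv := disp_neg_disp_apply r
  right_inv := disp_disp_neg_apply r
  norm_map' := norm_disp_apply r

@[simp] lemma dispEquiv_apply (r : PhaseSpace N) (ψ : Space N) : dispEquiv r ψ = disp r ψ := rfl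

/-- Conjugating a displacement by another multiplies it by a character of phase space. This is how
characteristic functions of the noise arise from operators. -/
lemma disp_comm_apply (z r : PhaseSpace N) (ψ : Space N) :
    disp z (disp r ψ) = phase (2 * sform z r) • disp r (disp z ψ) := by
  rw [disp_disp_apply, disp_disp_apply, smul_smul, ← phase_add, add_comm r z, sform_swap r z]
  congr 2
  ring

/-! ### Strong continuity -/

lemma continuous_dispPhase_left (x : Conf N) : Continuous fun r : PhaseSpace N => dispPhase r x := by
  unfold dispPhase
  fun_prop

lemma tendsto_phaseMul (ψ : Space N) (r₀ : PhaseSpace N) :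
    Tendsto (fun r => phaseMul (dispPhase r) (continuous_dispPhase r) ψ) (𝓝 r₀)
      (𝓝 (phaseMul (dispPhase r₀) (continuous_dispPhase r₀) ψ)) := by
  rw [Lp.tendsto_Lp_iff_tendsto_eLpNorm']
  have hmain : Tendsto (fun r => ∫⁻ x, ‖(phase (dispPhase r x) - phase (dispPhase r₀ x)) * ψ x‖ₑ ^ 2)
      (𝓝 r₀) (𝓝 (∫⁻ _ : Conf N, 0)) := by
    refine tendsto_lintegral_filter_of_dominated_convergence (fun x => 4 * ‖ψ x‖ₑ ^ 2) ?_ ?_ ?_ ?_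
    · refine Eventually.of_forall fun r => ?_
      have h : StronglyMeasurable
          (fun x => (phase (dispPhase r x) - phase (dispPhase r₀ x)) * ψ x) := by
        refine StronglyMeasurable.mul (Continuous.stronglyMeasurable ?_) (Lp.stronglyMeasurable ψ)
        exact (continuous_phase.comp (continuous_dispPhase r)).sub
          (continuous_phase.comp (continuous_dispPhase r₀))
      exact h.enorm.pow_const 2
    · refine Eventually.of_forall fun r => Eventually.of_forall fun x => ?_
      rw [enorm_mul, mul_pow]
      gcongr
      have h : ‖phase (dispPhase r x) - phase (dispPhase r₀ x)‖ₑ ≤ 2 := by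
        refine (enorm_sub_le).trans ?_
        rw [← ofReal_norm, ← ofReal_norm, norm_phase, norm_phase]
        norm_num
      calc _ ≤ (2 : ℝ≥0∞) ^ 2 := by gcongr
        _ = 4 := by norm_num
    · rw [lintegral_const_mul' _ _ (by norm_num)]
      refine ENNReal.mul_ne_top (by norm_num) ?_
      have := (Lp.memLp ψ).2
      rw [eLpNorm_lt_top_iff_lintegral_rpow_enorm_lt_top (by norm_num) (by norm_num)] at this
      simpa using this.ne
    · refine Eventually.of_forall fun x => ?_
      have : Continuous fun r => ‖(phase (dispPhase r x) - phase (dispPhase r₀ x)) * ψ x‖ₑ ^ 2 := by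
        have h := continuous_phase.comp (continuous_dispPhase_left x)
        exact (ENNReal.continuous_pow 2).comp
          (continuous_enorm.comp ((h.sub continuous_const).mul continuous_const))
      simpa using this.tendsto r₀
  have h2 : ∀ r, eLpNorm (fun x => phaseMul (dispPhase r) (continuous_dispPhase r) ψ x
      - phaseMul (dispPhase r₀) (continuous_dispPhase r₀) ψ x) 2 volume
      = (∫⁻ x, ‖(phase (dispPhase r x) - phase (dispPhase r₀ x)) * ψ x‖ₑ ^ 2) ^ (1 / 2 : ℝ) := by
    intro r
    rw [eLpNorm_eq_lintegral_rpow_enorm_toReal (by norm_num) (by norm_num)]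
    congr 1
    refine lintegral_congr_ae ?_
    filter_upwards [MemLp.coeFn_toLp (memLp_phase (continuous_dispPhase r) ψ),
      MemLp.coeFn_toLp (memLp_phase (continuous_dispPhase r₀) ψ)] with x h1 h2
    have e1 : phaseMul (dispPhase r) (continuous_dispPhase r) ψ x = phase (dispPhase r x) * ψ x := h1
    have e2 : phaseMul (dispPhase r₀) (continuous_dispPhase r₀) ψ x = phase (dispPhase r₀ x) * ψ x :=
      h2
    rw [e1, e2, sub_mul]
    norm_num
  have h3 := (ENNReal.continuous_rpow_const (y := (1 / 2 : ℝ))).tendsto _ |>.comp hmain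
  simp only [lintegral_zero, one_div] at h3
  rw [ENNReal.zero_rpow_of_pos (by norm_num)] at h3
  refine h3.congr fun r => ?_
  have := h2 r
  simp only [one_div] at this
  exact this.symm

/-- Phase and shift both depend on `r`. Since the phases act isometrically, the variation of the
shift can be estimated after removing them, which leaves a varying phase on a fixed vector. -/
lemma continuous_disp_apply (ψ : Space N) : Continuous fun r : PhaseSpace N => disp r ψ := by
  rw [continuous_iff_continuousAt]
  intro r₀
  have hT : Continuous fun r : PhaseSpace N => Lp.compMeasurePreserving
      (fun x : Conf N => x - shift r) (measurePreserving_shift (shift r)) ψ := by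
    let g : PhaseSpace N → C(Conf N, Conf N) := fun r => ⟨fun x => x - shift r, by fun_prop⟩
    have hg : Continuous g := by
      refine ContinuousMap.continuous_of_continuous_uncurry _ ?_
      exact continuous_snd.sub (continuous_shift.comp continuous_fst)
    exact Continuous.compMeasurePreservingLp (f := fun _ => ψ) (g := g) continuous_const hg
      (fun r => measurePreserving_shift (shift r)) (by norm_num)
  have h1 := tendsto_phaseMul (Lp.compMeasurePreserving
      (fun x : Conf N => x - shift r₀) (measurePreserving_shift (shift r₀)) ψ) r₀
  have h2 : Tendsto (fun r => phaseMul (dispPhase r) (continuous_dispPhase r)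
      (Lp.compMeasurePreserving (fun x : Conf N => x - shift r)
        (measurePreserving_shift (shift r)) ψ - Lp.compMeasurePreserving
      (fun x : Conf N => x - shift r₀) (measurePreserving_shift (shift r₀)) ψ)) (𝓝 r₀) (𝓝 0) := by
    rw [tendsto_zero_iff_norm_tendsto_zero]
    simp only [LinearIsometry.norm_map]
    rw [← tendsto_zero_iff_norm_tendsto_zero, tendsto_sub_nhds_zero_iff]
    exact hT.tendsto r₀
  have h3 := h2.add h1
  simp only [zero_add, map_sub, sub_add_cancel] at h3
  exact h3

lemma continuous_disp_disp_apply (T : Op N) (ψ : Space N) :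
    Continuous fun r : PhaseSpace N => T (disp r ψ) :=
  T.continuous.comp (continuous_disp_apply ψ)

lemma continuous_inner_disp (T : Op N) (φ ψ : Space N) :
    Continuous fun r : PhaseSpace N => ⟪disp r φ, T (disp r ψ)⟫_ℂ :=
  (continuous_disp_apply φ).inner (continuous_disp_disp_apply T ψ)

/-! ### Plancherel's theorem and the orthogonality relation of displacement operators -/

section Plancherel

open FourierTransform SchwartzMap

variable {V : Type*} [NormedAddCommGroup V] [InnerProductSpace ℝ V] [FiniteDimensional ℝ V]
  [MeasurableSpace V] [BorelSpace V]

lemma continuous_fourier_of_integrable {G : V → ℂ} (hG : Integrable G) : Continuous (𝓕 G) :=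
  VectorFourier.fourierIntegral_continuous Real.continuous_fourierChar continuous_inner hG

/-- The Fourier integral of an integrable, square integrable function represents its `L²`
Fourier transform. -/
lemma coeFn_fourier_toLp {G : V → ℂ} (hG : Integrable G) (hG2 : MemLp G 2) :
    (𝓕 (hG2.toLp G) : Lp (α := V) ℂ 2) =ᵐ[volume] 𝓕 G := by
  refine ae_eq_of_integral_contDiff_smul_eq ?_ ?_ ?_
  · exact (Lp.memLp _).locallyIntegrable (by norm_num)
  · exact (continuous_fourier_of_integrable hG).locallyIntegrable
  -- The L² transform is known only as a tempered distribution, so both sides are paired with smooth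
  -- compactly supported functions and the transform is moved onto the test function.
  · intro g hg hgc
    have hc : HasCompactSupport (fun x => (g x : ℂ)) := hgc.comp_left (g := fun t : ℝ => (t : ℂ)) (by simp)
    have hd : ContDiff ℝ (⊤ : ℕ∞) (fun x => (g x : ℂ)) := Complex.ofRealCLM.contDiff.comp hg
    let g' : 𝓢(V, ℂ) := hc.toSchwartzMap hd
    have hg' : ∀ x, g' x = (g x : ℂ) := fun x => rfl
    have h := DFunLike.congr_fun (Lp.fourier_toTemperedDistribution_eq (hG2.toLp G)) g'
    rw [TemperedDistribution.fourier_apply] at h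
    have h0 := (Lp.toTemperedDistribution_apply (hG2.toLp G) (𝓕 g')).symm.trans
      (h.trans (Lp.toTemperedDistribution_apply (𝓕 (hG2.toLp G)) g'))
    have h2 : ∫ x, 𝓕 g' x • (hG2.toLp G) x = ∫ x, 𝓕 (g' : V → ℂ) x • G x := by
      refine integral_congr_ae ?_
      filter_upwards [hG2.coeFn_toLp] with x hx
      rw [hx, fourier_coe]
    have h3 : ∫ x, 𝓕 (g' : V → ℂ) x • G x = ∫ x, g' x • 𝓕 G x := by
      have := VectorFourier.integral_fourierIntegral_smul_eq_flip (μ := (volume : Measure V))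
        (ν := (volume : Measure V)) (L := innerₗ V) (f := (g' : V → ℂ)) (g := G)
        Real.continuous_fourierChar continuous_inner g'.integrable hG
      rw [flip_innerₗ] at this
      exact this
    rw [h2, h3] at h0
    simp only [hg', smul_eq_mul] at h0
    simpa only [Complex.real_smul] using h0.symm

lemma lintegral_enorm_sq_fourier {G : V → ℂ} (hG : Integrable G) (hG2 : MemLp G 2) :
    ∫⁻ w, ‖𝓕 G w‖ₑ ^ 2 = ∫⁻ x, ‖G x‖ₑ ^ 2 := by
  have key : ∀ f : Lp (α := V) ℂ 2, ∫⁻ x, ‖f x‖ₑ ^ 2 = ‖f‖ₑ ^ 2 := by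
    intro f
    rw [Lp.enorm_def, eLpNorm_eq_lintegral_rpow_enorm_toReal (by norm_num) (by norm_num)]
    simp only [ENNReal.toReal_ofNat, ENNReal.rpow_ofNat, one_div]
    rw [← ENNReal.rpow_natCast, ← ENNReal.rpow_mul]
    norm_num
  have hF := coeFn_fourier_toLp hG hG2
  have hn := Lp.norm_fourier_eq (hG2.toLp G)
  generalize 𝓕 (hG2.toLp G) = F at hF hn
  have h1 : ∫⁻ w, ‖𝓕 G w‖ₑ ^ 2 = ∫⁻ w, ‖F w‖ₑ ^ 2 := by
    refine lintegral_congr_ae ?_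
    filter_upwards [hF] with x hx
    rw [hx]
  have h2 : ∫⁻ w, ‖G w‖ₑ ^ 2 = ∫⁻ w, ‖(hG2.toLp G) w‖ₑ ^ 2 := by
    refine lintegral_congr_ae ?_
    filter_upwards [hG2.coeFn_toLp] with x hx
    rw [hx]
  rw [h1, h2, key, key, ← ofReal_norm, ← ofReal_norm, hn]

end Plancherel

/-! ### Plancherel's theorem in position and momentum coordinates of phase space. -/

lemma lintegral_comp_const_smul {E : Type*} [NormedAddCommGroup E] [NormedSpace ℝ E]
    [MeasurableSpace E] [BorelSpace E] [FiniteDimensional ℝ E] (μ : Measure E)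
    [μ.IsAddHaarMeasure] (f : E → ℝ≥0∞) {c : ℝ} (hc : 0 < c) :
    ∫⁻ x, f x ∂μ = ENNReal.ofReal (c ^ Module.finrank ℝ E) * ∫⁻ x, f (c • x) ∂μ := by
  have h := lintegral_map_equiv (μ := μ) f
    (Homeomorph.smulOfNeZero c hc.ne' : E ≃ₜ E).toMeasurableEquiv
  have h2 : Measure.map ((Homeomorph.smulOfNeZero c hc.ne' : E ≃ₜ E).toMeasurableEquiv) μ
      = ENNReal.ofReal (|(c ^ Module.finrank ℝ E)⁻¹|) • μ := Measure.map_addHaar_smul μ hc.ne'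
  rw [h2, lintegral_smul_measure, abs_of_pos (by positivity), smul_eq_mul] at h
  have h3 : ∫⁻ x, f (c • x) ∂μ = ENNReal.ofReal (c ^ Module.finrank ℝ E)⁻¹ * ∫⁻ x, f x ∂μ := h.symm
  rw [h3, ← mul_assoc, ← ENNReal.ofReal_mul (by positivity), mul_inv_cancel₀ (by positivity)]
  simp

instance isAddHaarMeasure_volume_conf : (volume : Measure (Conf N)).IsAddHaarMeasure :=
  Measure.prod.instIsAddHaarMeasure _ _

instance isNegInvariant_volume_conf : (volume : Measure (Conf N)).IsNegInvariant :=
  ⟨((Measure.measurePreserving_neg (volume : Measure (LocalConf N))).prod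
    (Measure.measurePreserving_neg (volume : Measure (LocalConf N)))).map_eq⟩

/-- The Euclidean scalar product of two configurations. -/
def cdot (b x : Conf N) : ℝ := ∑ i, (b.1 i * x.1 i + b.2 i * x.2 i)

lemma cdot_smul_left (c : ℝ) (b x : Conf N) : cdot (c • b) x = c * cdot b x := by
  simp only [cdot, Finset.mul_sum, Prod.smul_fst, Prod.smul_snd, Pi.smul_apply, smul_eq_mul]
  exact Finset.sum_congr rfl fun i _ => by ring

/-- Configurations as vectors of a Euclidean space. -/
def confEquiv (N : ℕ) : EuclideanSpace ℝ (Fin N ⊕ Fin N) ≃ᵐ Conf N :=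
  (MeasurableEquiv.toLp 2 (Fin N ⊕ Fin N → ℝ)).symm.trans
    (MeasurableEquiv.sumPiEquivProdPi fun _ : Fin N ⊕ Fin N => ℝ)

lemma measurePreserving_confEquiv : MeasurePreserving (confEquiv N) volume volume :=
  (volume_measurePreserving_sumPiEquivProdPi (fun _ : Fin N ⊕ Fin N => ℝ)).comp
    (EuclideanSpace.volume_preserving_symm_measurableEquiv_toLp (Fin N ⊕ Fin N))

lemma inner_eq_cdot (v w : EuclideanSpace ℝ (Fin N ⊕ Fin N)) :
    inner ℝ v w = cdot (confEquiv N w) (confEquiv N v) := by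
  rw [PiLp.inner_apply, Fintype.sum_sum_type, cdot, Finset.sum_add_distrib]
  rfl

/-- The factor comes from rescaling each of the 2N frequencies by 2π, because the unitary Fourier
transform has the kernel exp(-2πi⟨x, w⟩). -/
lemma lintegral_enorm_sq_conf {G : Conf N → ℂ} (hG : Integrable G) (hG2 : MemLp G 2) :
    ∫⁻ b : Conf N, ‖∫ x, phase (-cdot b x) * G x‖ₑ ^ 2 =
      ENNReal.ofReal ((2 * Real.pi) ^ (2 * N)) * ∫⁻ x, ‖G x‖ₑ ^ 2 := by
  have hmp := measurePreserving_confEquiv (N := N)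
  have hme : MeasurableEmbedding (confEquiv N) := (confEquiv N).measurableEmbedding
  have h := lintegral_enorm_sq_fourier (G := G ∘ confEquiv N)
    ((hmp.integrable_comp_emb hme).2 hG) (hG2.comp_measurePreserving hmp)
  have h1 : ∫⁻ x, ‖(G ∘ confEquiv N) x‖ₑ ^ 2 = ∫⁻ x, ‖G x‖ₑ ^ 2 :=
    hmp.lintegral_comp_emb hme (fun x => ‖G x‖ₑ ^ 2)
  have h2 : ∀ w, FourierTransform.fourier (G ∘ confEquiv N) w
      = ∫ x, phase (-cdot ((2 * Real.pi) • confEquiv N w) x) * G x := by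
    intro w
    rw [Real.fourier_eq', ← hmp.integral_comp hme]
    refine integral_congr_ae (Eventually.of_forall fun x => ?_)
    simp only [Function.comp_apply, smul_eq_mul, inner_eq_cdot, cdot_smul_left, phase]
    congr 2
    push_cast
    ring
  have h3 : ∫⁻ w, ‖FourierTransform.fourier (G ∘ confEquiv N) w‖ₑ ^ 2
      = ∫⁻ b : Conf N, ‖∫ x, phase (-cdot ((2 * Real.pi) • b) x) * G x‖ₑ ^ 2 := by
    simp only [h2]
    exact hmp.lintegral_comp_emb hme
      (fun b => ‖∫ x, phase (-cdot ((2 * Real.pi) • b) x) * G x‖ₑ ^ 2)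
  rw [h1, h3] at h
  rw [lintegral_comp_const_smul volume _ (c := 2 * Real.pi) (by positivity), h]
  congr 3
  simp
  ring

/-- The displacement with prescribed positions `a` and momenta `b`. -/
def phasePoint (ab : Conf N × Conf N) : PhaseSpace N :=
  fun k => ![ab.1.1 k.1, ab.2.1 k.1, ab.1.2 k.1, ab.2.2 k.1] k.2

/-- Splitting the coordinates of phase space into positions and momenta. -/
def coordEquiv (N : ℕ) : (Fin N ⊕ Fin N) ⊕ (Fin N ⊕ Fin N) ≃ Fin N × Fin 4 where
  toFun := Sum.elim (Sum.elim (fun i => (i, 0)) fun i => (i, 2))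
    (Sum.elim (fun i => (i, 1)) fun i => (i, 3))
  invFun k := ![.inl (.inl k.1), .inr (.inl k.1), .inl (.inr k.1), .inr (.inr k.1)] k.2
  left_inv := by rintro ((i | i) | (i | i)) <;> rfl
  right_inv := by rintro ⟨i, j⟩; fin_cases j <;> rfl

lemma measurePreserving_phasePoint :
    MeasurePreserving (phasePoint : Conf N × Conf N → PhaseSpace N) volume volume := by
  have h1 := (volume_measurePreserving_sumPiEquivProdPi_symm (fun _ : Fin N ⊕ Fin N => ℝ))
  have h2 := (volume_measurePreserving_sumPiEquivProdPi_symm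
    (fun _ : (Fin N ⊕ Fin N) ⊕ (Fin N ⊕ Fin N) => ℝ))
  have h3 := volume_measurePreserving_piCongrLeft (fun _ : Fin N × Fin 4 => ℝ) (coordEquiv N)
  have h := (h3.comp h2).comp (h1.prod h1)
  have he : (phasePoint : Conf N × Conf N → PhaseSpace N) =
      (MeasurableEquiv.piCongrLeft (fun _ : Fin N × Fin 4 => ℝ) (coordEquiv N) ∘
        (MeasurableEquiv.sumPiEquivProdPi
          fun _ : (Fin N ⊕ Fin N) ⊕ (Fin N ⊕ Fin N) => ℝ).symm) ∘
      Prod.map (MeasurableEquiv.sumPiEquivProdPi fun _ : Fin N ⊕ Fin N => ℝ).symm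
        (MeasurableEquiv.sumPiEquivProdPi fun _ : Fin N ⊕ Fin N => ℝ).symm := by
    funext ab
    ext k
    obtain ⟨c, rfl⟩ := (coordEquiv N).surjective k
    simp only [Function.comp_apply]
    rw [MeasurableEquiv.coe_piCongrLeft, Equiv.piCongrLeft_apply_apply]
    rcases c with (i | i) | (i | i) <;> rfl
  rw [he]
  exact h

lemma lintegral_phaseSpace {f : PhaseSpace N → ℝ≥0∞} (hf : Measurable f) :
    ∫⁻ z, f z = ∫⁻ a : Conf N, ∫⁻ b : Conf N, f (phasePoint (a, b)) := by
  rw [← measurePreserving_phasePoint.lintegral_comp hf]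
  exact lintegral_prod _ (hf.comp measurePreserving_phasePoint.measurable).aemeasurable

lemma lintegral_enorm_sq_coeFn (ψ : Space N) : ∫⁻ x, ‖ψ x‖ₑ ^ 2 = ‖ψ‖ₑ ^ 2 := by
  rw [Lp.enorm_def, eLpNorm_eq_lintegral_rpow_enorm_toReal (by norm_num) (by norm_num)]
  simp only [ENNReal.toReal_ofNat, ENNReal.rpow_ofNat, one_div]
  rw [← ENNReal.rpow_natCast, ← ENNReal.rpow_mul]
  norm_num

/-- For fixed position part, the matrix element is, up to a phase, a Fourier transform in the
momentum part. -/
lemma inner_disp_phasePoint (a b : Conf N) (φ ψ : Space N) :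
    ‖⟪disp (phasePoint (a, b)) φ, ψ⟫_ℂ‖ₑ =
      ‖∫ x, phase (-cdot b x) * (conj (φ (x - (2 : ℝ) • a)) * ψ x)‖ₑ := by
  have h : ⟪disp (phasePoint (a, b)) φ, ψ⟫_ℂ = phase (cdot b a) *
      ∫ x, phase (-cdot b x) * (conj (φ (x - (2 : ℝ) • a)) * ψ x) := by
    rw [L2.inner_def, ← integral_const_mul]
    refine integral_congr_ae ?_
    filter_upwards [coeFn_disp (phasePoint (a, b)) φ] with x hx
    have h1 : shift (phasePoint (a, b)) = (2 : ℝ) • a := by ext i <;> rfl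
    have h2 : dispPhase (phasePoint (a, b)) x = cdot b x - cdot b a := by
      simp only [dispPhase, cdot, phasePoint, ← Finset.sum_sub_distrib]
      refine Finset.sum_congr rfl fun i _ => ?_
      simp
      ring
    rw [hx, h1, RCLike.inner_apply, map_mul, h2, ← phase, conj_phase, ← mul_assoc, ← mul_assoc,
      ← mul_assoc, ← phase_add, neg_sub, ← sub_eq_add_neg]
    ring
  rw [h, enorm_mul, ← ofReal_norm (phase _), norm_phase]
  simp

/-- The orthogonality relation of displacement operators. -/
theorem lintegral_enorm_sq_inner_disp (φ ψ : Space N) :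
    ∫⁻ z : PhaseSpace N, ‖⟪disp z φ, ψ⟫_ℂ‖ₑ ^ 2 =
      ENNReal.ofReal (Real.pi ^ (2 * N)) * (‖φ‖ₑ ^ 2 * ‖ψ‖ₑ ^ 2) := by
  have hm : Measurable fun z : PhaseSpace N => ‖⟪disp z φ, ψ⟫_ℂ‖ₑ ^ 2 :=
    ((continuous_enorm.comp ((continuous_disp_apply φ).inner continuous_const)).measurable).pow_const 2
  have hφm : Measurable (φ : Conf N → ℂ) := (Lp.stronglyMeasurable φ).measurable
  have hψm : Measurable (ψ : Conf N → ℂ) := (Lp.stronglyMeasurable ψ).measurable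
  have hsub : Measurable fun p : Conf N × Conf N => p.2 - (2 : ℝ) • p.1 := by fun_prop
  -- the total mass of the shifted products
  have hT : ∫⁻ a : Conf N, ∫⁻ x, ‖conj (φ (x - (2 : ℝ) • a)) * ψ x‖ₑ ^ 2 =
      ENNReal.ofReal (((2 : ℝ) ^ (2 * N))⁻¹) * (‖φ‖ₑ ^ 2 * ‖ψ‖ₑ ^ 2) := by
    rw [lintegral_lintegral_swap]
    · have h1 : ∀ x : Conf N, ∫⁻ a : Conf N, ‖conj (φ (x - (2 : ℝ) • a)) * ψ x‖ₑ ^ 2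
          = ENNReal.ofReal (((2 : ℝ) ^ (2 * N))⁻¹) * ‖φ‖ₑ ^ 2 * ‖ψ x‖ₑ ^ 2 := by
        intro x
        simp only [enorm_mul, mul_pow, RCLike.enorm_conj]
        rw [lintegral_mul_const _ (by fun_prop)]
        congr 1
        have h2 := lintegral_comp_const_smul (volume : Measure (Conf N))
          (fun a => ‖φ (x - a)‖ₑ ^ 2) (c := 2) (by norm_num)
        rw [lintegral_sub_left_eq_self (fun a => ‖φ a‖ₑ ^ 2) x, lintegral_enorm_sq_coeFn] at h2
        rw [h2, ← mul_assoc, ← ENNReal.ofReal_mul (by positivity)]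
        have h3 : ((2 : ℝ) ^ (2 * N))⁻¹ * (2 : ℝ) ^ Module.finrank ℝ (Conf N) = 1 := by
          have : Module.finrank ℝ (Conf N) = 2 * N := by simp; ring
          rw [this]
          exact inv_mul_cancel₀ (by positivity)
        rw [h3]
        simp
      simp only [h1]
      rw [lintegral_const_mul _ (by fun_prop), lintegral_enorm_sq_coeFn, mul_assoc]
    · refine Measurable.aemeasurable ?_
      have : Measurable fun p : Conf N × Conf N => conj (φ (p.2 - (2 : ℝ) • p.1)) * ψ p.2 :=
        (Complex.continuous_conj.measurable.comp (hφm.comp hsub)).mul (hψm.comp measurable_snd)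
      exact this.enorm.pow_const 2
  -- A product of two L² functions is integrable but need not be square integrable. Finiteness of
  -- the total mass gives square integrability for almost every shift, which is enough for
  -- Plancherel.
  have hfin : ∀ᵐ a : Conf N, ∫⁻ x, ‖conj (φ (x - (2 : ℝ) • a)) * ψ x‖ₑ ^ 2 < ∞ := by
    refine ae_lt_top ?_ ?_
    · refine Measurable.lintegral_prod_right' (ν := (volume : Measure (Conf N)))
        (f := fun p : Conf N × Conf N => ‖conj (φ (p.2 - (2 : ℝ) • p.1)) * ψ p.2‖ₑ ^ 2) ?_
      have : Measurable fun p : Conf N × Conf N => conj (φ (p.2 - (2 : ℝ) • p.1)) * ψ p.2 :=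
        (Complex.continuous_conj.measurable.comp (hφm.comp hsub)).mul (hψm.comp measurable_snd)
      exact this.enorm.pow_const 2
    · rw [hT]
      refine ENNReal.mul_ne_top (by simp) (ENNReal.mul_ne_top ?_ ?_) <;>
        exact ENNReal.pow_ne_top enorm_ne_top
  rw [lintegral_phaseSpace hm]
  simp only [inner_disp_phasePoint]
  have hb : ∀ᵐ a : Conf N, ∫⁻ b : Conf N,
      ‖∫ x, phase (-cdot b x) * (conj (φ (x - (2 : ℝ) • a)) * ψ x)‖ₑ ^ 2 =
      ENNReal.ofReal ((2 * Real.pi) ^ (2 * N)) *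
        ∫⁻ x, ‖conj (φ (x - (2 : ℝ) • a)) * ψ x‖ₑ ^ 2 := by
    filter_upwards [hfin] with a ha
    have hmeas : Measurable fun x : Conf N => conj (φ (x - (2 : ℝ) • a)) * ψ x :=
      (Complex.continuous_conj.measurable.comp
        (hφm.comp (measurable_id.sub_const _))).mul hψm
    refine lintegral_enorm_sq_conf ?_ ?_
    · have h1 : MemLp (fun x => conj (φ (x - (2 : ℝ) • a))) 2 (volume : Measure (Conf N)) := by
        have := (Lp.memLp φ).comp_measurePreserving (measurePreserving_shift ((2 : ℝ) • a))
        exact this.star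
      exact h1.integrable_mul (Lp.memLp ψ)
    · refine ⟨hmeas.aestronglyMeasurable, ?_⟩
      rw [eLpNorm_lt_top_iff_lintegral_rpow_enorm_lt_top (by norm_num) (by norm_num)]
      simpa using ha
  rw [lintegral_congr_ae hb, lintegral_const_mul' _ _ (by simp), hT, ← mul_assoc,
    ← ENNReal.ofReal_mul (by positivity), mul_pow]
  congr 2
  field_simp

/-! ### Traces and averages over displacements -/

/-- Balls of radius 1/2 around the basis vectors are disjoint in a separable space. Countability is
needed to exchange sums over a basis with integrals. -/
lemma countable_of_hilbertBasis {ι : Type*} (b : HilbertBasis ι ℂ (Space N)) : Countable ι := by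
  have h : Pairwise fun i j => 1 ≤ dist (b i) (b j) := by
    intro i j hij
    have h0 : ⟪b i, b j⟫_ℂ = 0 := b.orthonormal.2 hij
    have h1 := @norm_sub_sq ℂ _ _ _ _ (b i) (b j)
    rw [h0, b.orthonormal.1, b.orthonormal.1] at h1
    rw [dist_eq_norm]
    norm_num at h1
    nlinarith [norm_nonneg (b i - b j)]
  have : Fact ((2 : ℝ≥0∞) ≠ ∞) := ⟨by norm_num⟩
  have hs : SecondCountableTopology (Space N) := inferInstance
  refine Pairwise.countable_of_isOpen_disjoint (s := fun i => Metric.ball (b i) (1 / 2)) ?_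
    (fun i => Metric.isOpen_ball) (fun i => ⟨b i, Metric.mem_ball_self (by norm_num)⟩)
  intro i j hij
  exact Metric.ball_disjoint_ball (by linarith [h hij])

lemma hasSum_norm_sq_inner {ι : Type*} (b : HilbertBasis ι ℂ (Space N)) (x : Space N) :
    HasSum (fun i => ‖⟪b i, x⟫_ℂ‖ ^ 2) (‖x‖ ^ 2) := by
  have h := (b.hasSum_inner_mul_inner x x).mapL Complex.reCLM
  convert h using 1
  · funext i
    rw [← inner_conj_symm x (b i), Complex.reCLM_apply, ← Complex.normSq_eq_conj_mul_self,
      Complex.ofReal_re, Complex.normSq_eq_norm_sq]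
  · rw [Complex.reCLM_apply]
    exact (inner_self_eq_norm_sq (𝕜 := ℂ) x).symm

lemma tsum_enorm_sq_inner {ι : Type*} (b : HilbertBasis ι ℂ (Space N)) (x : Space N) :
    ∑' i, ‖⟪b i, x⟫_ℂ‖ₑ ^ 2 = ‖x‖ₑ ^ 2 := by
  have h := hasSum_norm_sq_inner b x
  have h1 := ENNReal.ofReal_tsum_of_nonneg (f := fun i => ‖⟪b i, x⟫_ℂ‖ ^ 2)
    (fun i => by positivity) h.summable
  rw [h.tsum_eq, ENNReal.ofReal_pow (norm_nonneg _), ofReal_norm] at h1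
  rw [h1]
  refine tsum_congr fun i => ?_
  rw [ENNReal.ofReal_pow (norm_nonneg _), ofReal_norm]

/-- The image of a Hilbert basis under a unitary equivalence. -/
def mapBasis {ι : Type*} (b : HilbertBasis ι ℂ (Space N)) (U : Space N ≃ₗᵢ[ℂ] Space N) :
    HilbertBasis ι ℂ (Space N) :=
  HilbertBasis.ofRepr (U.symm.trans b.repr)

lemma mapBasis_apply {ι : Type*} (b : HilbertBasis ι ℂ (Space N)) (U : Space N ≃ₗᵢ[ℂ] Space N)
    (i : ι) : mapBasis b U i = U (b i) := by
  classical
  rw [← HilbertBasis.repr_symm_single, ← HilbertBasis.repr_symm_single]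
  rfl

lemma HasTrace.add {A B : Op N} {s t : ℂ} (hA : HasTrace A s) (hB : HasTrace B t) :
    HasTrace (A + B) (s + t) := by
  intro ι b
  simpa [inner_add_right] using (hA ι b).add (hB ι b)

lemma HasTrace.smul {A : Op N} {t : ℂ} (c : ℂ) (hA : HasTrace A t) :
    HasTrace (c • A) (c * t) := by
  intro ι b
  simpa [inner_smul_right] using (hA ι b).mul_left c

/-- Cyclicity of the trace without any trace class theory: the diagonal series of the left side in
the basis `b` is that of `A * (disp r' * disp (-r))` in the displaced basis, and `HasTrace` covers
every basis. -/
lemma HasTrace.disp_conj {A : Op N} {t : ℂ} {r r' : PhaseSpace N}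
    (h : HasTrace (A * (disp r' * disp (-r))) t) :
    HasTrace (ContinuousLinearMap.adjoint (disp r) * A * disp r') t := by
  intro ι b
  refine (h ι (mapBasis b (dispEquiv r))).congr_fun fun i => ?_
  simp only [mapBasis_apply, dispEquiv_apply, mul_apply_eq_comp,
    ContinuousLinearMap.adjoint_inner_right, disp_neg_disp_apply]

/-- `T` has trace `t`, and the average of `T` over all displacements is `π^{2N} t`. -/
def HasTwirl (T : Op N) (t : ℂ) : Prop :=
  HasTrace T t ∧ ∀ φ φ' : Space N, Integrable (fun z : PhaseSpace N => ⟪disp z φ, T (disp z φ')⟫_ℂ) ∧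
    ∫ z : PhaseSpace N, ⟪disp z φ, T (disp z φ')⟫_ℂ = (Real.pi : ℂ) ^ (2 * N) * t * ⟪φ, φ'⟫_ℂ

lemma HasTwirl.add {A B : Op N} {s t : ℂ} (hA : HasTwirl A s) (hB : HasTwirl B t) :
    HasTwirl (A + B) (s + t) := by
  refine ⟨hA.1.add hB.1, fun φ φ' => ?_⟩
  obtain ⟨i1, e1⟩ := hA.2 φ φ'
  obtain ⟨i2, e2⟩ := hB.2 φ φ'
  simp only [add_apply, inner_add_right]
  refine ⟨i1.add i2, ?_⟩
  rw [integral_add i1 i2, e1, e2]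
  ring

lemma HasTwirl.smul {A : Op N} {t : ℂ} (c : ℂ) (hA : HasTwirl A t) :
    HasTwirl (c • A) (c * t) := by
  refine ⟨hA.1.smul c, fun φ φ' => ?_⟩
  obtain ⟨i1, e1⟩ := hA.2 φ φ'
  simp only [smul_apply, inner_smul_right]
  refine ⟨i1.const_mul c, ?_⟩
  rw [integral_const_mul, e1]
  ring

lemma exists_sqrt {H : Type*} [NormedAddCommGroup H] [InnerProductSpace ℂ H] [CompleteSpace H]
    {T : H →L[ℂ] H} (hT : T.IsPositive) :
    ∃ C : H →L[ℂ] H, ∀ x y : H, ⟪x, T y⟫_ℂ = ⟪C x, C y⟫_ℂ := by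
  have h0 : 0 ≤ T := (ContinuousLinearMap.nonneg_iff_isPositive T).2 hT
  refine ⟨CFC.sqrt T, fun x y => ?_⟩
  have h1 : IsSelfAdjoint (CFC.sqrt T) := IsSelfAdjoint.of_nonneg (CFC.sqrt_nonneg T)
  have h2 : CFC.sqrt T * CFC.sqrt T = T := CFC.sqrt_mul_sqrt_self T h0
  conv_lhs => rw [← h2]
  rw [mul_apply_eq_comp, ← ContinuousLinearMap.adjoint_inner_left, h1.adjoint_eq]

lemma HasTrace.nonneg {T : Op N} {t : ℂ} (hT : T.IsPositive) (h : HasTrace T t) : 0 ≤ t := by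
  have hs := h _ (exists_basis N).choose_spec.some
  exact hs.nonneg fun i => hT.inner_nonneg_right _

/-- Write T = C†C and expand ‖C D_z φ‖² by Parseval. The orthogonality relation integrates each term
to a multiple of ‖C† b_i‖², and the sum of these is the squared Hilbert–Schmidt norm of C†, equal to
that of C and hence to the trace. All terms are nonnegative, so no convergence question arises. -/
lemma lintegral_twirl {T : Op N} {t : ℂ} (hT : T.IsPositive) (h : HasTrace T t) (φ : Space N) :
    ∫⁻ z : PhaseSpace N, ENNReal.ofReal (⟪disp z φ, T (disp z φ)⟫_ℂ).re =
      ENNReal.ofReal (Real.pi ^ (2 * N) * t.re * ‖φ‖ ^ 2) := by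
  obtain ⟨C, hC⟩ := exists_sqrt hT
  let b := (exists_basis N).choose_spec.some
  have hcount := countable_of_hilbertBasis b
  have hsq : ∀ x : Space N, ENNReal.ofReal (⟪x, T x⟫_ℂ).re = ‖C x‖ₑ ^ 2 := by
    intro x
    rw [hC, ← ofReal_norm, ← ENNReal.ofReal_pow (norm_nonneg _)]
    congr 1
    exact inner_self_eq_norm_sq (𝕜 := ℂ) (C x)
  have h1 : ∀ z : PhaseSpace N, ENNReal.ofReal (⟪disp z φ, T (disp z φ)⟫_ℂ).re =
      ∑' i, ‖⟪disp z φ, ContinuousLinearMap.adjoint C (b i)⟫_ℂ‖ₑ ^ 2 := by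
    intro z
    rw [hsq, ← tsum_enorm_sq_inner b]
    refine tsum_congr fun i => ?_
    rw [ContinuousLinearMap.adjoint_inner_right, ← inner_conj_symm, RCLike.enorm_conj]
  simp only [h1]
  rw [lintegral_tsum]
  · simp only [lintegral_enorm_sq_inner_disp]
    rw [ENNReal.tsum_mul_left, ENNReal.tsum_mul_left, ENNReal.ofReal_mul (by
      have := (Complex.nonneg_iff.1 (h.nonneg hT)).1
      positivity), ENNReal.ofReal_mul (by positivity), mul_assoc]
    congr 1
    rw [mul_comm, ENNReal.ofReal_pow (norm_nonneg _), ofReal_norm]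
    congr 1
    have hadj : ∑' i, ‖ContinuousLinearMap.adjoint C (b i)‖ₑ ^ 2 = ∑' i, ‖C (b i)‖ₑ ^ 2 := by
      have e1 : ∀ i, ‖ContinuousLinearMap.adjoint C (b i)‖ₑ ^ 2
          = ∑' j, ‖⟪b j, ContinuousLinearMap.adjoint C (b i)⟫_ℂ‖ₑ ^ 2 := fun i =>
        (tsum_enorm_sq_inner b _).symm
      have e2 : ∀ i, ‖C (b i)‖ₑ ^ 2 = ∑' j, ‖⟪b j, C (b i)⟫_ℂ‖ₑ ^ 2 := fun i =>
        (tsum_enorm_sq_inner b _).symm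
      simp only [e1, e2]
      rw [ENNReal.tsum_comm]
      refine tsum_congr fun i => tsum_congr fun j => ?_
      rw [ContinuousLinearMap.adjoint_inner_right, ← inner_conj_symm, RCLike.enorm_conj]
    rw [hadj]
    have hs := (h _ b).mapL Complex.reCLM
    simp only [Complex.reCLM_apply] at hs
    have hnn : ∀ i, 0 ≤ (⟪b i, T (b i)⟫_ℂ).re := fun i => hT.re_inner_nonneg_right _
    rw [← hs.tsum_eq, ENNReal.ofReal_tsum_of_nonneg hnn hs.summable]
    exact tsum_congr fun i => (hsq _).symm
  · intro i
    exact ((continuous_enorm.comp ((continuous_disp_apply φ).inner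
      continuous_const)).measurable.pow_const 2).aemeasurable

lemma integral_twirl_self {T : Op N} {t : ℂ} (hT : T.IsPositive) (h : HasTrace T t)
    (φ : Space N) : Integrable (fun z : PhaseSpace N => ⟪disp z φ, T (disp z φ)⟫_ℂ) ∧
      ∫ z : PhaseSpace N, ⟪disp z φ, T (disp z φ)⟫_ℂ =
        (Real.pi : ℂ) ^ (2 * N) * t * ⟪φ, φ⟫_ℂ := by
  have hre : ∀ z : PhaseSpace N, ⟪disp z φ, T (disp z φ)⟫_ℂ =
      (((⟪disp z φ, T (disp z φ)⟫_ℂ).re : ℝ) : ℂ) := fun z =>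
    Complex.eq_re_of_ofReal_le (r := 0) (by simpa using hT.inner_nonneg_right (disp z φ))
  have hnn : ∀ z : PhaseSpace N, 0 ≤ (⟪disp z φ, T (disp z φ)⟫_ℂ).re := fun z =>
    hT.re_inner_nonneg_right _
  have ht := h.nonneg hT
  have htre := (Complex.nonneg_iff.1 ht).1
  have hl := lintegral_twirl hT h φ
  have hc : Continuous fun z : PhaseSpace N => (⟪disp z φ, T (disp z φ)⟫_ℂ).re :=
    Complex.continuous_re.comp (continuous_inner_disp T φ φ)
  have hint : Integrable fun z : PhaseSpace N => (⟪disp z φ, T (disp z φ)⟫_ℂ).re := by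
    refine ⟨hc.aestronglyMeasurable, ?_⟩
    rw [hasFiniteIntegral_iff_ofReal (Eventually.of_forall hnn), hl]
    exact ENNReal.ofReal_lt_top
  have hI : ∫ z : PhaseSpace N, (⟪disp z φ, T (disp z φ)⟫_ℂ).re
      = Real.pi ^ (2 * N) * t.re * ‖φ‖ ^ 2 := by
    rw [integral_eq_lintegral_of_nonneg_ae (Eventually.of_forall hnn) hc.aestronglyMeasurable, hl,
      ENNReal.toReal_ofReal (by positivity)]
  constructor
  · rw [funext hre]
    exact hint.ofReal
  · rw [funext hre, integral_complex_ofReal, hI]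
    have h3 : t = ((t.re : ℝ) : ℂ) := Complex.eq_re_of_ofReal_le (r := 0) (by simpa using ht)
    rw [inner_self_eq_norm_sq_to_K]
    conv_rhs => rw [h3]
    push_cast
    rfl

/-- Polarization in the pair of vectors reduces the claim to equal vectors. -/
lemma HasTwirl.of_isPositive {T : Op N} {t : ℂ} (hT : T.IsPositive) (h : HasTrace T t) :
    HasTwirl T t := by
  refine ⟨h, fun φ φ' => ?_⟩
  have hpol : ∀ z : PhaseSpace N, ⟪disp z φ, T (disp z φ')⟫_ℂ =
      (⟪disp z (φ' + φ), T (disp z (φ' + φ))⟫_ℂ - ⟪disp z (φ' - φ), T (disp z (φ' - φ))⟫_ℂ +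
        Complex.I * ⟪disp z (φ' + Complex.I • φ), T (disp z (φ' + Complex.I • φ))⟫_ℂ -
        Complex.I * ⟪disp z (φ' - Complex.I • φ), T (disp z (φ' - Complex.I • φ))⟫_ℂ) / 4 := by
    intro z
    have h1 := inner_map_polarization (T : Space N →ₗ[ℂ] Space N) (disp z φ') (disp z φ)
    have hs : ∀ x y : Space N, ⟪T x, y⟫_ℂ = ⟪x, T y⟫_ℂ := fun x y =>
      hT.isSymmetric x y
    simp only [ContinuousLinearMap.coe_coe, hs] at h1
    rw [h1]
    simp only [map_add, map_sub, map_smul]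
  have hpol2 : ⟪φ, φ'⟫_ℂ =
      (⟪φ' + φ, φ' + φ⟫_ℂ - ⟪φ' - φ, φ' - φ⟫_ℂ +
        Complex.I * ⟪φ' + Complex.I • φ, φ' + Complex.I • φ⟫_ℂ -
        Complex.I * ⟪φ' - Complex.I • φ, φ' - Complex.I • φ⟫_ℂ) / 4 := by
    have h1 := inner_map_polarization (LinearMap.id : Space N →ₗ[ℂ] Space N) φ' φ
    simpa only [LinearMap.id_apply] using h1
  obtain ⟨i1, e1⟩ := integral_twirl_self hT h (φ' + φ)
  obtain ⟨i2, e2⟩ := integral_twirl_self hT h (φ' - φ)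
  obtain ⟨i3, e3⟩ := integral_twirl_self hT h (φ' + Complex.I • φ)
  obtain ⟨i4, e4⟩ := integral_twirl_self hT h (φ' - Complex.I • φ)
  rw [funext hpol, hpol2]
  have j3 := i3.const_mul Complex.I
  have j4 := i4.const_mul Complex.I
  have k2 := i1.sub i2
  have k3 := k2.add j3
  simp only [Pi.sub_def, Pi.add_def] at k2 k3
  refine ⟨(k3.sub j4).div_const 4, ?_⟩
  rw [integral_div, integral_sub k3 j4, integral_add k2 j3,
    integral_sub i1 i2, integral_const_mul, integral_const_mul, e1, e2, e3, e4]
  ring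

/-- Averages of the sandwiched operators `D_r† T D_r'`. -/
lemma HasTwirl.disp_conj {T : Op N} {t τ τ' : ℂ} (hT : T.IsPositive) (h : HasTrace T t)
    {r r' : PhaseSpace N} (hτ : HasTrace (T * (disp r' * disp (-r))) τ)
    (hτ' : HasTrace (T * (disp r * disp (-r'))) τ') :
    HasTwirl (ContinuousLinearMap.adjoint (disp r) * T * disp r') τ := by
  set A := disp r with hA
  set B := disp r' with hB
  have hAB := hτ.disp_conj
  have hBA := hτ'.disp_conj
  have hAA : HasTrace (ContinuousLinearMap.adjoint A * T * A) t :=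
    HasTrace.disp_conj (by rw [disp_mul_disp_neg, mul_one]; exact h)
  have hBB : HasTrace (ContinuousLinearMap.adjoint B * T * B) t :=
    HasTrace.disp_conj (by rw [disp_mul_disp_neg, mul_one]; exact h)
  -- The operator A†TB is not positive in general, so it is polarized too: 4 A†TB = Σ c (B + cA)†T(B
  -- + cA) over c = 1, -1, i, -i, where every summand involves a positive operator.
  have key : ∀ c : ℂ, HasTwirl (ContinuousLinearMap.adjoint (B + c • A) * T * (B + c • A))
      (t + c * τ' + conj c * (τ + c * t)) := by
    intro c
    refine HasTwirl.of_isPositive ?_ ?_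
    · have := hT.adjoint_conj (B + c • A)
      exact this
    · have e : ContinuousLinearMap.adjoint (B + c • A) * T * (B + c • A) =
          ContinuousLinearMap.adjoint B * T * B + c • (ContinuousLinearMap.adjoint B * T * A) +
          conj c • (ContinuousLinearMap.adjoint A * T * B +
            c • (ContinuousLinearMap.adjoint A * T * A)) := by
        rw [map_add, LinearIsometryEquiv.map_smulₛₗ]
        simp only [add_mul, mul_add, smul_mul_assoc, mul_smul_comm]
        module
      rw [e]
      exact (hBB.add (hBA.smul c)).add ((hAB.add (hAA.smul c)).smul _)
  have hsum := (((key 1).add ((key (-1)).smul (-1))).add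
    (((key Complex.I).smul Complex.I).add ((key (-Complex.I)).smul (-Complex.I)))).smul (1 / 4 : ℂ)
  convert hsum using 1
  · simp only [map_add, LinearIsometryEquiv.map_smulₛₗ, add_mul, mul_add, smul_mul_assoc,
      mul_smul_comm, smul_add, smul_smul, map_neg, Complex.conj_I, neg_mul, mul_neg,
      Complex.I_mul_I, neg_neg, neg_smul, one_smul]
    match_scalars <;> ring_nf <;> norm_num [Complex.I_sq]
  · simp only [map_neg, map_one, Complex.conj_I]
    linear_combination ((-τ' + τ) / 2) * Complex.I_sq

/-! ### The prior as a product of Gaussian measures -/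

lemma withDensity_prod_gaussianPDF {ι : Type*} [Fintype ι] {v : ℝ≥0} (hv : v ≠ 0) :
    (volume : Measure (ι → ℝ)).withDensity
      (fun x => ENNReal.ofReal (∏ i, gaussianPDFReal 0 v (x i))) =
      Measure.pi fun _ => gaussianReal 0 v := by
  symm
  refine Measure.pi_eq fun s hs => ?_
  rw [withDensity_apply _ (MeasurableSet.univ_pi hs)]
  have hint : Integrable fun x : ι → ℝ => ∏ i, gaussianPDFReal 0 v (x i) :=
    Integrable.fintype_prod (f := fun _ : ι => gaussianPDFReal 0 v)
      fun _ => integrable_gaussianPDFReal 0 v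
  rw [← ofReal_integral_eq_lintegral_ofReal hint.integrableOn
    (Eventually.of_forall fun x => Finset.prod_nonneg fun i _ => gaussianPDFReal_nonneg 0 v _),
    ← integral_indicator (MeasurableSet.univ_pi hs)]
  have h1 : ∀ x : ι → ℝ, (Set.univ.pi s).indicator (fun x => ∏ i, gaussianPDFReal 0 v (x i)) x =
      ∏ i, (s i).indicator (gaussianPDFReal 0 v) (x i) := by
    intro x
    by_cases hx : x ∈ Set.univ.pi s
    · rw [Set.indicator_of_mem hx]
      exact Finset.prod_congr rfl fun i _ => (Set.indicator_of_mem (hx i trivial) _).symm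
    · rw [Set.indicator_of_notMem hx]
      simp only [Set.mem_pi, Set.mem_univ, true_implies, not_forall] at hx
      obtain ⟨i, hi⟩ := hx
      exact (Finset.prod_eq_zero (Finset.mem_univ i) (Set.indicator_of_notMem hi _)).symm
  simp only [h1]
  rw [integral_fintype_prod_volume_eq_prod (f := fun i => (s i).indicator (gaussianPDFReal 0 v)),
    ENNReal.ofReal_prod_of_nonneg]
  · refine Finset.prod_congr rfl fun i _ => ?_
    rw [integral_indicator (hs i), gaussianReal_apply_eq_integral 0 hv]
  · intro i _
    exact integral_nonneg fun x => Set.indicator_nonneg (fun y _ => gaussianPDFReal_nonneg 0 v y) x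

/-- The centred Gaussian measure on phase space with covariance `σ² 1`. -/
def gaussPrior (N : ℕ) (σ : ℝ) : Measure (PhaseSpace N) :=
  Measure.pi fun _ => gaussianReal 0 (σ ^ 2).toNNReal

instance (N : ℕ) (σ : ℝ) : IsProbabilityMeasure (gaussPrior N σ) := by
  unfold gaussPrior
  infer_instance

lemma prior_eq_prod {σ : ℝ} (hσ : 0 < σ) (r : PhaseSpace N) :
    prior σ r = ∏ k, gaussianPDFReal 0 (σ ^ 2).toNNReal (r k) := by
  simp only [gaussianPDFReal, Real.coe_toNNReal _ (sq_nonneg σ), sub_zero]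
  rw [Finset.prod_mul_distrib, ← Real.exp_sum, Finset.prod_const, prior, Finset.card_univ]
  congr 1
  · have h : Fintype.card (Fin N × Fin 4) = 2 * (2 * N) := by simp; ring
    rw [h, inv_pow, pow_mul √(2 * Real.pi * σ ^ 2) 2, Real.sq_sqrt (by positivity)]
  · rw [← Finset.sum_neg_distrib, Finset.sum_div]

lemma continuous_prior (σ : ℝ) : Continuous (prior σ : PhaseSpace N → ℝ) := by
  unfold prior
  fun_prop

lemma prior_nonneg (σ : ℝ) (r : PhaseSpace N) : 0 ≤ prior σ r := by
  unfold prior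
  positivity

lemma withDensity_prior {σ : ℝ} (hσ : 0 < σ) :
    (volume : Measure (PhaseSpace N)).withDensity (fun r => ENNReal.ofReal (prior σ r)) =
      gaussPrior N σ := by
  simp only [prior_eq_prod hσ]
  refine withDensity_prod_gaussianPDF ?_
  simpa using hσ.ne'

lemma setIntegral_prior_smul {E : Type*} [NormedAddCommGroup E] [NormedSpace ℝ E] {σ : ℝ}
    (hσ : 0 < σ) (f : PhaseSpace N → E) {S : Set (PhaseSpace N)} (hS : MeasurableSet S) :
    ∫ r in S, prior σ r • f r = ∫ r in S, f r ∂gaussPrior N σ := by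
  rw [← withDensity_prior hσ, restrict_withDensity hS,
    integral_withDensity_eq_integral_toReal_smul
      (continuous_prior σ).measurable.ennreal_ofReal
      (Eventually.of_forall fun _ => ENNReal.ofReal_lt_top)]
  simp only [ENNReal.toReal_ofReal (prior_nonneg σ _)]

lemma gaussPrior_absolutelyContinuous {σ : ℝ} (hσ : 0 < σ) :
    gaussPrior N σ ≪ (volume : Measure (PhaseSpace N)) := by
  rw [← withDensity_prior hσ]
  exact withDensity_absolutelyContinuous _ _

/-! ### The parity of the number of positive products -/

/-- The difference `a_i - c_i` as a linear functional. -/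
def posDiff (i : Fin N) : PhaseSpace N →ₗ[ℝ] ℝ :=
  LinearMap.proj (R := ℝ) (φ := fun _ : Fin N × Fin 4 => ℝ) (i, 0) - LinearMap.proj (i, 2)

/-- The sum `b_i + d_i` as a linear functional. -/
def momSum (i : Fin N) : PhaseSpace N →ₗ[ℝ] ℝ :=
  LinearMap.proj (R := ℝ) (φ := fun _ : Fin N × Fin 4 => ℝ) (i, 1) + LinearMap.proj (i, 3)

lemma posDiff_apply (i : Fin N) (r : PhaseSpace N) : posDiff i r = r (i, 0) - r (i, 2) := rfl

lemma momSum_apply (i : Fin N) (r : PhaseSpace N) : momSum i r = r (i, 1) + r (i, 3) := rfl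

lemma posDiff_ne_zero (i : Fin N) : posDiff i ≠ 0 := by
  intro h
  have := congrArg (fun L : PhaseSpace N →ₗ[ℝ] ℝ => L (Pi.single (i, 0) 1)) h
  simp [posDiff_apply] at this

lemma momSum_ne_zero (i : Fin N) : momSum i ≠ 0 := by
  intro h
  have := congrArg (fun L : PhaseSpace N →ₗ[ℝ] ℝ => L (Pi.single (i, 1) 1)) h
  simp [momSum_apply] at this

lemma ae_ne_zero_of_ne_zero {L : PhaseSpace N →ₗ[ℝ] ℝ} (hL : L ≠ 0) :
    ∀ᵐ r : PhaseSpace N, L r ≠ 0 := by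
  have h := Measure.addHaar_submodule (volume : Measure (PhaseSpace N)) (LinearMap.ker L)
    (fun h => hL (LinearMap.ker_eq_top.1 h))
  exact measure_mono_null (fun r hr => by simpa using hr) h

lemma continuous_posDiff (i : Fin N) : Continuous (posDiff i) :=
  (posDiff i).continuous_of_finiteDimensional

lemma continuous_momSum (i : Fin N) : Continuous (momSum i) :=
  (momSum i).continuous_of_finiteDimensional

lemma posCount_eq_sum (r : PhaseSpace N) :
    posCount r = ∑ i, if 0 < posDiff i r * momSum i r then 1 else 0 := by
  rw [posCount, Finset.card_filter]
  rfl

lemma measurable_posCount : Measurable (posCount : PhaseSpace N → ℕ) := by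
  rw [show (posCount : PhaseSpace N → ℕ) = fun r =>
    ∑ i, if 0 < posDiff i r * momSum i r then 1 else 0 from funext posCount_eq_sum]
  refine Finset.measurable_sum _ fun i _ => Measurable.ite ?_ measurable_const measurable_const
  exact measurableSet_lt measurable_const
    ((continuous_posDiff i).mul (continuous_momSum i)).measurable

lemma measurableSet_even : MeasurableSet {r : PhaseSpace N | Even (posCount r)} :=
  measurable_posCount (Set.to_countable {n | Even n}).measurableSet

lemma measurableSet_odd : MeasurableSet {r : PhaseSpace N | Odd (posCount r)} :=
  measurable_posCount (Set.to_countable {n | Odd n}).measurableSet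

lemma compl_even : {r : PhaseSpace N | Even (posCount r)}ᶜ = {r | Odd (posCount r)} := by
  ext r
  simp

/-- Reversal of the positions of the pair `i`. -/
def flipPos (i : Fin N) (r : PhaseSpace N) : PhaseSpace N :=
  fun k => if k = (i, 0) ∨ k = (i, 2) then -r k else r k

lemma measurePreserving_flipPos (σ : ℝ) (i : Fin N) :
    MeasurePreserving (flipPos i) (gaussPrior N σ) (gaussPrior N σ) := by
  have h := measurePreserving_pi (fun _ : Fin N × Fin 4 => gaussianReal 0 (σ ^ 2).toNNReal)
    (fun _ : Fin N × Fin 4 => gaussianReal 0 (σ ^ 2).toNNReal)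
    (f := fun k x => if k = (i, 0) ∨ k = (i, 2) then -x else x) ?_
  · exact h
  · intro k
    by_cases hk : k = (i, 0) ∨ k = (i, 2)
    · simp only [hk, if_true]
      exact ⟨measurable_neg, by rw [gaussianReal_map_neg, neg_zero]⟩
    · simp only [hk, if_false]
      exact MeasurePreserving.id _

/-- The flip changes the sign of exactly one of the products, so the count changes by one. A
vanishing product would stay uncounted, hence the two hypotheses. -/
lemma even_posCount_flipPos {i : Fin N} {r : PhaseSpace N} (h1 : posDiff i r ≠ 0)
    (h2 : momSum i r ≠ 0) : Even (posCount (flipPos i r)) ↔ Odd (posCount r) := by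
  rw [posCount_eq_sum, posCount_eq_sum, ← Finset.add_sum_erase _ _ (Finset.mem_univ i),
    ← Finset.add_sum_erase _ _ (Finset.mem_univ i)]
  have hrest : ∑ j ∈ Finset.univ.erase i,
      (if 0 < posDiff j (flipPos i r) * momSum j (flipPos i r) then 1 else 0) =
      ∑ j ∈ Finset.univ.erase i, if 0 < posDiff j r * momSum j r then 1 else 0 := by
    refine Finset.sum_congr rfl fun j hj => ?_
    have hji : j ≠ i := Finset.ne_of_mem_erase hj
    have e1 : posDiff j (flipPos i r) = posDiff j r := by simp [posDiff_apply, flipPos, hji]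
    have e2 : momSum j (flipPos i r) = momSum j r := by simp [momSum_apply, flipPos, hji]
    rw [e1, e2]
  have hi1 : posDiff i (flipPos i r) = -posDiff i r := by
    simp [posDiff_apply, flipPos]
    ring
  have hi2 : momSum i (flipPos i r) = momSum i r := by
    simp [momSum_apply, flipPos]
  rw [hrest, hi1, hi2, neg_mul]
  have hne := mul_ne_zero h1 h2
  rcases lt_or_gt_of_ne hne with h | h
  · have h' : 0 < -(posDiff i r * momSum i r) := by linarith
    simp only [h', h.not_gt, if_true, if_false]
    rw [add_comm, zero_add, Nat.even_add_one, Nat.not_even_iff_odd]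
  · have h' : ¬ 0 < -(posDiff i r * momSum i r) := by linarith
    simp only [h', h, if_true, if_false]
    rw [add_comm 1, zero_add, Nat.odd_add_one, Nat.not_odd_iff_even]

lemma gaussPrior_even_eq_odd {σ : ℝ} (hσ : 0 < σ) (hN : 1 ≤ N) :
    gaussPrior N σ {r | Even (posCount r)} = gaussPrior N σ {r | Odd (posCount r)} := by
  let i : Fin N := ⟨0, hN⟩
  rw [← (measurePreserving_flipPos σ i).measure_preimage measurableSet_even.nullMeasurableSet]
  refine measure_congr ?_
  filter_upwards [gaussPrior_absolutelyContinuous hσ (ae_ne_zero_of_ne_zero (posDiff_ne_zero i)),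
    gaussPrior_absolutelyContinuous hσ (ae_ne_zero_of_ne_zero (momSum_ne_zero i))] with r h1 h2
  exact propext (even_posCount_flipPos h1 h2)

lemma gaussPrior_real_even_add_odd (σ : ℝ) :
    (gaussPrior N σ).real {r | Even (posCount r)} + (gaussPrior N σ).real {r | Odd (posCount r)}
      = 1 := by
  rw [← compl_even]
  exact probReal_add_probReal_compl measurableSet_even

lemma gaussPrior_real_even {σ : ℝ} (hσ : 0 < σ) (hN : 1 ≤ N) :
    (gaussPrior N σ).real {r | Even (posCount r)} = 1 / 2 := by
  have h1 := gaussPrior_real_even_add_odd (N := N) σ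
  rw [measureReal_def, measureReal_def, ← gaussPrior_even_eq_odd hσ hN] at h1
  rw [measureReal_def]
  linarith

lemma gaussPrior_real_odd {σ : ℝ} (hσ : 0 < σ) (hN : 1 ≤ N) :
    (gaussPrior N σ).real {r | Odd (posCount r)} = 1 / 2 := by
  linarith [gaussPrior_real_even_add_odd (N := N) σ, gaussPrior_real_even hσ hN]

/-! ### Mixtures of displaced states -/

lemma displaced_apply (s : ℝ) (r : PhaseSpace N) (ψ : Space N) :
    displaced s r ψ = ⟪disp r (squeezed N s), ψ⟫_ℂ • disp r (squeezed N s) := by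
  simp only [displaced, mul_apply_eq_comp, InnerProductSpace.rankOne_apply, map_smul,
    ContinuousLinearMap.adjoint_inner_right]

lemma displaced_eq_rankOne (s : ℝ) (r : PhaseSpace N) :
    displaced s r = InnerProductSpace.rankOne ℂ (disp r (squeezed N s)) (disp r (squeezed N s)) := by
  ext1 ψ
  rw [displaced_apply, InnerProductSpace.rankOne_apply]

lemma continuous_displaced (s : ℝ) : Continuous fun r : PhaseSpace N => displaced s r := by
  simp only [displaced_eq_rankOne]
  have h := continuous_disp_apply (N := N) (squeezed N s)
  exact (ContinuousLinearMap.smulRightL ℂ (Space N) (Space N)).continuous₂.comp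
    (((innerSL ℂ).continuous.comp h).prodMk h)

lemma norm_displaced (s : ℝ) (r : PhaseSpace N) : ‖displaced s r‖ = ‖squeezed N s‖ ^ 2 := by
  rw [displaced_eq_rankOne, InnerProductSpace.norm_rankOne, norm_disp_apply, sq]

lemma integrable_displaced (s : ℝ) (ν : Measure (PhaseSpace N)) [IsFiniteMeasure ν] :
    Integrable (fun r : PhaseSpace N => displaced s r) ν :=
  Integrable.of_bound (continuous_displaced s).aestronglyMeasurable (‖squeezed N s‖ ^ 2)
    (Eventually.of_forall fun r => (norm_displaced s r).le)

/-- The (unnormalized) mixture of displaced states with weights `ν`. -/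
def mixture (s : ℝ) (ν : Measure (PhaseSpace N)) : Op N := ∫ r, displaced s r ∂ν

lemma inner_mixture (s : ℝ) (ν : Measure (PhaseSpace N)) [IsFiniteMeasure ν] (x y : Space N) :
    ⟪x, mixture s ν y⟫_ℂ =
      ∫ r, ⟪x, disp r (squeezed N s)⟫_ℂ * ⟪disp r (squeezed N s), y⟫_ℂ ∂ν := by
  have h1 : mixture s ν y = ∫ r, displaced s r y ∂ν :=
    ContinuousLinearMap.integral_apply (integrable_displaced s ν) y
  have h2 : Integrable (fun r => displaced s r y) ν :=
    (integrable_displaced s ν).apply_continuousLinearMap y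
  rw [h1, ← integral_inner h2]
  refine integral_congr_ae (Eventually.of_forall fun r => ?_)
  simp only [displaced_apply, inner_smul_right]
  ring

lemma isPositive_mixture (s : ℝ) (ν : Measure (PhaseSpace N)) [IsFiniteMeasure ν] :
    (mixture s ν).IsPositive := by
  have key : ∀ x : Space N, ⟪x, mixture s ν x⟫_ℂ =
      ((∫ r, ‖⟪disp r (squeezed N s), x⟫_ℂ‖ ^ 2 ∂ν : ℝ) : ℂ) := by
    intro x
    rw [inner_mixture, ← integral_complex_ofReal]
    refine integral_congr_ae (Eventually.of_forall fun r => ?_)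
    simp only
    rw [← inner_conj_symm x, Complex.ofReal_pow, Complex.conj_mul']
  rw [ContinuousLinearMap.isPositive_iff_complex]
  intro x
  rw [← inner_conj_symm, key, Complex.conj_ofReal]
  exact ⟨by simp, by simpa using integral_nonneg fun r => by positivity⟩

/-- The diagonal series is summed under the integral. Each term is a product of two coefficients,
dominated by half the sum of their squares, and these are summable by Parseval for the displaced
vector and its image under T†. Hence T may be any bounded operator. -/
lemma hasTrace_mixture_mul (s : ℝ) (ν : Measure (PhaseSpace N)) [IsFiniteMeasure ν] (T : Op N) :
    HasTrace (mixture s ν * T)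
      (∫ r, ⟪disp r (squeezed N s), T (disp r (squeezed N s))⟫_ℂ ∂ν) := by
  intro ι b
  have hcount := countable_of_hilbertBasis b
  set φ := squeezed N s with hφ
  have hs1 : ∀ r : PhaseSpace N, HasSum (fun i => ‖⟪b i, disp r φ⟫_ℂ‖ ^ 2) (‖φ‖ ^ 2) := fun r => by
    have := hasSum_norm_sq_inner b (disp r φ)
    rwa [norm_disp_apply] at this
  have hs2 := fun r : PhaseSpace N =>
    hasSum_norm_sq_inner b (ContinuousLinearMap.adjoint T (disp r φ))
  simp only [mul_apply_eq_comp, inner_mixture]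
  refine hasSum_integral_of_dominated_convergence
    (fun i r => (‖⟪b i, disp r φ⟫_ℂ‖ ^ 2 +
      ‖⟪b i, ContinuousLinearMap.adjoint T (disp r φ)⟫_ℂ‖ ^ 2) / 2) ?_ ?_ ?_ ?_ ?_
  · intro i
    exact ((continuous_const.inner (continuous_disp_apply φ)).mul
      ((continuous_disp_apply φ).inner continuous_const)).aestronglyMeasurable
  · intro i
    refine Eventually.of_forall fun r => ?_
    have h1 : ‖⟪disp r φ, T (b i)⟫_ℂ‖ = ‖⟪b i, ContinuousLinearMap.adjoint T (disp r φ)⟫_ℂ‖ := by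
      rw [ContinuousLinearMap.adjoint_inner_right, norm_inner_symm]
    rw [norm_mul, h1]
    nlinarith [sq_nonneg (‖⟪b i, disp r φ⟫_ℂ‖ -
      ‖⟪b i, ContinuousLinearMap.adjoint T (disp r φ)⟫_ℂ‖)]
  · exact Eventually.of_forall fun r => (((hs1 r).add (hs2 r)).div_const 2).summable
  · have h : ∀ r : PhaseSpace N, ∑' i, (‖⟪b i, disp r φ⟫_ℂ‖ ^ 2 +
        ‖⟪b i, ContinuousLinearMap.adjoint T (disp r φ)⟫_ℂ‖ ^ 2) / 2 =
        (‖φ‖ ^ 2 + ‖ContinuousLinearMap.adjoint T (disp r φ)‖ ^ 2) / 2 := fun r =>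
      (((hs1 r).add (hs2 r)).div_const 2).tsum_eq
    rw [funext h]
    refine Integrable.of_bound (C := (‖φ‖ ^ 2 + (‖ContinuousLinearMap.adjoint T‖ * ‖φ‖) ^ 2) / 2)
      ?_ (Eventually.of_forall fun r => ?_)
    · have := (continuous_disp_disp_apply (ContinuousLinearMap.adjoint T) φ).norm.pow 2
      exact ((continuous_const.add this).div_const 2).aestronglyMeasurable
    · rw [Real.norm_of_nonneg (by positivity)]
      have := (ContinuousLinearMap.adjoint T).le_opNorm (disp r φ)
      rw [norm_disp_apply] at this
      gcongr
  · refine Eventually.of_forall fun r => ?_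
    have h := b.hasSum_inner_mul_inner (ContinuousLinearMap.adjoint T (disp r φ)) (disp r φ)
    rw [ContinuousLinearMap.adjoint_inner_left] at h
    refine h.congr_fun fun i => ?_
    rw [ContinuousLinearMap.adjoint_inner_left, mul_comm]

lemma smul_setIntegral_displaced {σ : ℝ} (hσ : 0 < σ) (s : ℝ) {S : Set (PhaseSpace N)}
    (hS : MeasurableSet S) :
    ((2 : ℝ) • ∫ r in S, prior σ r • displaced s r : Op N) =
      (2 : ℂ) • mixture s ((gaussPrior N σ).restrict S) := by
  rw [setIntegral_prior_smul hσ _ hS, mixture]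
  rw [two_smul, two_smul]

lemma isDensity_mixture {σ : ℝ} {s : ℝ} (hφ : ‖squeezed N s‖ = 1) {S : Set (PhaseSpace N)}
    (hS : (gaussPrior N σ).real S = 1 / 2) :
    IsDensity ((2 : ℂ) • mixture s ((gaussPrior N σ).restrict S)) := by
  constructor
  · exact (isPositive_mixture s _).smul_of_nonneg (by norm_num)
  · have h := (hasTrace_mixture_mul s ((gaussPrior N σ).restrict S) (1 : Op N)).smul 2
    rw [mul_one] at h
    convert h using 1
    simp only [one_apply_eq_self, inner_self_eq_norm_sq_to_K, norm_disp_apply, hφ]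
    rw [integral_const, measureReal_restrict_apply_univ, hS]
    norm_num

/-! ### The characteristic function of the two-mode squeezed vacuum -/

lemma integral_cexp_neg_quadratic {k : ℝ} (hk : 0 < k) (c d : ℂ) :
    ∫ x : ℝ, Complex.exp (-(k : ℂ) * x ^ 2 + c * x + d) =
      (√(Real.pi / k) : ℂ) * Complex.exp (d + c ^ 2 / (4 * k)) := by
  rw [integral_cexp_quadratic (by simpa using hk)]
  congr 1
  · rw [neg_neg, Real.sqrt_eq_rpow, Complex.ofReal_cpow (by positivity)]
    push_cast
    rfl
  · congr 1
    rw [mul_neg, div_neg, sub_neg_eq_add]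

/-- Two successive completions of the square. The relation A B = 1 simplifies both, and makes the
normalization independent of the squeezing. -/
lemma integral_integral_squeezed {A B : ℝ} (hA : 0 < A) (hB : 0 < B) (hAB : A * B = 1)
    (b d K : ℝ) :
    ∫ p : ℝ, ∫ q : ℝ, Complex.exp ((-(A * (p - q) ^ 2 + B * (p + q) ^ 2) / 4 + K : ℝ) +
      Complex.I * (b * p + d * q : ℝ)) =
      2 * Real.pi * Complex.exp ((K - (A * (b + d) ^ 2 + B * (b - d) ^ 2) / 4 : ℝ)) := by
  have hS : 0 < A + B := add_pos hA hB
  have hSc : ((A : ℂ) + B) ≠ 0 := by exact_mod_cast hS.ne'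
  have hABc : (A : ℂ) * B = 1 := by exact_mod_cast hAB
  have h1 : ∀ p : ℝ, ∫ q : ℝ, Complex.exp ((-(A * (p - q) ^ 2 + B * (p + q) ^ 2) / 4 + K : ℝ) +
      Complex.I * (b * p + d * q : ℝ)) = (√(Real.pi / ((A + B) / 4)) : ℂ) *
        Complex.exp (-((1 / (A + B) : ℝ) : ℂ) * p ^ 2 +
          Complex.I * (b + d * (A - B) / (A + B)) * p + (K - d ^ 2 / (A + B))) := by
    intro p
    have e : ∀ q : ℝ, ((-(A * (p - q) ^ 2 + B * (p + q) ^ 2) / 4 + K : ℝ) +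
        Complex.I * (b * p + d * q : ℝ) : ℂ) = -(((A + B) / 4 : ℝ) : ℂ) * q ^ 2 +
        ((A - B) / 2 * p + Complex.I * d) * q +
        (-(A + B) / 4 * p ^ 2 + Complex.I * b * p + K) := by
      intro q
      push_cast
      ring
    simp only [e]
    rw [integral_cexp_neg_quadratic (by positivity)]
    congr 2
    push_cast
    field_simp
    ring_nf
    rw [Complex.I_sq]
    linear_combination (-16 * (p : ℂ) ^ 2) * hABc
  simp only [h1]
  rw [integral_const_mul, integral_cexp_neg_quadratic (by positivity), ← mul_assoc]
  congr 1
  · rw [← Complex.ofReal_mul, ← Real.sqrt_mul (by positivity)]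
    have : Real.pi / ((A + B) / 4) * (Real.pi / (1 / (A + B))) = (2 * Real.pi) ^ 2 := by
      field_simp
      ring
    rw [this, Real.sqrt_sq (by positivity)]
    push_cast
    ring
  · congr 1
    push_cast
    field_simp
    rw [Complex.I_sq]
    linear_combination (4 * (d : ℂ) ^ 2) * hABc

/-- The exponent of the characteristic function of the squeezed vacuum, as a function of the
displacement. -/
def sqExponent (s : ℝ) (ξ : PhaseSpace N) : ℝ :=
  ∑ i, (Real.exp (2 * s) * ((ξ (i, 1) + ξ (i, 3)) ^ 2 + (ξ (i, 0) - ξ (i, 2)) ^ 2) +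
    Real.exp (-2 * s) * ((ξ (i, 1) - ξ (i, 3)) ^ 2 + (ξ (i, 0) + ξ (i, 2)) ^ 2)) / 4

/-- The integrand factors over the pairs of modes. Centring at the midpoint between the wave
function and its translate removes the linear terms by the parallelogram identity, and a
two-dimensional Gaussian integral remains for each pair. -/
lemma inner_disp_squeezed (s : ℝ) (ξ : PhaseSpace N) :
    ⟪squeezed N s, disp ξ (squeezed N s)⟫_ℂ = Complex.exp (-sqExponent s ξ : ℝ) := by
  set A := Real.exp (2 * s) with hA
  set B := Real.exp (-2 * s) with hB
  have hA0 : 0 < A := Real.exp_pos _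
  have hB0 : 0 < B := Real.exp_pos _
  have hAB : A * B = 1 := by rw [hA, hB, ← Real.exp_add]; simp
  let H : Fin N → ℝ → ℝ → ℂ := fun i p q =>
    (2 * Real.pi : ℂ)⁻¹ * Complex.exp ((-(A * (p - q) ^ 2 + B * (p + q) ^ 2) / 4 +
      -(A * (ξ (i, 0) - ξ (i, 2)) ^ 2 + B * (ξ (i, 0) + ξ (i, 2)) ^ 2) / 4 : ℝ) +
      Complex.I * (ξ (i, 1) * p + ξ (i, 3) * q : ℝ))
  have hpt : (fun x => ⟪squeezed N s x, disp ξ (squeezed N s) x⟫_ℂ) =ᵐ[volume]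
      fun x : Conf N => ∏ i, H i (x.1 i - ξ (i, 0)) (x.2 i - ξ (i, 2)) := by
    have h1 := (memLp_squeezedFun N s).coeFn_toLp
    have h2 := (measurePreserving_shift (shift ξ)).quasiMeasurePreserving.ae_eq_comp h1
    filter_upwards [coeFn_disp ξ (squeezed N s), h1, h2] with x h3 h4 h5
    simp only [Function.comp_apply] at h5
    change squeezed N s (x - shift ξ) = _ at h5
    change squeezed N s x = _ at h4
    have hcj : (starRingEnd ℂ) (squeezedFun N s x) = squeezedFun N s x := by
      simp only [squeezedFun, Complex.conj_ofReal]
    rw [h3, h5, h4, RCLike.inner_apply, hcj]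
    simp only [squeezedFun, dispPhase, Complex.ofReal_sum, Finset.mul_sum,
      Complex.exp_sum, Complex.ofReal_prod]
    rw [← Finset.prod_mul_distrib, ← Finset.prod_mul_distrib]
    refine Finset.prod_congr rfl fun i _ => ?_
    simp only [H]
    simp only [Complex.ofReal_mul, Complex.ofReal_exp]
    have hc : (((√(2 * Real.pi))⁻¹ : ℝ) : ℂ) * (((√(2 * Real.pi))⁻¹ : ℝ) : ℂ) =
        (2 * Real.pi : ℂ)⁻¹ := by
      rw [← Complex.ofReal_mul, ← mul_inv, Real.mul_self_sqrt (by positivity)]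
      push_cast
      rfl
    rw [← hc]
    have hr : ∀ u v w y : ℂ, u * (v * w) * (v * y) = v * v * (w * y * u) := fun _ _ _ _ => by ring
    rw [hr, ← Complex.exp_add, ← Complex.exp_add]
    congr 2
    simp only [shift, Prod.fst_sub, Prod.snd_sub, Pi.sub_apply, ← hA, ← hB]
    push_cast
    ring
  have hint : Integrable (fun x : Conf N =>
      ∏ i, H i (x.1 i - ξ (i, 0)) (x.2 i - ξ (i, 2))) := 
    (L2.integrable_inner (𝕜 := ℂ) (squeezed N s) (disp ξ (squeezed N s))).congr hpt
  rw [L2.inner_def, integral_congr_ae hpt]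
  have hfub : ∫ x : Conf N, ∏ i, H i (x.1 i - ξ (i, 0)) (x.2 i - ξ (i, 2)) =
      ∫ x : LocalConf N, ∫ y : LocalConf N, ∏ i, H i (x i - ξ (i, 0)) (y i - ξ (i, 2)) :=
    integral_prod _ hint
  rw [hfub]
  have hin : ∀ x : LocalConf N, ∫ y : LocalConf N, ∏ i, H i (x i - ξ (i, 0)) (y i - ξ (i, 2)) =
      ∏ i, ∫ t : ℝ, H i (x i - ξ (i, 0)) t := by
    intro x
    rw [integral_fintype_prod_volume_eq_prod
      (f := fun i (t : ℝ) => H i (x i - ξ (i, 0)) (t - ξ (i, 2)))]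
    exact Finset.prod_congr rfl fun i _ =>
      integral_sub_right_eq_self (fun t => H i (x i - ξ (i, 0)) t) (ξ (i, 2))
  simp only [hin]
  rw [integral_fintype_prod_volume_eq_prod
    (f := fun i (p : ℝ) => ∫ t : ℝ, H i (p - ξ (i, 0)) t)]
  rw [sqExponent, ← Finset.sum_neg_distrib, Complex.ofReal_sum, Complex.exp_sum]
  refine Finset.prod_congr rfl fun i _ => ?_
  rw [integral_sub_right_eq_self (fun p => ∫ t : ℝ, H i p t) (ξ (i, 0))]
  simp only [H]
  simp only [integral_const_mul]
  rw [integral_integral_squeezed hA0 hB0 hAB, ← mul_assoc, inv_mul_cancel₀, one_mul]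
  · congr 2
    ring
  · exact_mod_cast (by positivity : (2 * Real.pi : ℝ) ≠ 0)

lemma norm_squeezed (s : ℝ) : ‖squeezed N s‖ = 1 := by
  have h := inner_disp_squeezed (N := N) s 0
  rw [disp_zero, one_apply_eq_self, inner_self_eq_norm_sq_to_K] at h
  have h0 : sqExponent s (0 : PhaseSpace N) = 0 := by simp [sqExponent]
  rw [h0, neg_zero, Complex.ofReal_zero, Complex.exp_zero] at h
  have h2 : ‖squeezed N s‖ ^ 2 = 1 := by
    refine Complex.ofReal_injective ?_
    rw [Complex.ofReal_pow, Complex.ofReal_one]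
    exact h
  exact (pow_eq_one_iff_of_nonneg (norm_nonneg _) two_ne_zero).1 h2

/-- The covariance matrix of the two-mode squeezed vacuum. -/
def sqBlock (s : ℝ) : Matrix (Fin 4) (Fin 4) ℝ :=
  let ch := (Real.exp (2 * s) + Real.exp (-2 * s)) / 2
  let sh := (Real.exp (2 * s) - Real.exp (-2 * s)) / 2
  !![ch, 0, sh, 0; 0, ch, 0, -sh; sh, 0, ch, 0; 0, -sh, 0, ch]

/-- The covariance matrix of `N` copies of the two-mode squeezed vacuum. -/
def sqCov (N : ℕ) (s : ℝ) : Matrix (Fin N × Fin 4) (Fin N × Fin 4) ℝ :=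
  Matrix.of fun k l => if k.1 = l.1 then sqBlock s k.2 l.2 else 0

lemma isSymm_sqCov (s : ℝ) : (sqCov N s).IsSymm := by
  ext ⟨i, j⟩ ⟨i', j'⟩
  simp only [Matrix.transpose_apply, sqCov, Matrix.of_apply, eq_comm]
  congr 1
  fin_cases j <;> fin_cases j' <;> simp [sqBlock]

lemma dotProduct_sqCov (s : ℝ) (x : PhaseSpace N) :
    x ⬝ᵥ (sqCov N s).mulVec x =
      ∑ i, (Real.exp (2 * s) * ((x (i, 0) + x (i, 2)) ^ 2 + (x (i, 1) - x (i, 3)) ^ 2) +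
        Real.exp (-2 * s) * ((x (i, 0) - x (i, 2)) ^ 2 + (x (i, 1) + x (i, 3)) ^ 2)) / 2 := by
  have hmv : ∀ i j, (sqCov N s).mulVec x (i, j) = ∑ j', sqBlock s j j' * x (i, j') := by
    intro i j
    simp only [Matrix.mulVec, dotProduct, Fintype.sum_prod_type, sqCov, Matrix.of_apply, ite_mul,
      zero_mul]
    rw [Finset.sum_eq_single i]
    · simp
    · intro b _ hb
      simp [hb.symm]
    · simp
  simp only [dotProduct, Fintype.sum_prod_type, hmv]
  refine Finset.sum_congr rfl fun i _ => ?_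
  simp only [Fin.sum_univ_four, sqBlock]
  simp
  ring

lemma sqExponent_eq (s : ℝ) (ξ : PhaseSpace N) :
    -sqExponent s ξ = -(symp ξ ⬝ᵥ (sqCov N s).mulVec (symp ξ)) / 2 := by
  rw [dotProduct_sqCov, sqExponent, neg_div, Finset.sum_div]
  congr 1
  refine Finset.sum_congr rfl fun i _ => ?_
  simp [symp]
  ring

/-- The two-mode squeezed vacuum as the seed of a Gaussian measurement. -/
def squeezedMeasurement (N : ℕ) (s : ℝ) : GaussianMeasurement N where
  seed := mixture s (Measure.dirac 0)
  cov := sqCov N s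
  isGaussian := by
    have htr : ∀ T : Op N, HasTrace (mixture s (Measure.dirac 0) * T)
        ⟪squeezed N s, T (squeezed N s)⟫_ℂ := by
      intro T
      have h := hasTrace_mixture_mul (N := N) s (Measure.dirac 0) T
      rwa [integral_dirac, disp_zero, one_apply_eq_self] at h
    refine ⟨isSymm_sqCov s, ⟨isPositive_mixture s _, ?_⟩, fun ξ => ?_⟩
    · have h := htr 1
      rw [mul_one, one_apply_eq_self, inner_self_eq_norm_sq_to_K, norm_squeezed] at h
      simpa using h
    · have h := htr (disp ξ)
      rw [inner_disp_squeezed, sqExponent_eq] at h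
      exact_mod_cast h

/-! ### The noise added by a Gaussian measurement -/

namespace GaussianMeasurement

lemma isPositive_seed (M : GaussianMeasurement N) : M.seed.IsPositive := M.isGaussian.2.1.1

lemma hasTrace_seed (M : GaussianMeasurement N) : HasTrace M.seed 1 := M.isGaussian.2.1.2

lemma hasTrace_seed_mul (M : GaussianMeasurement N) (ξ : PhaseSpace N) :
    HasTrace (M.seed * disp ξ)
      (Real.exp (-(symp ξ ⬝ᵥ M.cov.mulVec (symp ξ)) / 2) : ℂ) := M.isGaussian.2.2 ξ

/-- Probability density of the difference between the displacement of the squeezed vacuum and the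
outcome of the measurement. -/
def noiseDensity (M : GaussianMeasurement N) (s : ℝ) (z : PhaseSpace N) : ℝ :=
  (Real.pi ^ (2 * N))⁻¹ * (⟪disp z (squeezed N s), M.seed (disp z (squeezed N s))⟫_ℂ).re

/-- Probability law of the difference between the displacement of the squeezed vacuum and the
outcome of the measurement. -/
def noise (M : GaussianMeasurement N) (s : ℝ) : Measure (PhaseSpace N) :=
  volume.withDensity fun z => ENNReal.ofReal (M.noiseDensity s z)

lemma noiseDensity_nonneg (M : GaussianMeasurement N) (s : ℝ) (z : PhaseSpace N) :
    0 ≤ M.noiseDensity s z :=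
  mul_nonneg (by positivity) (M.isPositive_seed.re_inner_nonneg_right _)

lemma coe_noiseDensity (M : GaussianMeasurement N) (s : ℝ) (z : PhaseSpace N) :
    (M.noiseDensity s z : ℂ) = (Real.pi ^ (2 * N) : ℂ)⁻¹ *
      ⟪disp z (squeezed N s), M.seed (disp z (squeezed N s))⟫_ℂ := by
  have h := Complex.eq_re_of_ofReal_le (r := 0)
    (by simpa using M.isPositive_seed.inner_nonneg_right (disp z (squeezed N s)))
  rw [h, noiseDensity]
  push_cast
  rfl

lemma continuous_noiseDensity (M : GaussianMeasurement N) (s : ℝ) :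
    Continuous (M.noiseDensity s) :=
  continuous_const.mul (Complex.continuous_re.comp (continuous_inner_disp _ _ _))

instance isProbabilityMeasure_noise (M : GaussianMeasurement N) (s : ℝ) :
    IsProbabilityMeasure (M.noise s) := by
  constructor
  rw [noise, withDensity_apply _ MeasurableSet.univ, Measure.restrict_univ]
  have h : ∀ z, ENNReal.ofReal (M.noiseDensity s z) = ENNReal.ofReal (Real.pi ^ (2 * N))⁻¹ *
      ENNReal.ofReal (⟪disp z (squeezed N s), M.seed (disp z (squeezed N s))⟫_ℂ).re := fun z =>
    ENNReal.ofReal_mul (by positivity)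
  simp only [h]
  rw [lintegral_const_mul' _ _ ENNReal.ofReal_ne_top,
    lintegral_twirl M.isPositive_seed M.hasTrace_seed, norm_squeezed,
    ← ENNReal.ofReal_mul (by positivity), Complex.one_re, one_pow, mul_one, mul_one,
    inv_mul_cancel₀ (by positivity), ENNReal.ofReal_one]

/-- The covariance matrix of the noise. -/
def noiseCov (M : GaussianMeasurement N) (s : ℝ) : Matrix (Fin N × Fin 4) (Fin N × Fin 4) ℝ :=
  (1 / 4 : ℝ) • (sqCov N s + M.cov)

lemma dotProduct_noiseCov (M : GaussianMeasurement N) (s : ℝ) (x y : PhaseSpace N) :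
    x ⬝ᵥ (M.noiseCov s).mulVec y =
      (x ⬝ᵥ (sqCov N s).mulVec y + x ⬝ᵥ M.cov.mulVec y) / 4 := by
  rw [noiseCov, Matrix.smul_mulVec, Matrix.add_mulVec, dotProduct_smul, dotProduct_add,
    smul_eq_mul]
  ring

lemma isSymm_noiseCov (M : GaussianMeasurement N) (s : ℝ) : (M.noiseCov s).IsSymm :=
  ((isSymm_sqCov s).add M.isGaussian.1).smul _

/-- The character of z is absorbed by writing D_z φ as a phase times D_ξ D_z D_{-ξ} φ. The average
over z then equals tr(Π₀ D_ξ)⟨φ, D_{-ξ} φ⟩, the product of the two characteristic functions, so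
covariances add. The 1/4 in `noiseCov` is there because a displacement by z moves the quadratures by
2z. -/
lemma integral_phase_noise (M : GaussianMeasurement N) (s : ℝ) (ξ : PhaseSpace N) :
    ∫ z, phase (2 * (z ⬝ᵥ symp ξ)) ∂M.noise s =
      (Real.exp (-(((2 : ℝ) • symp ξ) ⬝ᵥ (M.noiseCov s).mulVec ((2 : ℝ) • symp ξ)) / 2) : ℂ) := by
  set φ := squeezed N s with hφ
  have hdens : ∫ z, phase (2 * (z ⬝ᵥ symp ξ)) ∂M.noise s =
      ∫ z, (Real.pi ^ (2 * N) : ℂ)⁻¹ * ⟪disp z φ, (M.seed * disp ξ) (disp z (disp (-ξ) φ))⟫_ℂ := by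
    rw [noise, integral_withDensity_eq_integral_toReal_smul
      (M.continuous_noiseDensity s).measurable.ennreal_ofReal
      (Eventually.of_forall fun _ => ENNReal.ofReal_lt_top)]
    refine integral_congr_ae (Eventually.of_forall fun z => ?_)
    simp only
    rw [ENNReal.toReal_ofReal (M.noiseDensity_nonneg s z), disp_comm_apply, map_smul,
      mul_apply_eq_comp, disp_disp_neg_apply, inner_smul_right, sform_eq_neg_dotProduct,
      Complex.real_smul, coe_noiseDensity]
    have : symp (-ξ) = -symp ξ := by
      funext ⟨i, j⟩
      fin_cases j <;> simp [symp]
    rw [this, dotProduct_neg, neg_neg, mul_assoc, mul_comm (phase _)]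
  have h1 := M.hasTrace_seed_mul ξ
  have h2 := M.hasTrace_seed_mul (-ξ)
  -- The operator Π₀ D_ξ is not positive in general; taking `r = 0` makes it an instance of the
  -- sandwiched average.
  have key := HasTwirl.disp_conj M.isPositive_seed M.hasTrace_seed (r := 0) (r' := ξ)
    (by rw [neg_zero, disp_zero, mul_one]; exact h1)
    (by rw [disp_zero, one_mul]; exact h2)
  rw [adjoint_disp, neg_zero, disp_zero, one_mul] at key
  rw [hdens, integral_const_mul, (key.2 φ (disp (-ξ) φ)).2, inner_disp_squeezed, sqExponent_eq]
  have hn : symp (-ξ) = -symp ξ := by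
    funext ⟨i, j⟩
    fin_cases j <;> simp [symp]
  rw [hn, Matrix.mulVec_neg, neg_dotProduct, dotProduct_neg, neg_neg, mul_assoc,
    inv_mul_cancel_left₀, dotProduct_noiseCov]
  · rw [← Complex.ofReal_exp, ← Complex.ofReal_mul, ← Real.exp_add]
    simp only [Matrix.mulVec_smul, dotProduct_smul, smul_dotProduct, smul_eq_mul]
    congr 2
    ring
  · exact_mod_cast (by positivity : (Real.pi ^ (2 * N) : ℝ) ≠ 0)

/-- The noise is Gaussian. -/
lemma integral_cexp_noise (M : GaussianMeasurement N) (s : ℝ) (x : PhaseSpace N) :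
    ∫ z, Complex.exp ((z ⬝ᵥ x : ℝ) * Complex.I) ∂M.noise s =
      Complex.exp (-(x ⬝ᵥ (M.noiseCov s).mulVec x : ℝ) / 2) := by
  have h := M.integral_phase_noise s (-(1 / 2 : ℝ) • symp x)
  have hx : symp (-(1 / 2 : ℝ) • symp x) = (1 / 2 : ℝ) • x := by
    funext ⟨i, j⟩
    fin_cases j <;> simp [symp]
  have hx2 : (2 : ℝ) • (1 / 2 : ℝ) • x = x := by
    rw [smul_smul]
    norm_num
  rw [hx, hx2] at h
  simp only [dotProduct_smul, smul_eq_mul, phase] at h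
  convert h using 1
  · refine integral_congr_ae (Eventually.of_forall fun z => ?_)
    simp only
    rw [mul_comm Complex.I]
    congr 3
    ring
  · rw [Complex.ofReal_exp]
    push_cast
    rfl

/-! ### The success probability -/

/-- Composing D_{-y} and D_r gives D_{r-y} up to a phase, which cancels in the quadratic form. The
outcome density thus depends on `r - y` alone. -/
lemma inner_effect (M : GaussianMeasurement N) (s : ℝ) (r y : PhaseSpace N) :
    ⟪disp r (squeezed N s), M.effect y (disp r (squeezed N s))⟫_ℂ =
      (M.noiseDensity s (r - y) : ℂ) := by
  have h : disp (-y) (disp r (squeezed N s)) =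
      phase (sform (-y) r) • disp (r - y) (squeezed N s) := by
    rw [← mul_apply_eq_comp, disp_mul_disp, smul_apply, neg_add_eq_sub]
  rw [coe_noiseDensity, effect, adjoint_disp, smul_apply, mul_apply_eq_comp, mul_apply_eq_comp,
    inner_smul_right_eq_smul, Complex.real_smul]
  have h2 : ∀ w : Space N, ⟪disp r (squeezed N s), disp y w⟫_ℂ =
      ⟪disp (-y) (disp r (squeezed N s)), w⟫_ℂ := fun w => by
    rw [← adjoint_disp, ContinuousLinearMap.adjoint_inner_left]
  rw [h2, h, map_smul, inner_smul_left, inner_smul_right, ← mul_assoc (conj _),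
    ← Complex.normSq_eq_conj_mul_self, Complex.normSq_eq_norm_sq, norm_phase]
  push_cast
  ring

lemma noiseDensity_le (M : GaussianMeasurement N) (s : ℝ) (z : PhaseSpace N) :
    M.noiseDensity s z ≤ (Real.pi ^ (2 * N))⁻¹ * ‖M.seed‖ := by
  refine mul_le_mul_of_nonneg_left ?_ (by positivity)
  refine (Complex.re_le_norm _).trans ((norm_inner_le_norm _ _).trans ?_)
  refine (mul_le_mul_of_nonneg_left (M.seed.le_opNorm _) (norm_nonneg _)).trans ?_
  rw [norm_disp_apply, norm_squeezed, one_mul, mul_one]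

lemma lintegral_noiseDensity_lt_top (M : GaussianMeasurement N) (s : ℝ)
    (ν : Measure (PhaseSpace N)) [IsFiniteMeasure ν] (y : PhaseSpace N) :
    ∫⁻ r, ENNReal.ofReal (M.noiseDensity s (r - y)) ∂ν < ∞ := by
  refine (lintegral_mono fun r => ENNReal.ofReal_le_ofReal (M.noiseDensity_le s (r - y))).trans_lt ?_
  rw [lintegral_const]
  exact ENNReal.mul_lt_top ENNReal.ofReal_lt_top (measure_lt_top _ _)

lemma density_mixture (M : GaussianMeasurement N) (s : ℝ) (ν : Measure (PhaseSpace N))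
    [IsFiniteMeasure ν] (y : PhaseSpace N) :
    M.density ((2 : ℂ) • mixture s ν) y =
      2 * (∫⁻ r, ENNReal.ofReal (M.noiseDensity s (r - y)) ∂ν).toReal := by
  have h := (hasTrace_mixture_mul s ν (M.effect y)).smul 2
  rw [density, smul_mul_assoc, h.opTrace_eq]
  simp only [inner_effect]
  rw [integral_complex_ofReal, integral_eq_lintegral_of_nonneg_ae
    (Eventually.of_forall fun r => M.noiseDensity_nonneg s _)
    ((M.continuous_noiseDensity s).comp (continuous_sub_right y)).aestronglyMeasurable]
  simp

lemma measurable_noise_preimage (M : GaussianMeasurement N) (s : ℝ) {E : Set (PhaseSpace N)}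
    (hE : MeasurableSet E) : Measurable fun r => M.noise s {z | r - z ∈ E} :=
  measurable_measure_prodMk_left (ν := M.noise s)
    (s := {p : PhaseSpace N × PhaseSpace N | p.1 - p.2 ∈ E})
    ((measurable_fst.sub measurable_snd) hE)

lemma integral_density_mixture (M : GaussianMeasurement N) (s : ℝ) (ν : Measure (PhaseSpace N))
    [IsFiniteMeasure ν] {E : Set (PhaseSpace N)} (hE : MeasurableSet E) :
    ∫ y in E, M.density ((2 : ℂ) • mixture s ν) y =
      2 * ∫ r, (M.noise s).real {z | r - z ∈ E} ∂ν := by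
  have hm : Measurable fun p : PhaseSpace N × PhaseSpace N =>
      ENNReal.ofReal (M.noiseDensity s (p.2 - p.1)) :=
    ((M.continuous_noiseDensity s).comp (continuous_snd.sub continuous_fst)).measurable.ennreal_ofReal
  simp only [density_mixture, measureReal_def]
  rw [integral_const_mul, integral_toReal hm.lintegral_prod_right'.aemeasurable
      (Eventually.of_forall fun y => M.lintegral_noiseDensity_lt_top s ν y),
    integral_toReal (M.measurable_noise_preimage s hE).aemeasurable
      (Eventually.of_forall fun y => measure_lt_top _ _),
    lintegral_lintegral_swap (f := fun y r => ENNReal.ofReal (M.noiseDensity s (r - y)))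
      hm.aemeasurable]
  congr 3
  funext r
  have hset : MeasurableSet {z | r - z ∈ E} := (measurable_const.sub measurable_id) hE
  rw [noise, withDensity_apply _ hset, ← lintegral_indicator hE, ← lintegral_indicator hset,
    ← lintegral_sub_left_eq_self _ r]
  refine lintegral_congr fun y => ?_
  by_cases hy : r - y ∈ E
  · rw [Set.indicator_of_mem hy, Set.indicator_of_mem (by exact hy), sub_sub_cancel]
  · rw [Set.indicator_of_notMem hy, Set.indicator_of_notMem (by exact hy)]

lemma success_eq (M : GaussianMeasurement N) {σ : ℝ} (hσ : 0 < σ) (s : ℝ)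
    {E : Set (PhaseSpace N)} (hE : MeasurableSet E) :
    M.success (rhoEven N σ s) (rhoOdd N σ s) E =
      (∫ r in {r | Even (posCount r)}, (M.noise s).real {z | r - z ∈ E} ∂gaussPrior N σ) +
      ∫ r in {r | Odd (posCount r)}, (M.noise s).real {z | r - z ∈ Eᶜ} ∂gaussPrior N σ := by
  rw [success, rhoEven, rhoOdd, smul_setIntegral_displaced hσ s measurableSet_even,
    smul_setIntegral_displaced hσ s measurableSet_odd, integral_density_mixture M s _ hE,
    integral_density_mixture M s _ hE.compl]
  ring

end GaussianMeasurement

/-! ### The two mixtures are states. -/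

lemma isDensity_rhoEven {σ : ℝ} (hσ : 0 < σ) (hN : 1 ≤ N) (s : ℝ) : IsDensity (rhoEven N σ s) := by
  rw [rhoEven, smul_setIntegral_displaced hσ s measurableSet_even]
  exact isDensity_mixture (norm_squeezed s) (gaussPrior_real_even hσ hN)

lemma isDensity_rhoOdd {σ : ℝ} (hσ : 0 < σ) (hN : 1 ≤ N) (s : ℝ) : IsDensity (rhoOdd N σ s) := by
  rw [rhoOdd, smul_setIntegral_displaced hσ s measurableSet_odd]
  exact isDensity_mixture (norm_squeezed s) (gaussPrior_real_odd hσ hN)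

/-! ### Product vectors -/

lemma memLp_localDisp (a b : LocalConf N) (u : LocalSpace N) :
    MemLp (fun x : LocalConf N => Complex.exp (Complex.I * (∑ i, b i * (x i - a i) : ℝ)) *
      u (x - (2 : ℝ) • a)) 2 (volume : Measure (LocalConf N)) := by
  have h1 := (Lp.memLp u).comp_measurePreserving
    (measurePreserving_sub_right (volume : Measure (LocalConf N)) ((2 : ℝ) • a))
  refine h1.of_le ?_ ?_
  · refine AEStronglyMeasurable.mul (Continuous.aestronglyMeasurable ?_) h1.1
    fun_prop
  · refine Eventually.of_forall fun x => ?_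
    rw [norm_mul, mul_comm Complex.I, Complex.norm_exp_ofReal_mul_I, one_mul]
    rfl

/-- Displacement of the modes of one party. -/
def localDisp (a b : LocalConf N) (u : LocalSpace N) : LocalSpace N := (memLp_localDisp a b u).toLp _

lemma coeFn_tensor (u v : LocalSpace N) :
    tensor u v =ᵐ[volume] fun x : Conf N => u x.1 * v x.2 := MemLp.coeFn_toLp _

lemma disp_tensor (r : PhaseSpace N) (u v : LocalSpace N) :
    disp r (tensor u v) = tensor (localDisp (fun i => r (i, 0)) (fun i => r (i, 1)) u)
      (localDisp (fun i => r (i, 2)) (fun i => r (i, 3)) v) := by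
  apply Lp.ext
  have h1 := (measurePreserving_shift (shift r)).quasiMeasurePreserving.ae_eq_comp
    (coeFn_tensor u v)
  have h2 := (Measure.quasiMeasurePreserving_fst (μ := (volume : Measure (LocalConf N)))
    (ν := (volume : Measure (LocalConf N)))).ae_eq_comp
    (memLp_localDisp (fun i => r (i, 0)) (fun i => r (i, 1)) u).coeFn_toLp
  have h3 := (Measure.quasiMeasurePreserving_snd (μ := (volume : Measure (LocalConf N)))
    (ν := (volume : Measure (LocalConf N)))).ae_eq_comp
    (memLp_localDisp (fun i => r (i, 2)) (fun i => r (i, 3)) v).coeFn_toLp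
  filter_upwards [coeFn_disp r (tensor u v), h1, h2, h3, coeFn_tensor
    (localDisp (fun i => r (i, 0)) (fun i => r (i, 1)) u)
    (localDisp (fun i => r (i, 2)) (fun i => r (i, 3)) v)] with x e0 e1 e2 e3 e4
  simp only [Function.comp_apply] at e1 e2 e3
  rw [e0, e1, e4, localDisp, localDisp, e2, e3]
  have hd : dispPhase r x = (∑ i, r (i, 1) * (x.1 i - r (i, 0))) +
      ∑ i, r (i, 3) * (x.2 i - r (i, 2)) := by
    rw [dispPhase, Finset.sum_add_distrib]
  rw [hd, Complex.ofReal_add, mul_add, Complex.exp_add]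
  have s1 : (x - shift r).1 = x.1 - (2 : ℝ) • fun i => r (i, 0) := rfl
  have s2 : (x - shift r).2 = x.2 - (2 : ℝ) • fun i => r (i, 2) := rfl
  rw [s1, s2]
  ring

lemma smul_tensor (c : ℂ) (u v : LocalSpace N) : tensor (c • u) v = c • tensor u v := by
  apply Lp.ext
  have h2 := (Measure.quasiMeasurePreserving_fst (μ := (volume : Measure (LocalConf N)))
    (ν := (volume : Measure (LocalConf N)))).ae_eq_comp (Lp.coeFn_smul c u)
  filter_upwards [coeFn_tensor (c • u) v, coeFn_tensor u v, Lp.coeFn_smul c (tensor u v), h2]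
    with x e1 e2 e3 e4
  simp only [Function.comp_apply, Pi.smul_apply] at e4
  rw [e1, e3, Pi.smul_apply, e2, e4, smul_eq_mul, smul_eq_mul, mul_assoc]

lemma memLp_localVacuum (N : ℕ) : MemLp (fun x : LocalConf N =>
    ((∏ i, √(√(2 * Real.pi))⁻¹ * Real.exp (-(x i) ^ 2 / 4) : ℝ) : ℂ)) 2
      (volume : Measure (LocalConf N)) := by
  have hc : Continuous fun x : LocalConf N =>
      ∏ i, √(√(2 * Real.pi))⁻¹ * Real.exp (-(x i) ^ 2 / 4) := by fun_prop
  have hm : MemLp (fun x : LocalConf N => ∏ i, √(√(2 * Real.pi))⁻¹ * Real.exp (-(x i) ^ 2 / 4)) 2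
      (volume : Measure (LocalConf N)) := by
    rw [memLp_two_iff_integrable_sq hc.aestronglyMeasurable]
    have := Integrable.fintype_prod (ι := Fin N)
      (f := fun _ (t : ℝ) => (√(2 * Real.pi))⁻¹ * Real.exp (-(1 / 2) * t ^ 2))
      fun _ => (integrable_exp_neg_mul_sq (by norm_num)).const_mul _
    refine this.congr (Eventually.of_forall fun x => ?_)
    simp only
    rw [← Finset.prod_pow]
    refine Finset.prod_congr rfl fun i _ => ?_
    rw [mul_pow, Real.sq_sqrt (by positivity), ← Real.exp_nat_mul]
    congr 2
    push_cast
    ring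
  exact hm.ofReal

/-- The vacuum of one party. -/
def localVacuum (N : ℕ) : LocalSpace N := (memLp_localVacuum N).toLp _

/-- Without squeezing the state is a product. Its displacements are then product vectors as well, so
the PPT condition can be tested on them. -/
lemma squeezed_zero : squeezed N 0 = tensor (localVacuum N) (localVacuum N) := by
  apply Lp.ext
  have h2 := (Measure.quasiMeasurePreserving_fst (μ := (volume : Measure (LocalConf N)))
    (ν := (volume : Measure (LocalConf N)))).ae_eq_comp (memLp_localVacuum N).coeFn_toLp
  have h3 := (Measure.quasiMeasurePreserving_snd (μ := (volume : Measure (LocalConf N)))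
    (ν := (volume : Measure (LocalConf N)))).ae_eq_comp (memLp_localVacuum N).coeFn_toLp
  filter_upwards [(memLp_squeezedFun N 0).coeFn_toLp, h2, h3,
    coeFn_tensor (localVacuum N) (localVacuum N)] with x e1 e2 e3 e4
  simp only [Function.comp_apply] at e2 e3
  change squeezed N 0 x = _ at e1
  rw [e1, e4, localVacuum, e2, e3, ← Complex.ofReal_mul, squeezedFun, ← Finset.prod_mul_distrib]
  congr 1
  refine Finset.prod_congr rfl fun i _ => ?_
  rw [mul_mul_mul_comm, Real.mul_self_sqrt (by positivity), ← Real.exp_add]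
  congr 2
  simp only [mul_zero, Real.exp_zero]
  ring

/-! ### The uncertainty relation for PPT Gaussian measurements -/

/-- Phase space vector with the entries of `p` for Alice and of `q` for Bob. -/
def mixVec (p q : PhaseSpace N) : PhaseSpace N :=
  fun k => ![p (k.1, 0), p (k.1, 1), q (k.1, 2), q (k.1, 3)] k.2

/-- The symplectic form with the sign reversed for the modes of Bob. -/
def ptForm (x y : PhaseSpace N) : ℝ :=
  ∑ i, (x (i, 0) * y (i, 1) - x (i, 1) * y (i, 0) - (x (i, 2) * y (i, 3) - x (i, 3) * y (i, 2)))

lemma disp_mixVec_tensor (p q : PhaseSpace N) (u v : LocalSpace N) :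
    disp (mixVec p q) (tensor u v) = tensor (localDisp (fun i => p (i, 0)) (fun i => p (i, 1)) u)
      (localDisp (fun i => q (i, 2)) (fun i => q (i, 3)) v) :=
  disp_tensor _ _ _

lemma nonneg_of_hasDerivAt_zero {f : ℝ → ℝ} {f' : ℝ} (h : HasDerivAt f f' 0) (h0 : f 0 = 0)
    (hf : ∀ t, 0 < t → 0 ≤ f t) : 0 ≤ f' := by
  refine ge_of_tendsto h.tendsto_slope_zero_right ?_
  filter_upwards [self_mem_nhdsWithin] with t ht
  rw [zero_add, h0, sub_zero]
  exact smul_nonneg (inv_nonneg.2 (le_of_lt ht)) (hf t ht)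

namespace GaussianMeasurement

lemma effect_zero (M : GaussianMeasurement N) :
    M.effect 0 = ((Real.pi ^ (2 * N))⁻¹ : ℝ) • M.seed := by
  rw [effect, adjoint_disp, neg_zero, disp_zero, one_mul, mul_one]

/-- The matrix elements of the partial transpose, averaged over displacements. -/
def ptKernel (M : GaussianMeasurement N) (p q : PhaseSpace N) : ℂ :=
  phase (-sform (mixVec q p) (mixVec p q)) *
    (Real.exp (-(symp (mixVec q p - mixVec p q) ⬝ᵥ
      M.cov.mulVec (symp (mixVec q p - mixVec p q))) / 2) : ℂ)

lemma hasTwirl_ptKernel (M : GaussianMeasurement N) (p q : PhaseSpace N) :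
    HasTwirl (ContinuousLinearMap.adjoint (disp (mixVec p q)) * M.seed * disp (mixVec q p))
      (M.ptKernel p q) := by
  have key : ∀ r r' : PhaseSpace N, HasTrace (M.seed * (disp r' * disp (-r)))
      (phase (-sform r' r) * (Real.exp (-(symp (r' - r) ⬝ᵥ
      M.cov.mulVec (symp (r' - r))) / 2) : ℂ)) := by
    intro r r'
    have h := (M.hasTrace_seed_mul (r' - r)).smul (phase (sform r' (-r)))
    rw [← mul_smul_comm] at h
    rwa [disp_mul_disp, ← sub_eq_add_neg, ← sform_neg_right]
  exact HasTwirl.disp_conj M.isPositive_seed M.hasTrace_seed (key _ _) (key _ _)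

/-- For each z, the displaced vacuum is some u ⊗ v, and the PPT condition is applied to the local
displacements of u and v by the `p k`. Integrating over z replaces every matrix element by π^{2N}
times a trace, which is an explicit Gaussian function. -/
lemma PPT.sum_ptKernel_nonneg {M : GaussianMeasurement N} (hM : M.PPT) {n : ℕ}
    (c : Fin n → ℂ) (p : Fin n → PhaseSpace N) :
    0 ≤ (∑ k, ∑ l, conj (c k) * c l * M.ptKernel (p k) (p l)).re := by
  set φ := squeezed N 0 with hφ
  have htw := fun k l => (M.hasTwirl_ptKernel (p k) (p l)).2 φ φ
  have hφφ : ⟪φ, φ⟫_ℂ = 1 := by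
    rw [inner_self_eq_norm_sq_to_K, norm_squeezed]
    simp
  have hpos : ∀ z : PhaseSpace N, 0 ≤ (∑ k, ∑ l, conj (c k) * c l *
      ⟪disp z φ, (ContinuousLinearMap.adjoint (disp (mixVec (p k) (p l))) * M.seed *
        disp (mixVec (p l) (p k))) (disp z φ)⟫_ℂ).re := by
    intro z
    obtain ⟨u, v, huv⟩ : ∃ u v : LocalSpace N, disp z φ = tensor u v :=
      ⟨_, _, by rw [hφ, squeezed_zero, disp_tensor]⟩
    have h := hM 0 n
      (fun k => c k • localDisp (fun i => p k (i, 0)) (fun i => p k (i, 1)) u)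
      (fun k => localDisp (fun i => p k (i, 2)) (fun i => p k (i, 3)) v)
    simp only [smul_tensor, ← disp_mixVec_tensor, effect_zero, smul_apply, map_smul,
      inner_smul_left, inner_smul_right, inner_smul_right_eq_smul] at h
    simp only [mul_apply_eq_comp, ContinuousLinearMap.adjoint_inner_right, huv]
    have e : ∀ k l, c l * ((Real.pi ^ (2 * N))⁻¹ : ℝ) •
        (conj (c k) * ⟪disp (mixVec (p k) (p l)) (tensor u v),
          M.seed (disp (mixVec (p l) (p k)) (tensor u v))⟫_ℂ) =
        (((Real.pi ^ (2 * N))⁻¹ : ℝ) : ℂ) * (conj (c k) * c l *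
          ⟪disp (mixVec (p k) (p l)) (tensor u v),
            M.seed (disp (mixVec (p l) (p k)) (tensor u v))⟫_ℂ) := by
      intro k l
      rw [Complex.real_smul]
      ring
    simp only [e, ← Finset.mul_sum] at h
    rw [Complex.re_ofReal_mul] at h
    exact (mul_nonneg_iff_of_pos_left (by positivity)).1 h
  have hint : ∀ k l, Integrable fun z : PhaseSpace N => conj (c k) * c l *
      ⟪disp z φ, (ContinuousLinearMap.adjoint (disp (mixVec (p k) (p l))) * M.seed *
        disp (mixVec (p l) (p k))) (disp z φ)⟫_ℂ := fun k l => (htw k l).1.const_mul _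
  have hI : ∫ z : PhaseSpace N, ∑ k, ∑ l, conj (c k) * c l *
      ⟪disp z φ, (ContinuousLinearMap.adjoint (disp (mixVec (p k) (p l))) * M.seed *
        disp (mixVec (p l) (p k))) (disp z φ)⟫_ℂ =
      (Real.pi ^ (2 * N) : ℝ) * ∑ k, ∑ l, conj (c k) * c l * M.ptKernel (p k) (p l) := by
    rw [integral_finsetSum _ fun k _ => integrable_finsetSum _ fun l _ => hint k l,
      Finset.mul_sum]
    refine Finset.sum_congr rfl fun k _ => ?_
    rw [integral_finsetSum _ fun l _ => hint k l, Finset.mul_sum]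
    refine Finset.sum_congr rfl fun l _ => ?_
    rw [integral_const_mul, (htw k l).2, hφφ]
    push_cast
    ring
  have hre := integral_re (𝕜 := ℂ) (integrable_finsetSum Finset.univ fun k _ =>
    integrable_finsetSum Finset.univ fun l _ => hint k l)
  have h0 := integral_nonneg_of_ae (μ := (volume : Measure (PhaseSpace N)))
    (Eventually.of_forall hpos)
  have h1 : 0 ≤ ((Real.pi ^ (2 * N) : ℝ) *
      ∑ k, ∑ l, conj (c k) * c l * M.ptKernel (p k) (p l) : ℂ).re := by
    rw [← hI]
    exact h0.trans_eq hre
  rw [Complex.re_ofReal_mul] at h1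
  exact (mul_nonneg_iff_of_pos_left (by positivity)).1 h1

/-- PPT Gaussian measurements satisfy the uncertainty relation of the partially transposed
system. -/
lemma PPT.uncertainty {M : GaussianMeasurement N} (hM : M.PPT) (x y : PhaseSpace N) :
    0 ≤ x ⬝ᵥ M.cov.mulVec x + y ⬝ᵥ M.cov.mulVec y + 2 * ptForm x y := by
  -- The inverse of `symp` on Alice's entries and its negative on Bob's. The kernel exchanges the
  -- displacements of Bob, which reverses their difference, and the extra sign undoes this; in the
  -- phase it survives and turns the symplectic form into `ptForm`.
  let L : PhaseSpace N → PhaseSpace N :=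
    fun x k => ![-x (k.1, 1), x (k.1, 0), x (k.1, 3), -x (k.1, 2)] k.2
  let q : PhaseSpace N → ℝ := fun x => x ⬝ᵥ M.cov.mulVec x
  have hker : ∀ (s t : ℝ) (x y : PhaseSpace N), M.ptKernel (s • L x) (t • L y) =
      phase (-(s * t * ptForm x y)) * (Real.exp (-q (t • y - s • x) / 2) : ℂ) := by
    intro s t x y
    have e1 : symp (mixVec (t • L y) (s • L x) - mixVec (s • L x) (t • L y)) = t • y - s • x := by
      funext ⟨i, j⟩
      fin_cases j <;> simp [symp, mixVec, L] <;> ring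
    have e2 : -sform (mixVec (t • L y) (s • L x)) (mixVec (s • L x) (t • L y)) =
        -(s * t * ptForm x y) := by
      rw [sform, ptForm, Finset.mul_sum]
      congr 1
      refine Finset.sum_congr rfl fun i _ => ?_
      simp [mixVec, L]
      ring
    rw [ptKernel, e1, e2]
  have hq : ∀ (t : ℝ) (x : PhaseSpace N), q (t • x) = t ^ 2 * q x := by
    intro t x
    simp only [q, Matrix.mulVec_smul, dotProduct_smul, smul_dotProduct, smul_eq_mul]
    ring
  have hF : ∀ t : ℝ, 0 < t → 0 ≤ 4 - 2 * Real.exp (-(t * q x) / 2) - 2 * Real.exp (-(t * q y) / 2) +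
      2 * Real.sin (t * ptForm x y) * Real.exp (-(t * q (y - x)) / 2) := by
    intro t ht
    -- The exponents are quadratic in the displacements, so scaling these by √t makes the
    -- second-order term the derivative at t = 0.
    set a := √t with ha
    have ha2 : a ^ 2 = t := Real.sq_sqrt ht.le
    have hq0 : q 0 = 0 := by simp [q]
    have hp0 : ∀ x : PhaseSpace N, ptForm x x = 0 := fun x => by
      rw [ptForm]
      exact Finset.sum_eq_zero fun i _ => by ring
    have hsw : ptForm y x = -ptForm x y := by
      rw [ptForm, ptForm, ← Finset.sum_neg_distrib]
      exact Finset.sum_congr rfl fun i _ => by ring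
    have hqn : q (x - y) = q (y - x) := by
      have := hq (-1) (y - x)
      rw [neg_one_smul, neg_sub] at this
      rw [this]
      ring
    have haa : a * a = t := by rw [← sq, ha2]
    have hphase : ∀ θ : ℝ, phase θ = Real.cos θ + Real.sin θ * Complex.I := fun θ => by
      rw [phase, mul_comm, Complex.exp_mul_I, Complex.ofReal_cos, Complex.ofReal_sin]
    have hk1 : ∀ (t : ℝ) (x : PhaseSpace N), M.ptKernel 0 (t • L x) =
        (Real.exp (-(t ^ 2 * q x) / 2) : ℂ) := fun t x => by
      have := hker 0 t 0 x
      rwa [zero_smul, zero_smul, zero_mul, zero_mul, neg_zero, phase_zero, one_mul, sub_zero,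
        hq] at this
    have hk2 : ∀ (t : ℝ) (x : PhaseSpace N), M.ptKernel (t • L x) 0 =
        (Real.exp (-(t ^ 2 * q x) / 2) : ℂ) := fun t x => by
      have := hker t 0 x 0
      rwa [zero_smul, zero_smul, mul_zero, zero_mul, neg_zero, phase_zero, one_mul, zero_sub,
        ← neg_smul, hq, neg_sq] at this
    have hk0 : M.ptKernel 0 0 = 1 := by
      have := hk1 0 0
      rwa [zero_smul, hq0, mul_zero, neg_zero, zero_div, Real.exp_zero, Complex.ofReal_one] at this
    -- The coefficients add up to zero, which removes the term of order zero. The relative factor i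
    -- between the last two brings the antisymmetric phase into the real part.
    have h := hM.sum_ptKernel_nonneg ![-(1 + Complex.I), 1, Complex.I] ![0, a • L x, a • L y]
    simp only [Fin.sum_univ_three, Matrix.cons_val_zero, Matrix.cons_val_one, Matrix.cons_val,
      hk0, hk1, hk2, hker, mul_zero, neg_zero, sub_self, hq0, hp0, hsw,
      ← smul_sub, hq, ha2, haa, hqn, hphase, Real.cos_zero, Real.sin_zero, mul_neg, neg_neg,
      Real.cos_neg, Real.sin_neg, zero_div, Real.exp_zero] at h
    simp only [Complex.add_re, Complex.mul_re, Complex.mul_im, Complex.add_im, Complex.neg_re,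
      Complex.neg_im, Complex.I_re, Complex.I_im, Complex.one_re, Complex.one_im, map_add, map_neg,
      map_one, Complex.conj_I, Complex.ofReal_re, Complex.ofReal_im] at h
    linarith
  have hder : HasDerivAt (fun t : ℝ => 4 - 2 * Real.exp (-(t * q x) / 2) -
      2 * Real.exp (-(t * q y) / 2) +
      2 * Real.sin (t * ptForm x y) * Real.exp (-(t * q (y - x)) / 2))
      (q x + q y + 2 * ptForm x y) 0 := by
    have hE : ∀ c : ℝ, HasDerivAt (fun t : ℝ => Real.exp (-(t * c) / 2)) (-c / 2) 0 := by
      intro c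
      have := (((hasDerivAt_id (0 : ℝ)).mul_const c).neg.div_const 2).exp
      simpa using this
    have hS : HasDerivAt (fun t : ℝ => Real.sin (t * ptForm x y)) (ptForm x y) 0 := by
      have := ((hasDerivAt_id (0 : ℝ)).mul_const (ptForm x y)).sin
      simpa using this
    have := (((hE (q x)).const_mul 2).const_sub 4 |>.sub ((hE (q y)).const_mul 2)).add
      ((hS.const_mul 2).mul (hE (q (y - x))))
    refine this.congr_deriv ?_
    simp
    ring
  refine nonneg_of_hasDerivAt_zero hder ?_ hF
  norm_num

end GaussianMeasurement

/-! ### A direction of large classical noise -/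

/-- By the parallelogram law, the better of the two signs of each new vector increases the form by
at least its value there. Cross terms, of whatever size, can therefore be made harmless. -/
lemma exists_signs_le {E κ : Type*} [AddCommGroup E] [DecidableEq κ] {Q : E → ℝ} (h0 : Q 0 = 0)
    (hQ : ∀ x y, Q (x + y) + Q (x - y) = 2 * (Q x + Q y)) (f : κ → E) (s : Finset κ) :
    ∃ ε : κ → ℤˣ, ∑ j ∈ s, Q (f j) ≤ Q (∑ j ∈ s, (ε j : ℤ) • f j) := by
  induction s using Finset.induction_on with
  | empty => exact ⟨1, by simp [h0]⟩
  | insert a s ha ih =>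
    obtain ⟨ε, hε⟩ := ih
    have hup : ∀ u : ℤˣ, ∑ j ∈ insert a s, ((Function.update ε a u j : ℤˣ) : ℤ) • f j =
        (∑ j ∈ s, (ε j : ℤ) • f j) + (u : ℤ) • f a := by
      intro u
      rw [Finset.sum_insert ha, Function.update_self, add_comm]
      congr 1
      refine Finset.sum_congr rfl fun j hj => ?_
      rw [Function.update_of_ne (by rintro rfl; exact ha hj)]
    have hp := hQ (∑ j ∈ s, (ε j : ℤ) • f j) (f a)
    rw [Finset.sum_insert ha]
    rcases le_total (Q (∑ j ∈ s, (ε j : ℤ) • f j - f a)) (Q (∑ j ∈ s, (ε j : ℤ) • f j + f a))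
      with h | h
    · refine ⟨Function.update ε a 1, ?_⟩
      rw [hup, Units.val_one, one_smul]
      linarith
    · refine ⟨Function.update ε a (-1), ?_⟩
      rw [hup, Units.val_neg, Units.val_one, neg_one_smul, ← sub_eq_add_neg]
      linarith

section Quadratic

variable {ι : Type*} [Fintype ι] {S : Matrix ι ι ℝ}

lemma dotProduct_mulVec_comm (hS : S.IsSymm) (x y : ι → ℝ) :
    x ⬝ᵥ S.mulVec y = y ⬝ᵥ S.mulVec x := by
  rw [Matrix.dotProduct_mulVec, ← Matrix.mulVec_transpose, hS.eq, dotProduct_comm]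

lemma sq_dotProduct_mulVec_le (hS : S.IsSymm) (hp : ∀ x, 0 ≤ x ⬝ᵥ S.mulVec x) (x y : ι → ℝ) :
    (x ⬝ᵥ S.mulVec y) ^ 2 ≤ (x ⬝ᵥ S.mulVec x) * (y ⬝ᵥ S.mulVec y) := by
  have h : ∀ t : ℝ, 0 ≤ (y ⬝ᵥ S.mulVec y) * (t * t) + 2 * (x ⬝ᵥ S.mulVec y) * t +
      x ⬝ᵥ S.mulVec x := by
    intro t
    have := hp (x + t • y)
    simp only [Matrix.mulVec_add, Matrix.mulVec_smul, dotProduct_add, add_dotProduct,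
      smul_dotProduct, dotProduct_smul, smul_eq_mul, dotProduct_mulVec_comm hS y x] at this
    linarith
  have := discrim_le_zero h
  rw [discrim] at this
  linarith

/-- The resolvent equation of a positive semidefinite matrix. -/
lemma exists_resolvent (hp : ∀ x, 0 ≤ x ⬝ᵥ S.mulVec x) {θ : ℝ} (hθ : 0 < θ) :
    ∃ K : (ι → ℝ) →ₗ[ℝ] (ι → ℝ), ∀ g, K g + θ⁻¹ • S.mulVec (K g) = g := by
  classical
  let A : (ι → ℝ) →ₗ[ℝ] (ι → ℝ) := LinearMap.id + θ⁻¹ • S.mulVecLin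
  have hA : Function.Injective A := by
    rw [← LinearMap.ker_eq_bot, LinearMap.ker_eq_bot']
    intro x hx
    have h1 : x ⬝ᵥ A x = 0 := by rw [hx, dotProduct_zero]
    have h2 : x ⬝ᵥ A x = x ⬝ᵥ x + θ⁻¹ * (x ⬝ᵥ S.mulVec x) := by
      simp [A, dotProduct_add, dotProduct_smul]
    have h3 : 0 ≤ θ⁻¹ * (x ⬝ᵥ S.mulVec x) := mul_nonneg (by positivity) (hp x)
    have h4 : 0 ≤ x ⬝ᵥ x := Finset.sum_nonneg fun i _ => mul_self_nonneg _
    exact dotProduct_self_eq_zero.1 (by linarith)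
  have hA' : Function.Surjective A := LinearMap.injective_iff_surjective.1 hA
  refine ⟨(LinearEquiv.ofBijective A ⟨hA, hA'⟩).symm.toLinearMap, fun g => ?_⟩
  exact (LinearEquiv.ofBijective A ⟨hA, hA'⟩).apply_symm_apply g

end Quadratic

/-- The vector representing `posDiff i`. -/
def posVec (i : Fin N) : PhaseSpace N := Pi.single (i, 0) 1 - Pi.single (i, 2) 1

/-- The vector representing `momSum i`. -/
def momVec (i : Fin N) : PhaseSpace N := Pi.single (i, 1) 1 + Pi.single (i, 3) 1

lemma posVec_dotProduct (i : Fin N) (w : PhaseSpace N) : posVec i ⬝ᵥ w = posDiff i w := by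
  simp [posVec, posDiff_apply, sub_dotProduct]

lemma momVec_dotProduct (i : Fin N) (w : PhaseSpace N) : momVec i ⬝ᵥ w = momSum i w := by
  simp [momVec, momSum_apply, add_dotProduct]

/-- In the ordinary symplectic form the contributions of Alice and Bob cancel; with Bob's sign
reversed they add. This is the obstruction for PPT measurements. -/
lemma ptForm_posVec_momVec (i : Fin N) : ptForm (posVec i) (momVec i) = 2 := by
  rw [ptForm, Finset.sum_eq_single i]
  · simp [posVec, momVec]
    norm_num
  · intro j _ hj
    simp [posVec, momVec, hj]
  · simp

lemma dotProduct_eq_sum (x y : PhaseSpace N) : x ⬝ᵥ y = ∑ i, (x (i, 0) * y (i, 0) +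
    x (i, 1) * y (i, 1) + x (i, 2) * y (i, 2) + x (i, 3) * y (i, 3)) := by
  simp [dotProduct, Fintype.sum_prod_type, Fin.sum_univ_four]

lemma ptForm_le (x y : PhaseSpace N) {a : ℝ} (ha : 0 < a) :
    ptForm x y ≤ a / 2 * (x ⬝ᵥ x) + (2 * a)⁻¹ * (y ⬝ᵥ y) := by
  have h : ∀ u v : ℝ, u * v ≤ a / 2 * (u * u) + (2 * a)⁻¹ * (v * v) := by
    intro u v
    have : a / 2 * (u * u) + (2 * a)⁻¹ * (v * v) - u * v = (a * u - v) ^ 2 / (2 * a) := by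
      field_simp
      ring
    have h2 : 0 ≤ (a * u - v) ^ 2 / (2 * a) := by positivity
    linarith
  rw [ptForm, dotProduct_eq_sum, dotProduct_eq_sum, Finset.mul_sum, Finset.mul_sum,
    ← Finset.sum_add_distrib]
  refine Finset.sum_le_sum fun i _ => ?_
  have h1 := h (x (i, 0)) (y (i, 1))
  have h2 := h (-x (i, 1)) (y (i, 0))
  have h3 := h (-x (i, 2)) (y (i, 3))
  have h4 := h (x (i, 3)) (y (i, 2))
  linarith

lemma ptForm_sub_sub (x y x' y' : PhaseSpace N) :
    ptForm (x - x') (y - y') = ptForm x y - ptForm x' y - ptForm x y' - ptForm (-x') y' := by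
  simp only [ptForm, ← Finset.sum_sub_distrib]
  refine Finset.sum_congr rfl fun i _ => ?_
  simp only [Pi.sub_apply, Pi.neg_apply]
  ring

/-- If `S` satisfies the uncertainty relation of the partially transposed system, then it contains
classical noise along a direction with large overlap with the variables `posDiff i` and
`momSum i`. -/
lemma exists_noise_direction {S : Matrix (Fin N × Fin 4) (Fin N × Fin 4) ℝ} (hS : S.IsSymm)
    (hp : ∀ x, 0 ≤ x ⬝ᵥ S.mulVec x)
    (hu : ∀ x y, ptForm x y ≤ 2 * (x ⬝ᵥ S.mulVec x + y ⬝ᵥ S.mulVec y)) {θ : ℝ} (hθ : 0 < θ)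
    (hN : 1 ≤ N) :
    ∃ w : PhaseSpace N, (∀ x, (x ⬝ᵥ w) ^ 2 ≤ x ⬝ᵥ S.mulVec x) ∧ w ⬝ᵥ w ≤ θ ∧
      √(N * (3 * θ / (4 * θ + 5))) ≤ ∑ i, (|posDiff i w| + |momSum i w|) := by
  obtain ⟨K, hK⟩ := exists_resolvent hp hθ
  -- This is the form of S(1 + S/θ)⁻¹, the noise S truncated smoothly at level θ. The truncation is
  -- what will bound the length of w.
  let Q : PhaseSpace N → ℝ := fun g => g ⬝ᵥ S.mulVec (K g)
  have hQ : ∀ g, Q g = K g ⬝ᵥ S.mulVec (K g) +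
      θ⁻¹ * (S.mulVec (K g) ⬝ᵥ S.mulVec (K g)) := by
    intro g
    have : Q g = (K g + θ⁻¹ • S.mulVec (K g)) ⬝ᵥ S.mulVec (K g) := by rw [hK]
    rw [this, add_dotProduct, smul_dotProduct, smul_eq_mul]
  have hsq : ∀ x : PhaseSpace N, 0 ≤ x ⬝ᵥ x := fun x =>
    Finset.sum_nonneg fun i _ => mul_self_nonneg _
  have hpair : ∀ i : Fin N, 3 * θ / (4 * θ + 5) ≤ Q (posVec i) + Q (momVec i) := by
    intro i
    set f := posVec i with hf
    set f' := momVec i with hf'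
    set d := θ⁻¹ • S.mulVec (K f) with hd
    set d' := θ⁻¹ • S.mulVec (K f') with hd'
    have hk : K f = f - d := eq_sub_of_add_eq (hK f)
    have hk' : K f' = f' - d' := eq_sub_of_add_eq (hK f')
    have h1 := hu (K f) (K f')
    have hdd : ∀ g : PhaseSpace N, (θ⁻¹ • S.mulVec (K g)) ⬝ᵥ (θ⁻¹ • S.mulVec (K g)) =
        θ⁻¹ * (Q g - K g ⬝ᵥ S.mulVec (K g)) := by
      intro g
      rw [hQ, smul_dotProduct, dotProduct_smul, smul_eq_mul, smul_eq_mul]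
      ring
    have e1 : d ⬝ᵥ d = θ⁻¹ * (Q f - K f ⬝ᵥ S.mulVec (K f)) := hdd f
    have e2 : d' ⬝ᵥ d' = θ⁻¹ * (Q f' - K f' ⬝ᵥ S.mulVec (K f')) := hdd f'
    rw [hk, hk', ptForm_sub_sub, hf, hf', ptForm_posVec_momVec, ← hf, ← hf', ← hk, ← hk'] at h1
    -- The weights 4 and 1/4 charge 1/4 each to the fixed vectors, whose squared length is 2, so
    -- that 2 - 1/2 = 3/2 survives. The corrections d and d' enter with the coefficient 2 + 1/2 =
    -- 5/2.
    have h2 := ptForm_le d f' (a := 4) (by norm_num)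
    have h3 := ptForm_le f d' (a := 1 / 4) (by norm_num)
    have h4 := ptForm_le (-d) d' (a := 1) (by norm_num)
    have n1 : f ⬝ᵥ f = 2 := by
      rw [hf, posVec_dotProduct, posDiff_apply]
      simp [posVec]
      norm_num
    have n2 : f' ⬝ᵥ f' = 2 := by
      rw [hf', momVec_dotProduct, momSum_apply]
      simp [momVec]
      norm_num
    rw [neg_dotProduct, dotProduct_neg, neg_neg] at h4
    rw [n2] at h2
    rw [n1] at h3
    have p1 := hp (K f)
    have p2 := hp (K f')
    have hθd : θ * (d ⬝ᵥ d) = Q f - K f ⬝ᵥ S.mulVec (K f) := by rw [e1]; field_simp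
    have hθd' : θ * (d' ⬝ᵥ d') = Q f' - K f' ⬝ᵥ S.mulVec (K f') := by rw [e2]; field_simp
    rw [div_le_iff₀ (by positivity)]
    have h5 : 3 / 2 ≤ 2 * (K f ⬝ᵥ S.mulVec (K f) + K f' ⬝ᵥ S.mulVec (K f')) +
        5 / 2 * (d ⬝ᵥ d + d' ⬝ᵥ d') := by linarith
    have h6 := mul_le_mul_of_nonneg_left h5 hθ.le
    have h7 : K f ⬝ᵥ S.mulVec (K f) + K f' ⬝ᵥ S.mulVec (K f') ≤ Q f + Q f' := by
      have := mul_nonneg hθ.le (hsq d)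
      have := mul_nonneg hθ.le (hsq d')
      linarith
    have h8 := mul_le_mul_of_nonneg_left h7 hθ.le
    linarith
  have hpl : ∀ x y, Q (x + y) + Q (x - y) = 2 * (Q x + Q y) := by
    intro x y
    simp only [Q, map_add, map_sub, Matrix.mulVec_add, Matrix.mulVec_sub, dotProduct_add,
      add_dotProduct, dotProduct_sub, sub_dotProduct]
    ring
  let f : Fin N × Bool → PhaseSpace N := fun j => if j.2 then posVec j.1 else momVec j.1
  obtain ⟨ε, hε⟩ := exists_signs_le (by simp [Q]) hpl f Finset.univ
  set g := ∑ j, (ε j : ℤ) • f j with hg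
  have hD : N * (3 * θ / (4 * θ + 5)) ≤ Q g := by
    refine le_trans ?_ hε
    rw [Fintype.sum_prod_type]
    have := Finset.sum_le_sum fun (i : Fin N) (_ : i ∈ Finset.univ) => hpair i
    simpa [f] using this
  have hNpos : (0 : ℝ) < N := by exact_mod_cast hN
  have hD0 : 0 < Q g := lt_of_lt_of_le (by positivity) hD
  have hr : √(Q g) * √(Q g) = Q g := Real.mul_self_sqrt hD0.le
  have hr0 : 0 < √(Q g) := Real.sqrt_pos.2 hD0
  have hQg := hQ g
  -- Both summands of Q g = Kg·SKg + θ⁻¹|SKg|² are nonnegative. The first gives domination by S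
  -- through Cauchy–Schwarz, the second the bound on the length, and g·w = √(Q g) gives the overlap.
  refine ⟨(√(Q g))⁻¹ • S.mulVec (K g), fun x => ?_, ?_, ?_⟩
  · rw [dotProduct_smul, smul_eq_mul, mul_pow, inv_pow, Real.sq_sqrt hD0.le, inv_mul_le_iff₀ hD0]
    refine (sq_dotProduct_mulVec_le hS hp x (K g)).trans ?_
    rw [mul_comm]
    refine mul_le_mul_of_nonneg_right ?_ (hp x)
    have : 0 ≤ θ⁻¹ * (S.mulVec (K g) ⬝ᵥ S.mulVec (K g)) := mul_nonneg (by positivity) (hsq _)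
    linarith
  · rw [smul_dotProduct, dotProduct_smul, smul_eq_mul, smul_eq_mul, ← mul_assoc, ← mul_inv, hr,
      inv_mul_le_iff₀ hD0, hQg, mul_comm _ θ, mul_add, mul_inv_cancel_left₀ hθ.ne']
    have := mul_nonneg hθ.le (hp (K g))
    linarith
  · refine (Real.sqrt_le_sqrt hD).trans ?_
    set w := (√(Q g))⁻¹ • S.mulVec (K g) with hw
    have h1 : g ⬝ᵥ w = √(Q g) := by
      rw [hw, dotProduct_smul, smul_eq_mul, inv_mul_eq_iff_eq_mul₀ hr0.ne', hr]
    rw [← h1, hg, sum_dotProduct]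
    have h2 : ∑ i, (|posDiff i w| + |momSum i w|) = ∑ j, |f j ⬝ᵥ w| := by
      rw [Fintype.sum_prod_type]
      simp [f, posVec_dotProduct, momVec_dotProduct]
    rw [h2]
    refine Finset.sum_le_sum fun j _ => ?_
    rw [smul_dotProduct]
    rcases Int.units_eq_one_or (ε j) with h | h
    · rw [h, Units.val_one, one_smul]
      exact le_abs_self _
    · rw [h, Units.val_neg, Units.val_one, neg_one_smul]
      exact neg_le_abs _

/-! ### Translations of the prior -/

/-- The density of the prior translated by `v` with respect to the prior. -/
def transDensity (σ : ℝ) (v r : PhaseSpace N) : ℝ :=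
  Real.exp ((r ⬝ᵥ v) / σ ^ 2 - (v ⬝ᵥ v) / (2 * σ ^ 2))

lemma continuous_transDensity (σ : ℝ) :
    Continuous fun p : PhaseSpace N × PhaseSpace N => transDensity σ p.1 p.2 := by
  unfold transDensity dotProduct
  fun_prop

lemma continuous_transDensity_right (σ : ℝ) (v : PhaseSpace N) :
    Continuous (transDensity σ v) :=
  (continuous_transDensity σ).comp (Continuous.prodMk_right v)

lemma transDensity_pos (σ : ℝ) (v r : PhaseSpace N) : 0 < transDensity σ v r := Real.exp_pos _

lemma prior_sub {σ : ℝ} (hσ : 0 < σ) (v r : PhaseSpace N) :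
    prior σ (r - v) = prior σ r * transDensity σ v r := by
  rw [prior, prior, transDensity, mul_assoc (_⁻¹), ← Real.exp_add]
  congr 2
  simp only [dotProduct, Pi.sub_apply]
  field_simp
  rw [Finset.mul_sum, ← Finset.sum_neg_distrib, ← Finset.sum_neg_distrib, ← Finset.sum_sub_distrib,
    ← Finset.sum_add_distrib]
  exact Finset.sum_congr rfl fun i _ => by ring

/-- The Cameron–Martin formula in finite dimension. -/
lemma map_add_gaussPrior {σ : ℝ} (hσ : 0 < σ) (v : PhaseSpace N) :
    (gaussPrior N σ).map (fun r => r + v) =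
      (gaussPrior N σ).withDensity fun r => ENNReal.ofReal (transDensity σ v r) := by
  have hm := (continuous_prior (N := N) σ).measurable.ennreal_ofReal
  have hd := (continuous_transDensity_right σ v).measurable.ennreal_ofReal
  refine Measure.ext_of_lintegral _ fun f hf => ?_
  rw [lintegral_map hf (measurable_add_const v), lintegral_withDensity_eq_lintegral_mul _ hd hf,
    ← withDensity_prior hσ, lintegral_withDensity_eq_lintegral_mul _ hm
      (f := fun r => ENNReal.ofReal (prior σ r)) (g := fun r => f (r + v))
      (hf.comp (measurable_add_const v)),
    lintegral_withDensity_eq_lintegral_mul _ hm (hd.mul hf),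
    ← lintegral_sub_right_eq_self _ v]
  refine lintegral_congr fun r => ?_
  simp only [Pi.mul_apply, sub_add_cancel]
  rw [prior_sub hσ, ENNReal.ofReal_mul (prior_nonneg σ r), mul_assoc]

lemma integral_gaussPrior_add {σ : ℝ} (hσ : 0 < σ) (f : PhaseSpace N → ℝ) (v : PhaseSpace N) :
    ∫ r, f (r + v) ∂gaussPrior N σ = ∫ r, transDensity σ v r * f r ∂gaussPrior N σ := by
  have he : MeasurableEmbedding fun r : PhaseSpace N => r + v := measurableEmbedding_addRight v
  rw [← he.integral_map, map_add_gaussPrior hσ, integral_withDensity_eq_integral_toReal_smul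
    (continuous_transDensity_right σ v).measurable.ennreal_ofReal
    (Eventually.of_forall fun _ => ENNReal.ofReal_lt_top)]
  simp only [ENNReal.toReal_ofReal (transDensity_pos σ v _).le, smul_eq_mul]

lemma integrable_transDensity {σ : ℝ} (hσ : 0 < σ) (v : PhaseSpace N) :
    Integrable (transDensity σ v) (gaussPrior N σ) := by
  have h : (gaussPrior N σ).map (fun r => r + v) Set.univ = (gaussPrior N σ).withDensity
      (fun r => ENNReal.ofReal (transDensity σ v r)) Set.univ := by rw [map_add_gaussPrior hσ]
  rw [Measure.map_apply (by fun_prop) MeasurableSet.univ, Set.preimage_univ, measure_univ,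
    withDensity_apply _ MeasurableSet.univ, Measure.restrict_univ] at h
  refine ⟨(continuous_transDensity_right σ v).aestronglyMeasurable, ?_⟩
  rw [hasFiniteIntegral_iff_ofReal (Eventually.of_forall fun r => (transDensity_pos σ v r).le), ← h]
  exact ENNReal.one_lt_top

lemma integral_transDensity {σ : ℝ} (hσ : 0 < σ) (v : PhaseSpace N) :
    ∫ r, transDensity σ v r ∂gaussPrior N σ = 1 := by
  have h := integral_gaussPrior_add (N := N) hσ (fun _ => 1) v
  simpa using h.symm

lemma transDensity_mul {σ : ℝ} (hσ : 0 < σ) (a b : ℝ) (w r : PhaseSpace N) :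
    transDensity σ (a • w) r * transDensity σ (b • w) r =
      Real.exp (a * b * (w ⬝ᵥ w) / σ ^ 2) * transDensity σ ((a + b) • w) r := by
  rw [transDensity, transDensity, transDensity, ← Real.exp_add, ← Real.exp_add]
  congr 1
  simp only [dotProduct_smul, smul_dotProduct, smul_eq_mul]
  field_simp
  ring

/-! ### Smoothing along one direction -/

/-- This replaces Cauchy–Schwarz in the smoothing estimate; the scale `l` is later set to the target
error. -/
lemma abs_le_half_add_sq_div {a b l : ℝ} (hl : 0 < l) (h : |a| ≤ b) : |a| ≤ (l + b ^ 2 / l) / 2 := by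
  refine h.trans ?_
  rw [le_div_iff₀ two_pos, ← sub_nonneg]
  have : l + b ^ 2 / l - b * 2 = (l - b) ^ 2 / l := by field_simp; ring
  rw [this]
  positivity

/-- Smoothing by Gaussian noise along the direction `w` destroys correlations with a function
that is oscillating along `w`. -/
lemma abs_integral_smoothing_le {σ : ℝ} (hσ : 0 < σ) {h β : PhaseSpace N → ℝ} (hm : Measurable h)
    (βm : Measurable β) (hh : ∀ r, |h r| ≤ 1) (hβ : ∀ r, |β r| ≤ 1) (w : PhaseSpace N)
    (hint : Integrable (fun p : ℝ × ℝ => Real.exp (p.1 * p.2 * (w ⬝ᵥ w) / σ ^ 2))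
      ((gaussianReal 0 1).prod (gaussianReal 0 1))) {l : ℝ} (hl : 0 < l) :
    |∫ r, h r * ∫ g, β (r - g • w) ∂gaussianReal 0 1 ∂gaussPrior N σ| ≤
      (l + (∫ p : ℝ × ℝ, Real.exp (p.1 * p.2 * (w ⬝ᵥ w) / σ ^ 2) *
        ∫ r, h (r - p.1 • w) * h (r - p.2 • w) ∂gaussPrior N σ
          ∂(gaussianReal 0 1).prod (gaussianReal 0 1)) / l) / 2 := by
  set γ := gaussPrior N σ with hγ
  set G := gaussianReal 0 1 with hG
  -- The average of `k g` over g is the adjoint of the smoothing, taken in L² of the prior and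
  -- applied to `h`. The unknown `β` is then merely a bounded factor.
  let k : ℝ → PhaseSpace N → ℝ := fun g r => transDensity σ ((-g) • w) r * h (r + g • w)
  have kpos : ∀ g r, |k g r| ≤ transDensity σ ((-g) • w) r := fun g r => by
    rw [abs_mul, abs_of_pos (transDensity_pos σ _ _)]
    exact mul_le_of_le_one_right (transDensity_pos σ _ _).le (hh _)
  have hdm : Measurable fun p : ℝ × PhaseSpace N => transDensity σ ((-p.1) • w) p.2 :=
    ((continuous_transDensity σ).comp (f := fun p : ℝ × PhaseSpace N => ((-p.1) • w, p.2))
      (by fun_prop)).measurable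
  have km : Measurable fun p : ℝ × PhaseSpace N => k p.1 p.2 :=
    hdm.mul (hm.comp (by fun_prop))
  let F : PhaseSpace N → ℝ := fun r => ∫ g, k g r ∂G
  have hD : Integrable (fun p : ℝ × PhaseSpace N => transDensity σ ((-p.1) • w) p.2) (G.prod γ) := by
    rw [integrable_prod_iff hdm.aestronglyMeasurable]
    refine ⟨Eventually.of_forall fun g => integrable_transDensity hσ ((-g) • w), ?_⟩
    simp only [Real.norm_of_nonneg (transDensity_pos σ _ _).le, hγ, integral_transDensity hσ]
    exact integrable_const _
  have e1 : ∫ r, h r * ∫ g, β (r - g • w) ∂G ∂γ = ∫ r, β r * F r ∂γ := by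
    have m1 : Measurable fun p : PhaseSpace N × ℝ => p.1 - p.2 • w := by fun_prop
    have m2 : Measurable fun p : PhaseSpace N × ℝ => h p.1 * β (p.1 - p.2 • w) :=
      (hm.comp measurable_fst).mul (βm.comp m1)
    have i1 : Integrable (fun p : PhaseSpace N × ℝ => h p.1 * β (p.1 - p.2 • w)) (γ.prod G) := by
      refine Integrable.of_bound m2.aestronglyMeasurable 1 (Eventually.of_forall fun p => ?_)
      · rw [norm_mul]
        exact mul_le_one₀ (hh _) (norm_nonneg _) (hβ _)
    have i2 : Integrable (fun p : ℝ × PhaseSpace N => β p.2 * k p.1 p.2) (G.prod γ) := by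
      refine hD.mono' ((βm.comp measurable_snd).mul km).aestronglyMeasurable
        (Eventually.of_forall fun p => ?_)
      rw [norm_mul]
      exact (mul_le_of_le_one_left (norm_nonneg _) (hβ _)).trans (kpos _ _)
    simp only [← integral_const_mul, F]
    rw [integral_integral_swap i1, integral_integral_swap (f := fun r g => β r * k g r) i2.swap]
    refine integral_congr_ae (Eventually.of_forall fun g => ?_)
    have := integral_gaussPrior_add (N := N) hσ (fun r => h (r + g • w) * β r) ((-g) • w)
    simp only [neg_smul, ← sub_eq_add_neg, sub_add_cancel] at this
    simp only [k, neg_smul]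
    rw [hγ, this]
    refine integral_congr_ae (Eventually.of_forall fun r => ?_)
    ring
  have e2 : ∀ r, F r ^ 2 = ∫ p : ℝ × ℝ, k p.1 r * k p.2 r ∂G.prod G := fun r => by
    rw [sq, ← integral_prod_mul]
  have i3 : Integrable (fun q : (ℝ × ℝ) × PhaseSpace N => k q.1.1 q.2 * k q.1.2 q.2)
      ((G.prod G).prod γ) := by
    have hdm2 : Measurable fun q : (ℝ × ℝ) × PhaseSpace N =>
        transDensity σ ((-q.1.1) • w) q.2 * transDensity σ ((-q.1.2) • w) q.2 :=
      (hdm.comp (f := fun q : (ℝ × ℝ) × PhaseSpace N => (q.1.1, q.2)) (by fun_prop)).mul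
        (hdm.comp (f := fun q : (ℝ × ℝ) × PhaseSpace N => (q.1.2, q.2)) (by fun_prop))
    have hD2 : Integrable (fun q : (ℝ × ℝ) × PhaseSpace N =>
        transDensity σ ((-q.1.1) • w) q.2 * transDensity σ ((-q.1.2) • w) q.2)
        ((G.prod G).prod γ) := by
      rw [integrable_prod_iff hdm2.aestronglyMeasurable]
      simp only [transDensity_mul hσ, norm_mul, Real.norm_of_nonneg (Real.exp_pos _).le,
        Real.norm_of_nonneg (transDensity_pos σ _ _).le]
      refine ⟨Eventually.of_forall fun g => (integrable_transDensity hσ ((-g.1 + -g.2) • w)).const_mul _, ?_⟩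
      simp only [integral_const_mul, hγ, integral_transDensity hσ, mul_one, neg_mul_neg]
      exact hint
    refine hD2.mono' (Measurable.aestronglyMeasurable ?_) (Eventually.of_forall fun q => ?_)
    · exact (km.comp (f := fun q : (ℝ × ℝ) × PhaseSpace N => (q.1.1, q.2)) (by fun_prop)).mul
        (km.comp (f := fun q : (ℝ × ℝ) × PhaseSpace N => (q.1.2, q.2)) (by fun_prop))
    · rw [norm_mul]
      exact mul_le_mul (kpos _ _) (kpos _ _) (norm_nonneg _) (transDensity_pos σ _ _).le
  -- The square of an average is an average over two independent copies. Two translation densities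
  -- multiply to one for the summed translation, which is undone by a change of variables, leaving
  -- the exponential factor.
  have e3 : ∫ r, F r ^ 2 ∂γ = ∫ p : ℝ × ℝ, Real.exp (p.1 * p.2 * (w ⬝ᵥ w) / σ ^ 2) *
        ∫ r, h (r - p.1 • w) * h (r - p.2 • w) ∂γ ∂G.prod G := by
    simp only [e2]
    rw [integral_integral_swap (f := fun r (p : ℝ × ℝ) => k p.1 r * k p.2 r) i3.swap]
    refine integral_congr_ae (Eventually.of_forall fun p => ?_)
    simp only
    have := integral_gaussPrior_add (N := N) hσ
      (fun r => h (r + p.2 • w) * h (r + p.1 • w)) ((-p.1 + -p.2) • w)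
    have ew : ∀ r : PhaseSpace N, r + (-p.1 + -p.2) • w + p.2 • w = r - p.1 • w := fun r => by
      module
    have ew' : ∀ r : PhaseSpace N, r + (-p.1 + -p.2) • w + p.1 • w = r - p.2 • w := fun r => by
      module
    simp only [ew, ew'] at this
    rw [hγ, this, ← integral_const_mul]
    refine integral_congr_ae (Eventually.of_forall fun r => ?_)
    have e := transDensity_mul hσ (-p.1) (-p.2) w r
    rw [neg_mul_neg] at e
    simp only [k]
    linear_combination (h (r + p.1 • w) * h (r + p.2 • w)) * e
  have i4 : Integrable (fun r => F r ^ 2) γ := by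
    simp only [e2]
    exact i3.integral_prod_right
  rw [e1, ← e3]
  have i5 : Integrable (fun r => (l + F r ^ 2 / l) / 2) γ :=
    ((integrable_const _).add (i4.div_const _)).div_const _
  refine (abs_integral_le_integral_abs).trans ?_
  have hle : ∀ r, |β r * F r| ≤ (l + F r ^ 2 / l) / 2 := fun r => by
    have := abs_le_half_add_sq_div hl (a := β r * F r) (b := |F r|) (by
      rw [abs_mul]
      exact mul_le_of_le_one_left (abs_nonneg _) (hβ _))
    rwa [sq_abs] at this
  refine (integral_mono_of_nonneg (Eventually.of_forall fun r => abs_nonneg _) i5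
    (Eventually.of_forall hle)).trans_eq ?_
  rw [integral_div, integral_add (integrable_const _) (i4.div_const _), integral_div,
    integral_const, probReal_univ, one_smul]

/-! ### Rotation of the prior -/

/-- The determinant squares to 1. The signs in `rot` are chosen so that it is an involution. -/
lemma measurePreserving_of_involutive {ι : Type*} [Fintype ι] {T : (ι → ℝ) →ₗ[ℝ] (ι → ℝ)}
    (hT : ∀ x, T (T x) = x) : MeasurePreserving T := by
  classical
  have h1 : T ∘ₗ T = LinearMap.id := LinearMap.ext hT
  have h2 : LinearMap.det T * LinearMap.det T = 1 := by
    rw [← LinearMap.det_comp, h1, LinearMap.det_id]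
  have h3 : |LinearMap.det T| = 1 := by
    rw [← sq, ← sq_abs] at h2
    exact (pow_eq_one_iff_of_nonneg (abs_nonneg _) two_ne_zero).1 h2
  refine ⟨T.continuous_of_finiteDimensional.measurable, ?_⟩
  rw [Real.map_linearMap_volume_pi_eq_smul_volume_pi (by rintro h; simp [h] at h2), abs_inv, h3]
  simp

/-- The rotation of phase space which maps `posDiff i / √2` and `momSum i / √2` to coordinates. -/
def rot : PhaseSpace N →ₗ[ℝ] PhaseSpace N where
  toFun r k := ![(r (k.1, 0) - r (k.1, 2)) / √2, (r (k.1, 1) + r (k.1, 3)) / √2,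
    -(r (k.1, 0) + r (k.1, 2)) / √2, (r (k.1, 1) - r (k.1, 3)) / √2] k.2
  map_add' x y := by
    funext ⟨i, j⟩
    fin_cases j <;> simp <;> ring
  map_smul' c x := by
    funext ⟨i, j⟩
    fin_cases j <;> simp <;> ring

lemma rot_apply_zero (r : PhaseSpace N) (i : Fin N) : rot r (i, 0) = posDiff i r / √2 := rfl

lemma rot_apply_one (r : PhaseSpace N) (i : Fin N) : rot r (i, 1) = momSum i r / √2 := rfl

lemma rot_rot (r : PhaseSpace N) : rot (rot r) = r := by
  have h : √2 * √2 = (2 : ℝ) := Real.mul_self_sqrt (by norm_num)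
  have h0 : √2 ≠ (0 : ℝ) := by positivity
  funext ⟨i, j⟩
  fin_cases j <;> simp [rot] <;> field_simp <;> rw [Real.sq_sqrt (by norm_num)] <;> ring

lemma sum_rot_sq (r : PhaseSpace N) : ∑ k, rot r k ^ 2 = ∑ k, r k ^ 2 := by
  rw [Fintype.sum_prod_type, Fintype.sum_prod_type]
  refine Finset.sum_congr rfl fun i _ => ?_
  simp [rot, Fin.sum_univ_four, div_pow]
  ring

lemma measurePreserving_rot {σ : ℝ} (hσ : 0 < σ) :
    MeasurePreserving (rot : PhaseSpace N → PhaseSpace N) (gaussPrior N σ) (gaussPrior N σ) := by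
  have hv := measurePreserving_of_involutive (rot_rot (N := N))
  refine ⟨hv.measurable, ?_⟩
  have hm := (continuous_prior (N := N) σ).measurable.ennreal_ofReal
  refine Measure.ext_of_lintegral _ fun f hf => ?_
  rw [lintegral_map hf hv.measurable, ← withDensity_prior hσ,
    lintegral_withDensity_eq_lintegral_mul _ hm hf,
    lintegral_withDensity_eq_lintegral_mul _ hm (g := fun r => f (rot r)) (hf.comp hv.measurable),
    ← hv.lintegral_comp (hm.mul hf)]
  refine lintegral_congr fun r => ?_
  simp only [Pi.mul_apply, prior, sum_rot_sq]

/-! ### Correlations of signs -/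

/-- The sign of a real number. -/
def sgn (x : ℝ) : ℝ := if 0 < x then 1 else -1

lemma measurable_sgn : Measurable sgn :=
  Measurable.ite measurableSet_Ioi measurable_const measurable_const

lemma abs_sgn (x : ℝ) : |sgn x| = 1 := by
  unfold sgn
  split_ifs <;> simp

lemma sgn_div {x c : ℝ} (hc : 0 < c) : sgn (x / c) = sgn x := by
  unfold sgn
  simp only [div_pos_iff_of_pos_right hc]

lemma le_gaussianReal_Ioc {v : ℝ≥0} (hv : v ≠ 0) {c d m : ℝ} (hcd : c ≤ d) (hc : -m ≤ c)
    (hd : d ≤ m) : (d - c) * gaussianPDFReal 0 v m ≤ (gaussianReal 0 v).real (Set.Ioc c d) := by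
  rw [measureReal_def, gaussianReal_apply_eq_integral 0 hv, ENNReal.toReal_ofReal
    (integral_nonneg fun x => gaussianPDFReal_nonneg 0 v x)]
  have h : ∫ x in Set.Ioc c d, gaussianPDFReal 0 v m ≤ ∫ x in Set.Ioc c d, gaussianPDFReal 0 v x := by
    refine setIntegral_mono_on (integrable_const _) (integrable_gaussianPDFReal 0 v).integrableOn
      measurableSet_Ioc fun x hx => ?_
    unfold gaussianPDFReal
    refine mul_le_mul_of_nonneg_left (Real.exp_le_exp.2 ?_) (by positivity)
    refine div_le_div_of_nonneg_right (neg_le_neg ?_) (by positivity)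
    rw [sub_zero, sub_zero]
    exact sq_le_sq' (by linarith [hx.1]) (by linarith [hx.2])
  simpa [hcd] using h

/-- The product of signs is -1 exactly between the two thresholds, so the integral is 1 - 2p with p
the mass of that interval. A bound on its modulus needs both p and 1 - p bounded below. -/
lemma abs_integral_sgn_mul_sgn_le {v : ℝ≥0} (hv : v ≠ 0) {a b m : ℝ} (ha : |a| ≤ m)
    (hb : |b| ≤ m) : |∫ x, sgn (x - a) * sgn (x - b) ∂gaussianReal 0 v| ≤
      Real.exp (-(2 * |a - b| * gaussianPDFReal 0 v (3 * m))) := by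
  wlog hab : a ≤ b generalizing a b
  · have := this hb ha (le_of_not_ge hab)
    simp only [mul_comm (sgn (_ - b))] at this
    rwa [abs_sub_comm]
  rw [abs_le] at ha hb
  set p := (gaussianReal 0 v).real (Set.Ioc a b) with hp
  have h1 : ∫ x, sgn (x - a) * sgn (x - b) ∂gaussianReal 0 v = 1 - 2 * p := by
    have e : ∀ x, sgn (x - a) * sgn (x - b) = 1 - 2 * (Set.Ioc a b).indicator 1 x := by
      intro x
      unfold sgn
      by_cases h1 : a < x
      · by_cases h2 : b < x
        · rw [Set.indicator_of_notMem (by simp [h2])]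
          simp [h1, h2]
        · rw [Set.indicator_of_mem (by exact ⟨h1, not_lt.1 h2⟩)]
          simp [h1, h2]
          norm_num
      · have h2 : ¬ b < x := fun h => h1 (hab.trans_lt h)
        rw [Set.indicator_of_notMem (by simp [h1])]
        simp [h1, h2]
    have hi : Integrable ((Set.Ioc a b).indicator (1 : ℝ → ℝ)) (gaussianReal 0 v) :=
      (integrable_const (1 : ℝ)).indicator measurableSet_Ioc
    simp only [e]
    rw [integral_sub (integrable_const _) (hi.const_mul 2), integral_const_mul, integral_indicator_one measurableSet_Ioc]
    simp [hp]
  have h2 : (b - a) * gaussianPDFReal 0 v (3 * m) ≤ p :=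
    le_gaussianReal_Ioc hv hab (by linarith) (by linarith)
  -- The adjacent interval of equal length supplies the lower bound on 1 - p. It reaches up to 2b -
  -- a, hence the density is evaluated at 3m.
  have h3 : (b - a) * gaussianPDFReal 0 v (3 * m) ≤
      (gaussianReal 0 v).real (Set.Ioc b (2 * b - a)) := by
    have := le_gaussianReal_Ioc hv (c := b) (d := 2 * b - a) (m := 3 * m) (by linarith)
      (by linarith) (by linarith)
    linarith
  have h4 : (gaussianReal 0 v).real (Set.Ioc b (2 * b - a)) ≤ 1 - p := by
    have := measureReal_union (μ := gaussianReal 0 v) (s₁ := Set.Ioc a b)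
      (s₂ := Set.Ioc b (2 * b - a)) (Set.Ioc_disjoint_Ioc_of_le le_rfl) measurableSet_Ioc
    have h5 : (gaussianReal 0 v).real (Set.Ioc a b ∪ Set.Ioc b (2 * b - a)) ≤ 1 :=
      measureReal_le_one
    linarith
  have h6 := Real.add_one_le_exp (-(2 * |a - b| * gaussianPDFReal 0 v (3 * m)))
  rw [abs_sub_comm, abs_of_nonneg (sub_nonneg.2 hab)] at h6 ⊢
  rw [h1, abs_le]
  constructor <;> linarith

/-- The product of the signs of all `posDiff i` and `momSum i`. -/
def signProd (r : PhaseSpace N) : ℝ := ∏ i, (sgn (posDiff i r) * sgn (momSum i r))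

lemma measurable_signProd : Measurable (signProd : PhaseSpace N → ℝ) := by
  unfold signProd
  exact Finset.measurable_prod _ fun i _ =>
    (measurable_sgn.comp (continuous_posDiff i).measurable).mul
      (measurable_sgn.comp (continuous_momSum i).measurable)

lemma abs_signProd (r : PhaseSpace N) : |signProd r| = 1 := by
  simp [signProd, Finset.abs_prod, abs_mul, abs_sgn]

/-- The rotation makes all the variables `posDiff i` and `momSum i`, divided by √2, independent
coordinates of the prior; positive factors do not affect signs. -/
lemma integral_signProd_mul {σ : ℝ} (hσ : 0 < σ) (y z : PhaseSpace N) :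
    ∫ r, signProd (r - y) * signProd (r - z) ∂gaussPrior N σ =
      ∏ i, ((∫ x, sgn (x - posDiff i y / √2) * sgn (x - posDiff i z / √2)
          ∂gaussianReal 0 (σ ^ 2).toNNReal) *
        ∫ x, sgn (x - momSum i y / √2) * sgn (x - momSum i z / √2)
          ∂gaussianReal 0 (σ ^ 2).toNNReal) := by
  let f : Fin N × Fin 4 → ℝ → ℝ := fun k x =>
    ![sgn (x - posDiff k.1 y / √2) * sgn (x - posDiff k.1 z / √2),
      sgn (x - momSum k.1 y / √2) * sgn (x - momSum k.1 z / √2), 1, 1] k.2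
  have h1 : ∀ r : PhaseSpace N, signProd (r - y) * signProd (r - z) = ∏ k, f k (rot r k) := by
    intro r
    rw [signProd, signProd, ← Finset.prod_mul_distrib, Fintype.prod_prod_type]
    refine Finset.prod_congr rfl fun i _ => ?_
    have h2 : (0 : ℝ) < √2 := by positivity
    simp only [Fin.prod_univ_four, f, Matrix.cons_val_zero, Matrix.cons_val_one, Matrix.cons_val,
      rot_apply_zero, rot_apply_one, ← sub_div, sgn_div h2, mul_one, map_sub]
    ring
  have hf : Measurable fun r : PhaseSpace N => ∏ k, f k (r k) := by
    refine Finset.measurable_prod _ fun k _ => ?_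
    have : Measurable (f k) := by
      obtain ⟨i, j⟩ := k
      have hs : ∀ c, Measurable fun x => sgn (x - c) := fun c =>
        measurable_sgn.comp (measurable_id.sub_const c)
      fin_cases j
      · exact (hs _).mul (hs _)
      · exact (hs _).mul (hs _)
      · exact measurable_const
      · exact measurable_const
    exact this.comp (measurable_pi_apply k)
  simp only [h1]
  have h3 := integral_map (μ := gaussPrior N σ) (measurePreserving_rot hσ).measurable.aemeasurable
    (f := fun r : PhaseSpace N => ∏ k, f k (r k)) hf.aestronglyMeasurable
  rw [(measurePreserving_rot hσ).map_eq] at h3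
  rw [← h3, gaussPrior, integral_fintype_prod_eq_prod, Fintype.prod_prod_type]
  refine Finset.prod_congr rfl fun i _ => ?_
  simp [Fin.prod_univ_four, f]

/-! ### Decay of the correlations under smoothing -/

/-- The rate of decay of the correlation between the signs of two translates. -/
def decayRate (σ : ℝ) (p : ℝ × ℝ) : ℝ :=
  √2 * |p.1 - p.2| * ((√(2 * Real.pi * σ ^ 2))⁻¹ * Real.exp (-(9 * (p.1 ^ 2 + p.2 ^ 2)) / 2))

lemma decayRate_nonneg (σ : ℝ) (p : ℝ × ℝ) : 0 ≤ decayRate σ p := by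
  unfold decayRate
  positivity

lemma continuous_decayRate (σ : ℝ) : Continuous (decayRate σ) := by
  unfold decayRate
  fun_prop

lemma abs_integral_sgn_translates_le {σ : ℝ} (hσ : 0 < σ) {u : ℝ} (hu : |u| ≤ √2 * σ)
    (p : ℝ × ℝ) : |∫ x, sgn (x - p.1 * u / √2) * sgn (x - p.2 * u / √2)
      ∂gaussianReal 0 (σ ^ 2).toNNReal| ≤ Real.exp (-(|u| * decayRate σ p)) := by
  have hv : (σ ^ 2).toNNReal ≠ 0 := by simpa using hσ.ne'
  have h2 : (0 : ℝ) < √2 := by positivity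
  have hm : ∀ t : ℝ, |t| ≤ √(p.1 ^ 2 + p.2 ^ 2) → |t * u / √2| ≤ √(p.1 ^ 2 + p.2 ^ 2) * σ := by
    intro t ht
    rw [abs_div, abs_mul, abs_of_pos h2, div_le_iff₀ h2, mul_assoc, mul_comm σ]
    exact mul_le_mul ht hu (abs_nonneg _) (Real.sqrt_nonneg _)
  have h1 := abs_integral_sgn_mul_sgn_le hv
    (hm p.1 (Real.abs_le_sqrt (by nlinarith [sq_nonneg p.2])))
    (hm p.2 (Real.abs_le_sqrt (by nlinarith [sq_nonneg p.1])))
  refine h1.trans_eq ?_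
  congr 2
  have h3 : gaussianPDFReal 0 (σ ^ 2).toNNReal (3 * (√(p.1 ^ 2 + p.2 ^ 2) * σ)) =
      (√(2 * Real.pi * σ ^ 2))⁻¹ * Real.exp (-(9 * (p.1 ^ 2 + p.2 ^ 2)) / 2) := by
    rw [gaussianPDFReal, Real.coe_toNNReal _ (sq_nonneg σ), sub_zero, mul_pow, mul_pow,
      Real.sq_sqrt (by positivity)]
    congr 2
    field_simp
    ring
  rw [h3, decayRate, ← sub_div, ← sub_mul, abs_div, abs_mul, abs_of_pos h2]
  field_simp
  rw [Real.sq_sqrt (by norm_num)]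
  ring

lemma sq_posDiff_le (i : Fin N) (w : PhaseSpace N) : posDiff i w ^ 2 ≤ 2 * (w ⬝ᵥ w) := by
  have h : w (i, 0) ^ 2 + w (i, 2) ^ 2 ≤ w ⬝ᵥ w := by
    rw [dotProduct_eq_sum]
    refine le_trans ?_ (Finset.single_le_sum (f := fun i => w (i, 0) * w (i, 0) +
      w (i, 1) * w (i, 1) + w (i, 2) * w (i, 2) + w (i, 3) * w (i, 3))
      (fun j _ => add_nonneg (add_nonneg (add_nonneg (mul_self_nonneg _) (mul_self_nonneg _))
        (mul_self_nonneg _)) (mul_self_nonneg _)) (Finset.mem_univ i))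
    nlinarith [mul_self_nonneg (w (i, 1)), mul_self_nonneg (w (i, 3))]
  rw [posDiff_apply]
  nlinarith [sq_nonneg (w (i, 0) + w (i, 2))]

lemma sq_momSum_le (i : Fin N) (w : PhaseSpace N) : momSum i w ^ 2 ≤ 2 * (w ⬝ᵥ w) := by
  have h : w (i, 1) ^ 2 + w (i, 3) ^ 2 ≤ w ⬝ᵥ w := by
    rw [dotProduct_eq_sum]
    refine le_trans ?_ (Finset.single_le_sum (f := fun i => w (i, 0) * w (i, 0) +
      w (i, 1) * w (i, 1) + w (i, 2) * w (i, 2) + w (i, 3) * w (i, 3))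
      (fun j _ => add_nonneg (add_nonneg (add_nonneg (mul_self_nonneg _) (mul_self_nonneg _))
        (mul_self_nonneg _)) (mul_self_nonneg _)) (Finset.mem_univ i))
    nlinarith [mul_self_nonneg (w (i, 0)), mul_self_nonneg (w (i, 2))]
  rw [momSum_apply]
  nlinarith [sq_nonneg (w (i, 1) - w (i, 3))]

lemma abs_integral_signProd_translates_le {σ : ℝ} (hσ : 0 < σ) {w : PhaseSpace N}
    (hw : w ⬝ᵥ w ≤ σ ^ 2) (p : ℝ × ℝ) :
    |∫ r, signProd (r - p.1 • w) * signProd (r - p.2 • w) ∂gaussPrior N σ| ≤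
      Real.exp (-((∑ i, (|posDiff i w| + |momSum i w|)) * decayRate σ p)) := by
  have hu : ∀ u : ℝ, u ^ 2 ≤ 2 * (w ⬝ᵥ w) → |u| ≤ √2 * σ := by
    intro u hu
    refine abs_le_of_sq_le_sq ?_ (by positivity)
    rw [mul_pow, Real.sq_sqrt (by norm_num)]
    linarith
  rw [integral_signProd_mul hσ, Finset.abs_prod, Finset.sum_mul, ← Finset.sum_neg_distrib,
    Real.exp_sum]
  refine Finset.prod_le_prod (fun i _ => abs_nonneg _) fun i _ => ?_
  rw [abs_mul, add_mul, neg_add, Real.exp_add]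
  simp only [map_smul, smul_eq_mul]
  exact mul_le_mul (abs_integral_sgn_translates_le hσ (hu _ (sq_posDiff_le i w)) p)
    (abs_integral_sgn_translates_le hσ (hu _ (sq_momSum_le i w)) p) (abs_nonneg _)
    (Real.exp_pos _).le

lemma integrable_exp_sq_gaussianReal :
    Integrable (fun x : ℝ => Real.exp (x ^ 2 / 4)) (gaussianReal 0 1) := by
  rw [gaussianReal_of_var_ne_zero 0 one_ne_zero, integrable_withDensity_iff
    (measurable_gaussianPDF 0 1) (Eventually.of_forall fun x => gaussianPDF_lt_top)]
  refine ((integrable_exp_neg_mul_sq (b := 1 / 4) (by norm_num)).const_mul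
    (√(2 * Real.pi))⁻¹).congr (Eventually.of_forall fun x => ?_)
  simp only [toReal_gaussianPDF, gaussianPDFReal]
  rw [mul_left_comm, ← Real.exp_add]
  simp only [NNReal.coe_one, mul_one]
  congr 2
  ring

lemma integrable_exp_sq_prod : Integrable (fun p : ℝ × ℝ => Real.exp ((p.1 ^ 2 + p.2 ^ 2) / 4))
    ((gaussianReal 0 1).prod (gaussianReal 0 1)) := by
  refine (integrable_exp_sq_gaussianReal.mul_prod integrable_exp_sq_gaussianReal).congr
    (Eventually.of_forall fun p => ?_)
  simp only
  rw [← Real.exp_add, add_div]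

/-- The rate is positive off the diagonal, which is a null set, and the remaining exponential is a
dominating function. -/
lemma tendsto_integral_decay {σ : ℝ} (hσ : 0 < σ) :
    Tendsto (fun R : ℝ => ∫ p : ℝ × ℝ, Real.exp ((p.1 ^ 2 + p.2 ^ 2) / 4) *
      Real.exp (-(R * decayRate σ p)) ∂(gaussianReal 0 1).prod (gaussianReal 0 1)) atTop (𝓝 0) := by
  have hne : ∀ᵐ p : ℝ × ℝ ∂(gaussianReal 0 1).prod (gaussianReal 0 1), p.1 ≠ p.2 := by
    have hs : MeasurableSet {p : ℝ × ℝ | p.1 = p.2} := measurableSet_eq_fun measurable_fst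
      measurable_snd
    have h0 : ((gaussianReal 0 1).prod (gaussianReal 0 1)) {p : ℝ × ℝ | p.1 = p.2} = 0 := by
      rw [Measure.measure_prod_null hs]
      refine Eventually.of_forall fun x => ?_
      have : Prod.mk x ⁻¹' {p : ℝ × ℝ | p.1 = p.2} = {x} := by
        ext y
        simp [eq_comm]
      have := nullSingletonClass_gaussianReal (μ := 0) (v := 1) one_ne_zero
      simp only [*, measure_singleton, Pi.zero_apply]
    exact measure_mono_null (fun p hp => by simpa using hp) h0
  suffices h : Tendsto (fun R : ℝ => ∫ p : ℝ × ℝ, Real.exp ((p.1 ^ 2 + p.2 ^ 2) / 4) *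
      Real.exp (-(R * decayRate σ p)) ∂(gaussianReal 0 1).prod (gaussianReal 0 1)) atTop
      (𝓝 (∫ _ : ℝ × ℝ, (0 : ℝ) ∂(gaussianReal 0 1).prod (gaussianReal 0 1))) by
    rwa [integral_zero] at h
  refine tendsto_integral_filter_of_dominated_convergence (l := (atTop : Filter ℝ))
    (fun p : ℝ × ℝ => Real.exp ((p.1 ^ 2 + p.2 ^ 2) / 4)) ?_ ?_ integrable_exp_sq_prod ?_
  · refine Eventually.of_forall fun R => Continuous.aestronglyMeasurable ?_
    have := continuous_decayRate σ
    fun_prop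
  · filter_upwards [eventually_ge_atTop 0] with R hR
    refine Eventually.of_forall fun p => ?_
    rw [norm_mul, Real.norm_of_nonneg (Real.exp_pos _).le, Real.norm_of_nonneg (Real.exp_pos _).le]
    refine mul_le_of_le_one_right (Real.exp_pos _).le (Real.exp_le_one_iff.2 ?_)
    have := mul_nonneg hR (decayRate_nonneg σ p)
    linarith
  · filter_upwards [hne] with p hp
    have hpos : 0 < decayRate σ p := by
      have := abs_pos.2 (sub_ne_zero.2 hp)
      unfold decayRate
      positivity
    rw [← mul_zero (Real.exp ((p.1 ^ 2 + p.2 ^ 2) / 4))]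
    refine Tendsto.const_mul _ (Real.tendsto_exp_atBot.comp ?_)
    exact tendsto_neg_atTop_atBot.comp (tendsto_id.atTop_mul_const hpos)

/-- Smoothing along a direction with large overlap with all the variables `posDiff i` and
`momSum i` destroys the correlation with the parity. -/
lemma exists_forall_abs_integral_signProd_le {σ : ℝ} (hσ : 0 < σ) {ε : ℝ} (hε : 0 < ε) :
    ∃ R₀ : ℝ, ∀ (N : ℕ) (w : PhaseSpace N), w ⬝ᵥ w ≤ σ ^ 2 / 2 →
      R₀ ≤ ∑ i, (|posDiff i w| + |momSum i w|) → ∀ β : PhaseSpace N → ℝ, Measurable β →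
      (∀ r, |β r| ≤ 1) →
      |∫ r, signProd r * ∫ g, β (r - g • w) ∂gaussianReal 0 1 ∂gaussPrior N σ| ≤ ε := by
  obtain ⟨R₀, hR₀⟩ := eventually_atTop.1
    ((tendsto_integral_decay hσ).eventually_le_const (sq_pos_of_pos hε))
  refine ⟨R₀, fun N w hw hR β hβm hβ => ?_⟩
  have hw0 : 0 ≤ w ⬝ᵥ w := Finset.sum_nonneg fun i _ => mul_self_nonneg _
  -- The bound σ²/2 on |w|² gives an exponent that the standard Gaussian density integrates,
  -- whatever N and w are.
  have hexp : ∀ p : ℝ × ℝ, Real.exp (p.1 * p.2 * (w ⬝ᵥ w) / σ ^ 2) ≤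
      Real.exp ((p.1 ^ 2 + p.2 ^ 2) / 4) := by
    intro p
    refine Real.exp_le_exp.2 ?_
    rw [div_le_iff₀ (by positivity)]
    nlinarith [mul_nonneg (sq_nonneg (p.1 - p.2)) hw0,
      mul_nonneg (add_nonneg (sq_nonneg p.1) (sq_nonneg p.2)) (sub_nonneg.2 hw)]
  have hint : Integrable (fun p : ℝ × ℝ => Real.exp (p.1 * p.2 * (w ⬝ᵥ w) / σ ^ 2))
      ((gaussianReal 0 1).prod (gaussianReal 0 1)) := by
    refine integrable_exp_sq_prod.mono' (Continuous.aestronglyMeasurable (by fun_prop))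
      (Eventually.of_forall fun p => ?_)
    rw [Real.norm_of_nonneg (Real.exp_pos _).le]
    exact hexp p
  refine (abs_integral_smoothing_le hσ measurable_signProd hβm (fun r => (abs_signProd r).le) hβ w
    hint hε).trans ?_
  set R := ∑ i, (|posDiff i w| + |momSum i w|) with hRdef
  have hJ : ∫ p : ℝ × ℝ, Real.exp (p.1 * p.2 * (w ⬝ᵥ w) / σ ^ 2) *
        ∫ r, signProd (r - p.1 • w) * signProd (r - p.2 • w) ∂gaussPrior N σ
          ∂(gaussianReal 0 1).prod (gaussianReal 0 1) ≤ ε ^ 2 := by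
    refine le_trans ?_ (hR₀ R hR)
    have hRnn : 0 ≤ R := Finset.sum_nonneg fun i _ => by positivity
    have hI : Integrable (fun p : ℝ × ℝ => Real.exp ((p.1 ^ 2 + p.2 ^ 2) / 4) *
        Real.exp (-(R * decayRate σ p))) ((gaussianReal 0 1).prod (gaussianReal 0 1)) := by
      have := continuous_decayRate σ
      refine integrable_exp_sq_prod.mono' (Continuous.aestronglyMeasurable (by fun_prop))
        (Eventually.of_forall fun p => ?_)
      rw [Real.norm_of_nonneg (by positivity)]
      refine mul_le_of_le_one_right (Real.exp_pos _).le (Real.exp_le_one_iff.2 ?_)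
      have := mul_nonneg hRnn (decayRate_nonneg σ p)
      linarith
    refine (le_abs_self _).trans (abs_integral_le_integral_abs.trans ?_)
    refine integral_mono_of_nonneg (Eventually.of_forall fun p => abs_nonneg _) hI
      (Eventually.of_forall fun p => ?_)
    simp only
    rw [abs_mul, Real.abs_exp]
    exact mul_le_mul (hexp p) (abs_integral_signProd_translates_le hσ (by nlinarith) p)
      (abs_nonneg _) (Real.exp_pos _).le
  have := div_le_div_of_nonneg_right hJ hε.le
  rw [sq ε, mul_self_div_self] at this
  linarith

/-! ### Gaussian measures on coordinate spaces -/

lemma exists_gaussian {ι : Type*} [Fintype ι] [DecidableEq ι] {S : Matrix ι ι ℝ}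
    (hS : S.PosSemidef) : ∃ μ : Measure (ι → ℝ), IsProbabilityMeasure μ ∧
      ∀ x : ι → ℝ, ∫ z, Complex.exp ((z ⬝ᵥ x : ℝ) * Complex.I) ∂μ =
        Complex.exp (-(x ⬝ᵥ S.mulVec x : ℝ) / 2) := by
  have hm : Measurable (WithLp.ofLp : EuclideanSpace ℝ ι → ι → ℝ) := by fun_prop
  refine ⟨(multivariateGaussian 0 S).map WithLp.ofLp,
    Measure.isProbabilityMeasure_map hm.aemeasurable, fun x => ?_⟩
  have h := charFun_multivariateGaussian (μ := 0) hS (WithLp.toLp 2 x)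
  rw [charFun_apply] at h
  rw [integral_map hm.aemeasurable (Continuous.aestronglyMeasurable (by fun_prop))]
  convert h using 1
  · refine integral_congr_ae (Eventually.of_forall fun z => ?_)
    simp only [EuclideanSpace.inner_eq_star_dotProduct, star_trivial]
    rw [dotProduct_comm]
  · congr 1
    simp
    ring

lemma strongDual_eq_dotProduct {ι : Type*} [Fintype ι] [DecidableEq ι]
    (L : StrongDual ℝ (ι → ℝ)) (z : ι → ℝ) : L z = z ⬝ᵥ fun k => L (Pi.single k 1) := by
  conv_lhs => rw [← Finset.univ_sum_single z]
  rw [map_sum, dotProduct]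
  refine Finset.sum_congr rfl fun k _ => ?_
  rw [← smul_eq_mul, ← map_smul]
  congr 1
  funext l
  by_cases h : l = k
  · subst h
    simp
  · simp [h]

lemma measure_ext_of_dotProduct {ι : Type*} [Fintype ι] {μ ν : Measure (ι → ℝ)}
    [IsFiniteMeasure μ] [IsFiniteMeasure ν]
    (h : ∀ x : ι → ℝ, ∫ z, Complex.exp ((z ⬝ᵥ x : ℝ) * Complex.I) ∂μ =
      ∫ z, Complex.exp ((z ⬝ᵥ x : ℝ) * Complex.I) ∂ν) : μ = ν := by
  classical
  refine Measure.ext_of_charFunDual (funext fun L => ?_)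
  rw [charFunDual_apply, charFunDual_apply]
  obtain ⟨x, hx⟩ : ∃ x : ι → ℝ, ∀ z, L z = z ⬝ᵥ x := ⟨_, strongDual_eq_dotProduct L⟩
  simp only [hx]
  exact h x

/-- A Gaussian random vector whose covariance matrix dominates `w wᵀ` contains an independent
Gaussian random variable along the direction `w`. -/
lemma exists_eq_map_add_smul {ι : Type*} [Fintype ι] [DecidableEq ι] {S : Matrix ι ι ℝ}
    (hS : S.IsSymm) {w : ι → ℝ} (hw : ∀ x, (x ⬝ᵥ w) ^ 2 ≤ x ⬝ᵥ S.mulVec x)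
    {μ : Measure (ι → ℝ)} [IsProbabilityMeasure μ]
    (hμ : ∀ x : ι → ℝ, ∫ z, Complex.exp ((z ⬝ᵥ x : ℝ) * Complex.I) ∂μ =
        Complex.exp (-(x ⬝ᵥ S.mulVec x : ℝ) / 2)) :
    ∃ μ₀ : Measure (ι → ℝ), IsProbabilityMeasure μ₀ ∧
      μ = (μ₀.prod (gaussianReal 0 1)).map fun p => p.1 + p.2 • w := by
  have hq : ∀ x : ι → ℝ, x ⬝ᵥ (S - Matrix.vecMulVec w w).mulVec x =
      x ⬝ᵥ S.mulVec x - (x ⬝ᵥ w) ^ 2 := by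
    intro x
    rw [Matrix.sub_mulVec, dotProduct_sub, Matrix.vecMulVec_mulVec, dotProduct_smul,
      dotProduct_comm w x, sq]
    rfl
  -- Removing the noise along w leaves a valid covariance matrix. A Gaussian vector with it plus an
  -- independent multiple of w has the required characteristic function.
  have hpsd : (S - Matrix.vecMulVec w w).PosSemidef := by
    refine Matrix.PosSemidef.of_dotProduct_mulVec_nonneg ?_ fun x => ?_
    · rw [Matrix.IsHermitian, Matrix.conjTranspose_eq_transpose_of_trivial, Matrix.transpose_sub,
        hS.eq, Matrix.transpose_vecMulVec]
    · rw [star_trivial, hq]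
      linarith [hw x]
  obtain ⟨μ₀, h₀, hμ₀⟩ := exists_gaussian hpsd
  have hm : Measurable fun p : (ι → ℝ) × ℝ => p.1 + p.2 • w := by fun_prop
  have := Measure.isProbabilityMeasure_map (μ := μ₀.prod (gaussianReal 0 1)) hm.aemeasurable
  refine ⟨μ₀, h₀, measure_ext_of_dotProduct fun x => ?_⟩
  rw [hμ, integral_map hm.aemeasurable (Continuous.aestronglyMeasurable (by fun_prop))]
  have e : ∀ p : (ι → ℝ) × ℝ, Complex.exp (((p.1 + p.2 • w) ⬝ᵥ x : ℝ) * Complex.I) =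
      Complex.exp ((p.1 ⬝ᵥ x : ℝ) * Complex.I) *
        Complex.exp ((x ⬝ᵥ w : ℝ) * p.2 * Complex.I) := by
    intro p
    rw [← Complex.exp_add, add_dotProduct, smul_dotProduct, dotProduct_comm w]
    push_cast
    congr 1
    simp
    ring
  simp only [e]
  have h1 := charFun_gaussianReal (μ := 0) (v := 1) (x ⬝ᵥ w)
  rw [charFun_apply_real] at h1
  rw [integral_prod_mul (fun z : ι → ℝ => Complex.exp ((z ⬝ᵥ x : ℝ) * Complex.I))
    (fun g : ℝ => Complex.exp ((x ⬝ᵥ w : ℝ) * g * Complex.I)), hμ₀, h1, hq, ← Complex.exp_add]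
  congr 1
  push_cast
  ring

/-! ### The parity of the number of positive products as a product of signs -/

/-- A positive product is counted and contributes -1, a negative one contributes 1: each pair gives
minus the product of its signs. -/
lemma neg_one_pow_posCount {r : PhaseSpace N} (h1 : ∀ i, posDiff i r ≠ 0)
    (h2 : ∀ i, momSum i r ≠ 0) : (-1 : ℝ) ^ posCount r = (-1) ^ N * signProd r := by
  have e : ∀ x y : ℝ, x ≠ 0 → y ≠ 0 →
      (-1 : ℝ) ^ (if 0 < x * y then 1 else 0) = -1 * (sgn x * sgn y) := by
    intro x y hx hy
    unfold sgn
    rcases hx.lt_or_gt with hx | hx <;> rcases hy.lt_or_gt with hy | hy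
    · simp [mul_pos_of_neg_of_neg hx hy, hx.not_gt, hy.not_gt]
    · simp [(mul_neg_of_neg_of_pos hx hy).not_gt, hx.not_gt, hy]
    · simp [(mul_neg_of_pos_of_neg hx hy).not_gt, hx, hy.not_gt]
    · simp [mul_pos hx hy, hx, hy]
  have hN : (-1 : ℝ) ^ N = ∏ _i : Fin N, (-1 : ℝ) := by simp
  rw [posCount_eq_sum, ← Finset.prod_pow_eq_pow_sum, hN, signProd, ← Finset.prod_mul_distrib]
  exact Finset.prod_congr rfl fun i _ => e _ _ (h1 i) (h2 i)

lemma ae_neg_one_pow_posCount {σ : ℝ} (hσ : 0 < σ) :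
    ∀ᵐ r ∂gaussPrior N σ, (-1 : ℝ) ^ posCount r = (-1) ^ N * signProd r := by
  have h1 := ae_all_iff.2 fun i : Fin N =>
    gaussPrior_absolutelyContinuous hσ (ae_ne_zero_of_ne_zero (posDiff_ne_zero i))
  have h2 := ae_all_iff.2 fun i : Fin N =>
    gaussPrior_absolutelyContinuous hσ (ae_ne_zero_of_ne_zero (momSum_ne_zero i))
  filter_upwards [h1, h2] with r h1 h2
  exact neg_one_pow_posCount h1 h2

/-! ### Success probability as a correlation with the sign product, and the bound for PPT
measurements. -/

namespace GaussianMeasurement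

lemma measurable_noise_real (M : GaussianMeasurement N) (s : ℝ) {E : Set (PhaseSpace N)}
    (hE : MeasurableSet E) : Measurable fun r => (M.noise s).real {z | r - z ∈ E} :=
  (M.measurable_noise_preimage s hE).ennreal_toReal

/-- With β the probability of guessing even, the success probability is the integral of β over the
even region plus that of 1 - β over the odd one. As the odd region has mass 1/2, the excess is the
integral of β against (-1)^{`posCount`}. -/
lemma success_sub_half (M : GaussianMeasurement N) {σ : ℝ} (hσ : 0 < σ) (hN : 1 ≤ N) (s : ℝ)
    {E : Set (PhaseSpace N)} (hE : MeasurableSet E) :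
    M.success (rhoEven N σ s) (rhoOdd N σ s) E - 1 / 2 = (-1) ^ N *
      ∫ r, signProd r * (M.noise s).real {z | r - z ∈ E} ∂gaussPrior N σ := by
  set β : PhaseSpace N → ℝ := fun r => (M.noise s).real {z | r - z ∈ E} with hβ
  have hβm : Measurable β := M.measurable_noise_real s hE
  have hβi : Integrable β (gaussPrior N σ) :=
    Integrable.of_bound hβm.aestronglyMeasurable 1 (Eventually.of_forall fun r => by
      rw [Real.norm_of_nonneg measureReal_nonneg]
      exact measureReal_le_one)
  have hc : ∀ r, (M.noise s).real {z | r - z ∈ Eᶜ} = 1 - β r := fun r =>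
    probReal_compl_eq_one_sub ((measurable_const.sub measurable_id) hE)
  have h1 : ∫ r, signProd r * β r ∂gaussPrior N σ =
      (-1) ^ N * ∫ r, (-1 : ℝ) ^ posCount r * β r ∂gaussPrior N σ := by
    rw [← integral_const_mul]
    refine integral_congr_ae ?_
    filter_upwards [ae_neg_one_pow_posCount hσ] with r hr
    rw [hr, ← mul_assoc, ← mul_assoc, ← mul_pow]
    simp
  have h2 : ∫ r, (-1 : ℝ) ^ posCount r * β r ∂gaussPrior N σ =
      (∫ r in {r | Even (posCount r)}, β r ∂gaussPrior N σ) -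
        ∫ r in {r | Odd (posCount r)}, β r ∂gaussPrior N σ := by
    have hi : Integrable (fun r => (-1 : ℝ) ^ posCount r * β r) (gaussPrior N σ) := by
      refine hβi.mono ((Measurable.mul ?_ hβm).aestronglyMeasurable)
        (Eventually.of_forall fun r => by simp)
      exact (measurable_from_top (f := fun n : ℕ => (-1 : ℝ) ^ n)).comp measurable_posCount
    rw [← integral_add_compl measurableSet_even hi, compl_even,
      setIntegral_congr_fun measurableSet_even (g := β) (fun r hr => ?_),
      setIntegral_congr_fun measurableSet_odd (g := fun r => -β r) (fun r hr => ?_),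
      integral_neg, sub_eq_add_neg]
    · rw [Odd.neg_one_pow hr, neg_one_mul]
    · rw [Even.neg_one_pow hr, one_mul]
  rw [success_eq M hσ s hE, h1, h2, ← mul_assoc, ← mul_pow]
  simp only [hc]
  rw [integral_sub (integrable_const _) hβi.integrableOn]
  simp only [integral_const, smul_eq_mul, mul_one, measureReal_restrict_apply_univ,
    gaussPrior_real_odd hσ hN]
  simp
  ring

lemma PPT.cov_nonneg {M : GaussianMeasurement N} (hM : M.PPT) (x : PhaseSpace N) :
    0 ≤ x ⬝ᵥ M.cov.mulVec x := by
  have h := hM.uncertainty x 0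
  simpa [ptForm] using h

lemma sqCov_nonneg (s : ℝ) (x : PhaseSpace N) : 0 ≤ x ⬝ᵥ (sqCov N s).mulVec x := by
  rw [dotProduct_sqCov]
  exact Finset.sum_nonneg fun i _ => by positivity

/-- The squeezed vacuum only adds nonnegative noise, so a quarter of the seed's covariance suffices.
This makes the final bound uniform in the squeezing. -/
lemma PPT.ptForm_le {M : GaussianMeasurement N} (hM : M.PPT) (s : ℝ) (x y : PhaseSpace N) :
    ptForm x y ≤ 2 * (x ⬝ᵥ (M.noiseCov s).mulVec x + y ⬝ᵥ (M.noiseCov s).mulVec y) := by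
  have h := hM.uncertainty (-x) y
  have hn : ptForm (-x) y = -ptForm x y := by
    rw [ptForm, ptForm, ← Finset.sum_neg_distrib]
    refine Finset.sum_congr rfl fun i _ => ?_
    simp only [Pi.neg_apply]
    ring
  rw [hn, Matrix.mulVec_neg, neg_dotProduct_neg] at h
  rw [dotProduct_noiseCov, dotProduct_noiseCov]
  linarith [sqCov_nonneg s x, sqCov_nonneg s y]

end GaussianMeasurement

/-- PPT Gaussian measurements are asymptotically useless. -/
lemma exists_forall_PPT_success {σ : ℝ} (hσ : 0 < σ) {ε : ℝ} (hε : 0 < ε) :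
    ∃ N₀ : ℕ, ∀ N : ℕ, 1 ≤ N → N₀ ≤ N → ∀ (s : ℝ) (M : GaussianMeasurement N), M.PPT →
      ∀ E : Set (PhaseSpace N), MeasurableSet E →
        |M.success (rhoEven N σ s) (rhoOdd N σ s) E - 1 / 2| ≤ ε := by
  obtain ⟨R₀, hR₀⟩ := exists_forall_abs_integral_signProd_le hσ hε
  set θ := σ ^ 2 / 2 with hθ
  have hθ0 : 0 < θ := by positivity
  set c := 3 * θ / (4 * θ + 5) with hc
  have hc0 : 0 < c := by positivity
  -- From this size on, the guaranteed overlap √(N c) is at least `R₀`, which was chosen before N.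
  obtain ⟨N₀, hN₀⟩ := exists_nat_ge (R₀ ^ 2 / c)
  refine ⟨N₀, fun N hN hNN s M hM E hE => ?_⟩
  have hpsd : ∀ x, 0 ≤ x ⬝ᵥ (M.noiseCov s).mulVec x := fun x => by
    rw [M.dotProduct_noiseCov]
    linarith [GaussianMeasurement.sqCov_nonneg s x, hM.cov_nonneg x]
  obtain ⟨w, hw1, hw2, hw3⟩ := exists_noise_direction (M.isSymm_noiseCov s) hpsd (hM.ptForm_le s)
    hθ0 hN
  have hR : R₀ ≤ ∑ i, (|posDiff i w| + |momSum i w|) := by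
    refine le_trans ?_ hw3
    refine Real.le_sqrt_of_sq_le ?_
    rw [← hc]
    have : (N₀ : ℝ) ≤ N := by exact_mod_cast hNN
    have h := hN₀.trans this
    rwa [div_le_iff₀ hc0] at h
  obtain ⟨μ₀, hμ₀, hμ⟩ := exists_eq_map_add_smul (M.isSymm_noiseCov s) hw1 (M.integral_cexp_noise s)
  have hβm : Measurable fun r => μ₀ {z | r - z ∈ E} :=
    measurable_measure_prodMk_left (ν := μ₀)
      (s := {p : PhaseSpace N × PhaseSpace N | p.1 - p.2 ∈ E}) ((measurable_fst.sub measurable_snd) hE)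
  -- Fubini for the decomposed noise exhibits the decision probability as a smoothing along w of
  -- another probability.
  have hβ : ∀ r, (M.noise s).real {z | r - z ∈ E} =
      ∫ g, μ₀.real {z | r - g • w - z ∈ E} ∂gaussianReal 0 1 := by
    intro r
    have hset : MeasurableSet {z | r - z ∈ E} := (measurable_const.sub measurable_id) hE
    have hm : Measurable fun p : PhaseSpace N × ℝ => p.1 + p.2 • w := by fun_prop
    simp only [measureReal_def]
    rw [integral_toReal (f := fun g : ℝ => μ₀ {z | r - g • w - z ∈ E})
      (hβm.comp (by fun_prop)).aemeasurable
      (Eventually.of_forall fun g => measure_lt_top _ _), hμ, Measure.map_apply hm hset,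
      Measure.prod_apply_symm (hm hset)]
    congr 2
    funext g
    congr 1
    ext z
    simp only [Set.mem_preimage, Set.mem_ofPred_eq]
    rw [sub_sub, add_comm]
  rw [M.success_sub_half hσ hN s hE, abs_mul, abs_pow, abs_neg, abs_one, one_pow, one_mul]
  simp only [hβ]
  refine hR₀ N w hw2 hR (fun r => μ₀.real {z | r - z ∈ E}) hβm.ennreal_toReal fun r => ?_
  rw [abs_of_nonneg measureReal_nonneg]
  exact measureReal_le_one

/-! ### Discrimination by the squeezed measurement -/

namespace GaussianMeasurement

lemma map_noise_eq_gaussianReal (M : GaussianMeasurement N) (s : ℝ) (x : PhaseSpace N) {v : ℝ≥0}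
    (hv : x ⬝ᵥ (M.noiseCov s).mulVec x = v) :
    (M.noise s).map (fun z => x ⬝ᵥ z) = gaussianReal 0 v := by
  have hm : Measurable fun z : PhaseSpace N => x ⬝ᵥ z := by
    unfold dotProduct
    fun_prop
  have := Measure.isProbabilityMeasure_map (μ := M.noise s) hm.aemeasurable
  refine Measure.ext_of_charFun (funext fun t => ?_)
  rw [charFun_gaussianReal, charFun_apply_real, integral_map hm.aemeasurable
    (Continuous.aestronglyMeasurable (by fun_prop))]
  have h := M.integral_cexp_noise s (t • x)
  simp only [Matrix.mulVec_smul, dotProduct_smul, smul_dotProduct, smul_eq_mul, hv] at h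
  convert h using 1
  · refine integral_congr_ae (Eventually.of_forall fun z => ?_)
    simp only
    rw [dotProduct_comm z]
    push_cast
    rfl
  · congr 1
    push_cast
    ring

lemma noise_real_le (M : GaussianMeasurement N) (s : ℝ) (x : PhaseSpace N) {v : ℝ≥0}
    (hv : x ⬝ᵥ (M.noiseCov s).mulVec x = v) {t : ℝ} (ht : 0 < t) :
    (M.noise s).real {z | t ≤ |x ⬝ᵥ z|} ≤ v / t ^ 2 := by
  have hm : Measurable fun z : PhaseSpace N => x ⬝ᵥ z := by
    unfold dotProduct
    fun_prop
  have hs : MeasurableSet {y : ℝ | t ≤ |y|} := measurableSet_le measurable_const (by fun_prop)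
  have h1 : (M.noise s) {z | t ≤ |x ⬝ᵥ z|} = gaussianReal 0 v {y | t ≤ |y|} := by
    rw [← M.map_noise_eq_gaussianReal s x hv, Measure.map_apply hm hs]
    rfl
  have h2 := meas_ge_le_variance_div_sq (μ := gaussianReal 0 v) (X := id)
    (memLp_id_gaussianReal 2) ht
  simp only [variance_id_gaussianReal, integral_id_gaussianReal, id_eq, sub_zero] at h2
  rw [measureReal_def, h1]
  exact ENNReal.toReal_le_of_le_ofReal (by positivity) h2

end GaussianMeasurement

lemma noiseCov_squeezedMeasurement (s : ℝ) (x : PhaseSpace N) :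
    x ⬝ᵥ ((squeezedMeasurement N s).noiseCov s).mulVec x = (x ⬝ᵥ (sqCov N s).mulVec x) / 2 := by
  rw [GaussianMeasurement.dotProduct_noiseCov]
  change (_ + x ⬝ᵥ (sqCov N s).mulVec x) / 4 = _
  ring

/-- State and seed have the same squeezing, and the antisqueezed part of the form vanishes on this
vector. -/
lemma posVec_noiseCov (s : ℝ) (i : Fin N) :
    posVec i ⬝ᵥ ((squeezedMeasurement N s).noiseCov s).mulVec (posVec i) =
      (Real.exp (-2 * s)).toNNReal := by
  rw [noiseCov_squeezedMeasurement, dotProduct_sqCov, Finset.sum_eq_single i,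
    Real.coe_toNNReal _ (Real.exp_pos _).le]
  · simp [posVec]
    ring
  · intro j _ hj
    simp [posVec, hj]
  · simp

lemma momVec_noiseCov (s : ℝ) (i : Fin N) :
    momVec i ⬝ᵥ ((squeezedMeasurement N s).noiseCov s).mulVec (momVec i) =
      (Real.exp (-2 * s)).toNNReal := by
  rw [noiseCov_squeezedMeasurement, dotProduct_sqCov, Finset.sum_eq_single i,
    Real.coe_toNNReal _ (Real.exp_pos _).le]
  · simp [momVec]
    ring
  · intro j _ hj
    simp [momVec, hj]
  · simp

lemma sub_mul_pos_iff {a b c d : ℝ} (h1 : |c| < |a|) (h2 : |d| < |b|) :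
    0 < (a - c) * (b - d) ↔ 0 < a * b := by
  have key : ∀ x y : ℝ, |y| < |x| → (0 < x - y ↔ 0 < x) ∧ (x - y < 0 ↔ x < 0) := by
    intro x y h
    rcases le_or_gt 0 x with hx | hx
    · rw [abs_of_nonneg hx, abs_lt] at h
      constructor <;> constructor <;> intro <;> linarith
    · rw [abs_of_neg hx, abs_lt] at h
      constructor <;> constructor <;> intro <;> linarith
  rw [mul_pos_iff, mul_pos_iff, (key a c h1).1, (key a c h1).2, (key b d h2).1, (key b d h2).2]

/-- Noise smaller than the signal in every variable cannot change any sign. -/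
lemma posCount_sub {r z : PhaseSpace N} (h1 : ∀ i, |posDiff i z| < |posDiff i r|)
    (h2 : ∀ i, |momSum i z| < |momSum i r|) : posCount (r - z) = posCount r := by
  rw [posCount_eq_sum, posCount_eq_sum]
  refine Finset.sum_congr rfl fun i _ => ?_
  simp only [map_sub, sub_mul_pos_iff (h1 i) (h2 i)]

/-- A bound for the probability that the squeezed measurement errs at the displacement `r`. -/
def errBound (v : ℝ) (r : PhaseSpace N) : ℝ :=
  ∑ i, (min 1 (v / posDiff i r ^ 2) + min 1 (v / momSum i r ^ 2))

lemma measurable_errBound (v : ℝ) : Measurable (errBound v : PhaseSpace N → ℝ) := by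
  unfold errBound
  refine Finset.measurable_sum _ fun i _ => ?_
  have h1 := (continuous_posDiff i).measurable
  have h2 := (continuous_momSum i).measurable
  fun_prop

lemma abs_errBound_le {v : ℝ} (hv : 0 ≤ v) (r : PhaseSpace N) : |errBound v r| ≤ 2 * N := by
  have h0 : ∀ x : ℝ, 0 ≤ min 1 (v / x ^ 2) := fun x => le_min zero_le_one (by positivity)
  rw [errBound, abs_of_nonneg (Finset.sum_nonneg fun i _ => add_nonneg (h0 _) (h0 _))]
  calc ∑ i, (min 1 (v / posDiff i r ^ 2) + min 1 (v / momSum i r ^ 2))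
      ≤ ∑ _i : Fin N, (2 : ℝ) := Finset.sum_le_sum fun i _ => by
        linarith [min_le_left 1 (v / posDiff i r ^ 2), min_le_left 1 (v / momSum i r ^ 2)]
    _ = 2 * N := by simp [mul_comm]

lemma integrable_errBound {v : ℝ} (hv : 0 ≤ v) (σ : ℝ) :
    Integrable (errBound v) (gaussPrior N σ) :=
  Integrable.of_bound (measurable_errBound v).aestronglyMeasurable (2 * N)
    (Eventually.of_forall fun r => abs_errBound_le hv r)

lemma tendsto_integral_errBound (N : ℕ) (σ : ℝ) :
    Tendsto (fun s : ℝ => ∫ r, errBound (Real.exp (-2 * s)) r ∂gaussPrior N σ) atTop (𝓝 0) := by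
  suffices h : Tendsto (fun s : ℝ => ∫ r, errBound (Real.exp (-2 * s)) r ∂gaussPrior N σ) atTop
      (𝓝 (∫ _, (0 : ℝ) ∂gaussPrior N σ)) by rwa [integral_zero] at h
  refine tendsto_integral_filter_of_dominated_convergence (l := (atTop : Filter ℝ))
    (fun _ => 2 * (N : ℝ)) (Eventually.of_forall fun s => (measurable_errBound _).aestronglyMeasurable)
    (Eventually.of_forall fun s => Eventually.of_forall fun r =>
      abs_errBound_le (Real.exp_pos _).le r) (integrable_const _) (Eventually.of_forall fun r => ?_)
  have he : Tendsto (fun s : ℝ => Real.exp (-2 * s)) atTop (𝓝 0) :=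
    Real.tendsto_exp_atBot.comp (tendsto_id.const_mul_atTop_of_neg (by norm_num))
  -- Convergence holds at x = 0 as well, where the quotient is 0 by convention. The cap at 1 is what
  -- gives the constant dominating function.
  have h1 : ∀ x : ℝ, Tendsto (fun s : ℝ => min 1 (Real.exp (-2 * s) / x ^ 2)) atTop (𝓝 0) := by
    intro x
    have := (tendsto_const_nhds (x := (1 : ℝ))).min (he.div_const (x ^ 2))
    simpa using this
  have h2 := tendsto_finsetSum Finset.univ fun (i : Fin N) _ =>
    (h1 (posDiff i r)).add (h1 (momSum i r))
  simpa [errBound] using h2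

lemma one_sub_errBound_le (s : ℝ) {r : PhaseSpace N} (h1 : ∀ i, posDiff i r ≠ 0)
    (h2 : ∀ i, momSum i r ≠ 0) {S : Set (PhaseSpace N)} (hS : MeasurableSet S)
    (hr : ∀ z, posCount (r - z) = posCount r → z ∈ S) :
    1 - errBound (Real.exp (-2 * s)) r ≤ ((squeezedMeasurement N s).noise s).real S := by
  set μ := (squeezedMeasurement N s).noise s with hμ
  have hb : ∀ (x : PhaseSpace N) (t : ℝ), t ≠ 0 →
      x ⬝ᵥ ((squeezedMeasurement N s).noiseCov s).mulVec x = (Real.exp (-2 * s)).toNNReal →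
      μ.real {z | |t| ≤ |x ⬝ᵥ z|} ≤ min 1 (Real.exp (-2 * s) / t ^ 2) := by
    intro x t ht hx
    have h := (squeezedMeasurement N s).noise_real_le s x hx (abs_pos.2 ht)
    rw [sq_abs, Real.coe_toNNReal _ (Real.exp_pos _).le] at h
    exact le_min measureReal_le_one h
  -- An error requires the noise to exceed the signal in at least one of the 2N variables;
  -- Chebyshev's inequality bounds each of these events.
  have hc : Sᶜ ⊆ ⋃ i : Fin N, ({z | |posDiff i r| ≤ |posVec i ⬝ᵥ z|} ∪
      {z | |momSum i r| ≤ |momVec i ⬝ᵥ z|}) := by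
    intro z hz
    by_contra h
    simp only [Set.mem_iUnion, Set.mem_union, Set.mem_ofPred_eq, not_exists, not_or, not_le,
      posVec_dotProduct, momVec_dotProduct] at h
    exact hz (hr z (posCount_sub (fun i => (h i).1) fun i => (h i).2))
  have h3 : μ.real Sᶜ ≤ errBound (Real.exp (-2 * s)) r := by
    refine (measureReal_mono hc).trans ((measureReal_iUnion_fintype_le _).trans ?_)
    refine Finset.sum_le_sum fun i _ => (measureReal_union_le _ _).trans ?_
    exact add_le_add (hb _ _ (h1 i) (posVec_noiseCov s i)) (hb _ _ (h2 i) (momVec_noiseCov s i))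
  rw [probReal_compl_eq_one_sub hS] at h3
  linarith

/-- The squeezed measurement discriminates almost perfectly at large squeezing. -/
lemma exists_forall_le_success {σ : ℝ} (hσ : 0 < σ) (N : ℕ) {ε : ℝ} (hε : 0 < ε) :
    ∃ s₀ : ℝ, ∀ s : ℝ, s₀ ≤ s →
      ∃ (M : GaussianMeasurement N) (E : Set (PhaseSpace N)), MeasurableSet E ∧
        1 - ε ≤ M.success (rhoEven N σ s) (rhoOdd N σ s) E := by
  obtain ⟨s₀, hs₀⟩ := eventually_atTop.1
    ((tendsto_integral_errBound N σ).eventually_le_const hε)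
  -- The outcome is treated as if it were the displacement itself.
  refine ⟨s₀, fun s hs => ⟨squeezedMeasurement N s, {r | Even (posCount r)}, measurableSet_even, ?_⟩⟩
  set M := squeezedMeasurement N s with hM
  have hne1 := ae_all_iff.2 fun i : Fin N =>
    gaussPrior_absolutelyContinuous hσ (ae_ne_zero_of_ne_zero (posDiff_ne_zero i))
  have hne2 := ae_all_iff.2 fun i : Fin N =>
    gaussPrior_absolutelyContinuous hσ (ae_ne_zero_of_ne_zero (momSum_ne_zero i))
  have hlow : Integrable (fun r => 1 - errBound (Real.exp (-2 * s)) r) (gaussPrior N σ) :=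
    (integrable_const _).sub (integrable_errBound (Real.exp_pos _).le σ)
  have hi : ∀ E : Set (PhaseSpace N), MeasurableSet E →
      Integrable (fun r => (M.noise s).real {z | r - z ∈ E}) (gaussPrior N σ) := fun E hE =>
    Integrable.of_bound (M.measurable_noise_real s hE).aestronglyMeasurable 1
      (Eventually.of_forall fun r => by
        rw [Real.norm_of_nonneg measureReal_nonneg]
        exact measureReal_le_one)
  have hsub : ∀ (r : PhaseSpace N) {E : Set (PhaseSpace N)}, MeasurableSet E →
      MeasurableSet {z | r - z ∈ E} := fun r E hE => (measurable_const.sub measurable_id) hE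
  have hE : ∫ r in {r | Even (posCount r)}, (1 - errBound (Real.exp (-2 * s)) r) ∂gaussPrior N σ ≤
      ∫ r in {r | Even (posCount r)}, (M.noise s).real {z | r - z ∈ {r | Even (posCount r)}}
        ∂gaussPrior N σ := by
    refine setIntegral_mono_ae_restrict hlow.integrableOn (hi _ measurableSet_even).integrableOn ?_
    filter_upwards [ae_restrict_mem measurableSet_even, ae_restrict_of_ae hne1,
      ae_restrict_of_ae hne2] with r hr h1 h2
    refine one_sub_errBound_le s h1 h2 (hsub r measurableSet_even) fun z hz => ?_
    simp only [Set.mem_ofPred_eq, hz]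
    exact hr
  have hO : ∫ r in {r | Odd (posCount r)}, (1 - errBound (Real.exp (-2 * s)) r) ∂gaussPrior N σ ≤
      ∫ r in {r | Odd (posCount r)}, (M.noise s).real {z | r - z ∈ {r | Even (posCount r)}ᶜ}
        ∂gaussPrior N σ := by
    refine setIntegral_mono_ae_restrict hlow.integrableOn
      (hi _ measurableSet_even.compl).integrableOn ?_
    filter_upwards [ae_restrict_mem measurableSet_odd, ae_restrict_of_ae hne1,
      ae_restrict_of_ae hne2] with r hr h1 h2
    refine one_sub_errBound_le s h1 h2 (hsub r measurableSet_even.compl) fun z hz => ?_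
    rw [compl_even]
    simp only [Set.mem_ofPred_eq, hz]
    exact hr
  have hsum := integral_add_compl measurableSet_even hlow
  rw [compl_even, integral_sub (integrable_const _) (integrable_errBound (Real.exp_pos _).le σ),
    integral_const, probReal_univ, one_smul] at hsum
  rw [M.success_eq hσ s measurableSet_even]
  linarith [hs₀ s hs]

end GaussianHiding

end

/-! ### The theorem. -/

open GaussianHiding

theorem theorem3 (σ : ℝ) (hσ : 0 < σ) :
    -- the two operators are states
    (∀ N : ℕ, 1 ≤ N → ∀ s : ℝ, IsDensity (rhoEven N σ s) ∧ IsDensity (rhoOdd N σ s)) ∧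
    -- nonlocal Gaussian measurements distinguish them almost perfectly for large squeezing
    (∀ N : ℕ, 1 ≤ N → ∀ ε : ℝ, 0 < ε → ∃ s₀ : ℝ, ∀ s : ℝ, s₀ ≤ s →
      ∃ (M : GaussianMeasurement N) (E : Set (PhaseSpace N)), MeasurableSet E ∧
        1 - ε ≤ M.success (rhoEven N σ s) (rhoOdd N σ s) E) ∧
    -- PPT Gaussian measurements are no better than guessing for many copies, at any squeezing
    (∀ ε : ℝ, 0 < ε → ∃ N₀ : ℕ, ∀ N : ℕ, 1 ≤ N → N₀ ≤ N → ∀ (s : ℝ)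
      (M : GaussianMeasurement N), M.PPT → ∀ E : Set (PhaseSpace N), MeasurableSet E →
        |M.success (rhoEven N σ s) (rhoOdd N σ s) E - 1 / 2| ≤ ε) := by
  refine ⟨fun N hN s => ⟨isDensity_rhoEven hσ hN s, isDensity_rhoOdd hσ hN s⟩,
    fun N _ _ hε => exists_forall_le_success hσ N hε, fun _ hε => exists_forall_PPT_success hσ hε⟩
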